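/- Let $d\ge 1$ and let $\mathbb{H}^d=\mathbb{C}^d\times\mathbb{R}$ be the Heisenberg group with points $(z,t)$, $z=x+iy$, Lebesgue measure, Koranyi norm $\rho=|(z,t)|_{\mathbb H}=(|z|^4+t^2)^{1/4}$, horizontal fields $X_j=\partial_{x_j}+2y_j\partial_t$, $Y_j=\partial_{y_j}-2x_j\partial_t$, horizontal gradient $\nabla_{\mathbb H}=(X_1,\dots,X_d,Y_1,\dots,Y_d)$ and sublaplacian $\mathcal L=-\sum_j(X_j^2+Y_j^2)$. Write $\|\cdot\|$ for the $L^2(\mathbb{H}^d)$-norm, $H^1(\mathbb H^d)=\{u\in L^2:\nabla_{\mathbb H}u\in L^2\}$ (weak derivatives), $\partial_\rho=\rho^{-1}(z\cdot\nabla_z+2t\partial_t)$ and $[\cdot]_+=\max\{0,\cdot\}$. A function is radial if it has the form $u(z,t)=u_0(|(z,t)|_{\mathbb H})$ (almost everywhere). Let $V\ge 0$ be a real function in $L^1_{\rm loc}(\mathbb H^d)\cap W^{1,d}_{\rm loc}(\mathbb H^d)$, and suppose that for some constant $0\le b<1$ $$\int_{\mathbb H^d}[\partial_\rho(\rho V)]_+|\psi|^2\le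 b^2\int_{\mathbb H^d}|\nabla_{\mathbb H}\psi|^2\qquad\text{for all }\psi\in H^1(\mathbb H^d),$$ where $\partial_\rho(\rho V)=V+\rho\,\partial_\rho V$. Let $\lambda=\lambda_1+i\lambda_2\in\mathbb C$, and let $u\in H^1(\mathbb H^d)$ be a radial weak solution of $-\mathcal L u-Vu+\lambda u=f$; that is, $Vu,f\in L^1_{\rm loc}$ and $$-\langle\nabla_{\mathbb H}v,\nabla_{\mathbb H}u\rangle-\langle v,Vu\rangle+\lambda\langle v,u\rangle=\langle v,f\rangle ,\qquad \langle v,w\rangle=\int_{\mathbb H^d}\overline{v}\,w,$$ for all $v\in C_c^\infty(\mathbb H^d)$ (in particular this holds if the identity holds for all $v\in H^1(\mathbb H^d)$). Set $$u^-=e^{-i\psi_\lambda}u,\qquad \psi_\lambda(z,t)=\sqrt{\tfrac d2}\,\frac{\Gamma(d/2)}{\Gamma((d+1)/2)}\,\operatorname{sgn}(\lambda_2)\sqrt{|\lambda_1|}\,|(z,t)|_{\mathbb H},$$ with $\operatorname{sgn}(w)=w/|w|$ for $w\ne0$ and $\operatorname{sgn}(0)=1$. Then for every $\delta>0$ $$\|\nabla_{\mathbb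 H}u\|\le\frac{1+1/\delta}{d}\,\Big\|\frac{|(z,t)|_{\mathbb H}^2}{|z|}f\Big\|\quad\text{if }|\lambda_2|>\delta\lambda_1,$$ $$\|\nabla_{\mathbb H}u^-\|\le K_{d,b}(\delta)\,\Big\|\frac{|(z,t)|_{\mathbb H}^2}{|z|}f\Big\|\quad\text{if }|\lambda_2|\le\delta\lambda_1,$$ where $$K_{d,b}(\delta)=\min_{\gamma>0}\left(\frac{8d+2+\gamma\sqrt\delta}{4d(1-b^2)}+\sqrt{\left[\frac{8d+2+\gamma\sqrt\delta}{4d(1-b^2)}\right]^2+\frac{\sqrt\delta}{2\gamma(1-b^2)}}\right).$$ In particular, the uniform estimate $$\Big\|\frac{|z|}{|(z,t)|_{\mathbb H}^2}u\Big\|\le\kappa_{d,b}\,\Big\|\frac{|(z,t)|_{\mathbb H}^2}{|z|}f\Big\|,\qquad \kappa_{d,b}=\min_{\delta>0}\max\left\{\frac{1+1/\delta}{d^2},\frac{K_{d,b}(\delta)}{d}\right\},$$ holds. Both minima are attained. (The estimates are trivial if the norm of $f$ on the right is infinite.) -/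

import Mathlib

open MeasureTheory Set
open scoped ENNReal ContDiff

noncomputable section

namespace Heisenberg

/-- The Heisenberg group as the space `ℂ^d × ℝ` of points `(z, t)`; its Haar measure is the Lebesgue
measure `volume`. -/
abbrev Heis (d : ℕ) : Type := (Fin d → ℂ) × ℝ

/-- The Euclidean norm `|z|` on `ℂ^d`. -/
def zNorm {d : ℕ} (p : Heis d) : ℝ := Real.sqrt (∑ j, ‖p.1 j‖ ^ 2)

/-- The Koranyi norm `(|z|⁴ + t²)^(1/4)`. -/
def koranyi {d : ℕ} (p : Heis d) : ℝ := (zNorm p ^ 4 + p.2 ^ 2) ^ (1 / 4 : ℝ)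

/-- The horizontal left-invariant vector fields at a point, as tangent vectors:
`Sum.inl j` is `X_j = ∂_{x_j} + 2 y_j ∂_t`, and `Sum.inr j` is `Y_j = ∂_{y_j} - 2 x_j ∂_t`. -/
def hField {d : ℕ} : Fin d ⊕ Fin d → Heis d → Heis d
  | Sum.inl j, p => (Pi.single j 1, 2 * (p.1 j).im)
  | Sum.inr j, p => (Pi.single j Complex.I, -2 * (p.1 j).re)

/-- The classical horizontal derivative of a differentiable function along `X_j` or `Y_j`. -/
def hDeriv {d : ℕ} {F : Type*} [NormedAddCommGroup F] [NormedSpace ℝ F]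
    (k : Fin d ⊕ Fin d) (φ : Heis d → F) (p : Heis d) : F :=
  fderiv ℝ φ p (hField k p)

/-- The classical horizontal gradient `(X_1, …, X_d, Y_1, …, Y_d) v`. -/
def hGrad {d : ℕ} (v : Heis d → ℂ) (p : Heis d) : EuclideanSpace ℂ (Fin d ⊕ Fin d) :=
  WithLp.toLp 2 fun k => hDeriv k v p

/-- `g` is the weak horizontal gradient of `u`. The fields `X_j`, `Y_j` are divergence free, so
their formal adjoints are `-X_j`, `-Y_j`. -/
def HasWeakHGrad {d : ℕ} (u : Heis d → ℂ) (g : Heis d → EuclideanSpace ℂ (Fin d ⊕ Fin d)) : Prop :=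
  LocallyIntegrable u ∧ LocallyIntegrable g ∧
    ∀ φ : Heis d → ℝ, ContDiff ℝ ∞ φ → HasCompactSupport φ → ∀ k : Fin d ⊕ Fin d,
      ∫ p, hDeriv k φ p • u p = - ∫ p, φ p • g p k

/-- The Sobolev space `H¹` of the Heisenberg group: `u` and its weak horizontal gradient are
square integrable. -/
def MemH1 {d : ℕ} (u : Heis d → ℂ) : Prop :=
  MemLp u 2 ∧ ∃ g, HasWeakHGrad u g ∧ MemLp g 2

/-- The `L²` norm of the weak horizontal gradient. The weak gradient is unique up to null sets, so
the infimum is over one value; it is `∞` if there is no weak gradient. -/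
def hGradNorm {d : ℕ} (u : Heis d → ℂ) : ℝ≥0∞ :=
  ⨅ (g : Heis d → EuclideanSpace ℂ (Fin d ⊕ Fin d)) (_ : HasWeakHGrad u g), eLpNorm g 2

/-- `u` is radial with respect to the Koranyi norm (as a class of functions). -/
def IsRadial {d : ℕ} (u : Heis d → ℂ) : Prop :=
  ∃ u₀ : ℝ → ℂ, ∀ᵐ p, u p = u₀ (koranyi p)

/-- `D` is the full weak derivative of the real function `V`: `D p e` is the weak derivative
of `V` in the constant direction `e` of `ℂ^d × ℝ`. -/
def HasWeakFDeriv {d : ℕ} (V : Heis d → ℝ) (D : Heis d → Heis d →L[ℝ] ℝ) : Prop :=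
  LocallyIntegrable V ∧ LocallyIntegrable D ∧
    ∀ φ : Heis d → ℝ, ContDiff ℝ ∞ φ → HasCompactSupport φ → ∀ e : Heis d,
      ∫ p, V p * fderiv ℝ φ p e = - ∫ p, D p e * φ p

/-- Local `L^q` integrability. -/
def MemLpLoc {d : ℕ} {F : Type*} [NormedAddCommGroup F] (h : Heis d → F) (q : ℝ≥0∞) : Prop :=
  ∀ K : Set (Heis d), IsCompact K → MemLp h q (volume.restrict K)

/-- `V` belongs to the local Sobolev space `W^{1,q}_loc`, with weak derivative `D`. -/
def MemW1Loc {d : ℕ} (V : Heis d → ℝ) (D : Heis d → Heis d →L[ℝ] ℝ) (q : ℝ≥0∞) : Prop :=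
  HasWeakFDeriv V D ∧ MemLpLoc V q ∧ MemLpLoc D q

/-- The radial derivative `∂_ρ V = |(z,t)|⁻¹ (z · ∇_z + 2 t ∂_t) V` of a function with weak
derivative `D`. -/
def radialDeriv {d : ℕ} (D : Heis d → Heis d →L[ℝ] ℝ) (p : Heis d) : ℝ :=
  (koranyi p)⁻¹ * D p (p.1, 2 * p.2)

/-- `∂_ρ (ρ V) = V + ρ ∂_ρ V`, where `ρ` is the Koranyi norm and `D` the weak derivative of `V`. -/
def radialDerivMul {d : ℕ} (V : Heis d → ℝ) (D : Heis d → Heis d →L[ℝ] ℝ) (p : Heis d) : ℝ :=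
  V p + koranyi p * radialDeriv D p

/-- `u` is an `H¹` weak solution of `-𝓛 u - V u + lam u = f`. The identity
`-⟨∇v, ∇u⟩ - ⟨v, V u⟩ + lam ⟨v, u⟩ = ⟨v, f⟩` is required for the smooth compactly supported
functions `v`, so every solution in the sense of all `v ∈ H¹` is one in this sense. -/
def IsWeakSolution {d : ℕ} (V : Heis d → ℝ) (lam : ℂ) (f u : Heis d → ℂ) : Prop :=
  MemLp u 2 ∧ LocallyIntegrable (fun p => (V p : ℂ) * u p) ∧ LocallyIntegrable f ∧
    ∃ g : Heis d → EuclideanSpace ℂ (Fin d ⊕ Fin d), HasWeakHGrad u g ∧ MemLp g 2 ∧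
      ∀ v : Heis d → ℂ, ContDiff ℝ ∞ v → HasCompactSupport v →
        - (∫ p, inner ℂ (hGrad v p) (g p))
          - (∫ p, (starRingEnd ℂ) (v p) * ((V p : ℂ) * u p))
          + lam * (∫ p, (starRingEnd ℂ) (v p) * u p)
        = ∫ p, (starRingEnd ℂ) (v p) * f p

/-- The sign function with value `1` at `0`. -/
def sgn (w : ℝ) : ℝ := if w = 0 then 1 else w / |w|

/-- The phase `ψ`. -/
def phase {d : ℕ} (lam : ℂ) (p : Heis d) : ℝ :=
  Real.sqrt ((d : ℝ) / 2) * (Real.Gamma ((d : ℝ) / 2) / Real.Gamma (((d : ℝ) + 1) / 2))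
    * sgn lam.im * Real.sqrt |lam.re| * koranyi p

/-- `u⁻ = e^{-iψ} u`. -/
def uMinus {d : ℕ} (lam : ℂ) (u : Heis d → ℂ) (p : Heis d) : ℂ :=
  Complex.exp (-(Complex.I * (phase lam p : ℂ))) * u p

/-- The function of `γ` whose minimum over `γ > 0` is `K_{d,b}(δ)`. -/
def kFun (d : ℕ) (b δ γ : ℝ) : ℝ :=
  (8 * d + 2 + γ * Real.sqrt δ) / (4 * d * (1 - b ^ 2))
    + Real.sqrt (((8 * d + 2 + γ * Real.sqrt δ) / (4 * d * (1 - b ^ 2))) ^ 2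
        + Real.sqrt δ / (2 * γ * (1 - b ^ 2)))

/-- `K_{d,b}(δ)`. -/
def K (d : ℕ) (b δ : ℝ) : ℝ := sInf (kFun d b δ '' Ioi 0)

/-- The function of `δ` whose minimum over `δ > 0` is `κ_{d,b}`. -/
def kappaFun (d : ℕ) (b δ : ℝ) : ℝ := max ((1 + 1 / δ) / (d : ℝ) ^ 2) (K d b δ / d)

/-- `κ_{d,b}`. -/
def kappa (d : ℕ) (b : ℝ) : ℝ := sInf (kappaFun d b '' Ioi 0)

/-- The weighted norm `‖(|(z,t)|² / |z|) f‖` in `L²`. -/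
def sourceNorm {d : ℕ} (f : Heis d → ℂ) : ℝ≥0∞ :=
  eLpNorm (fun p => (koranyi p ^ 2 / zNorm p) • f p) 2

/-- The weighted norm `‖(|z| / |(z,t)|²) u‖` in `L²`. -/
def hardyNorm {d : ℕ} (u : Heis d → ℂ) : ℝ≥0∞ :=
  eLpNorm (fun p => (zNorm p / koranyi p ^ 2) • u p) 2

end Heisenberg

end

/-! A radial solution satisfies an ordinary differential equation, and the estimates are
one-dimensional multiplier estimates. Let S be the mass of the Koranyi unit sphere and κ the
integral of |z|² over it. The horizontal gradient satisfies |∇ρ⁴|² = 16|z|²ρ⁴, so u = v(ρ) has |∇u|²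
= |v'(ρ)|²|z|²/ρ², and polar coordinates with weight r^(2d+1) give ‖∇u‖² = κ ∫ r^(2d+1)|v'|².
Testing the equation with radial functions gives v'' + (2d+1)/r v' - W v + (S/κ) λ v = G, where κW
and κG are the integrals of V and f over Koranyi spheres; neither V nor f has to be radial
(`exists_radialEq`). Cauchy–Schwarz on spheres bounds √κ times the norm of rG by the weighted norm
of f. The phase constant is exactly √(S/κ) (`sqrt_mul_gamma_ratio`).

On the half-line, let X and M be the norms of v' and rG in L²(r^(2d+1) dr), and write (S/κ)λ = α +
iε. The Hardy inequality ‖v/r‖ ≤ X/d gives ∫ r^(2d+1)|v||G| ≤ XM/d. The imaginary part of the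
equation times the conjugate of v bounds |ε|‖v‖² by this integral, and the real part bounds X². If
δα ≤ |ε| they combine to X ≤ (1+1/δ)M/d (`RadialEq.sectorial`).

If |ε| ≤ δα, the factor e^(-ikr) with k² = α removes α; k is given the sign of ε, so that ε = τk
with τ ≥ 0. A Morawetz multiplier, combining the conjugates of r p, v and r v, where p is the
derivative of the modulated function (again called v, with X the norm of p), yields (1-b²)X² ≤
M((4d+1)X/d + T) with T = τ‖v‖ and T² ≤ δXM/d (`RadialEq.morawetz`). The potential enters through a
term of good sign and through (W + rW')|v|², which the subordination hypothesis controls when tested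
on a radial function (`integral_potential_le`). Young's inequality with parameter γ and the solution
of a quadratic inequality produce K (`le_K_mul`). The uniform estimate is Hardy again, with the
better of the two cases at an optimal δ.

Two points need care. All functions are only locally absolutely continuous on (0,∞), so boundary
terms are discarded only along sequences: if e is integrable, r e(r) is small at some points near 0
and near ∞. And a radial function built from the half-line must be shown to have a weak gradient
across the origin (`hasWeakHGrad_radial`), since the hypothesis on V is tested on it and the
gradient norm is bounded through it. -/

namespace HalfLine

/-! ### Calculus of locally absolutely continuous functions on the half-line. -/

/-- `f` is locally absolutely continuous on `(0, ∞)` with derivative `g`. -/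
structure IsPrim {E : Type*} [NormedAddCommGroup E] [NormedSpace ℝ E] (f g : ℝ → E) : Prop where
  int : ∀ ⦃a b : ℝ⦄, 0 < a → 0 < b → IntervalIntegrable g volume a b
  eq : ∀ ⦃a b : ℝ⦄, 0 < a → 0 < b → ∫ x in a..b, g x = f b - f a

namespace IsPrim

variable {E F : Type*} [NormedAddCommGroup E] [NormedSpace ℝ E]
  [NormedAddCommGroup F] [NormedSpace ℝ F]

theorem uIcc_pos {a b x : ℝ} (ha : 0 < a) (hb : 0 < b) (hx : x ∈ uIcc a b) : 0 < x :=
  lt_of_lt_of_le (lt_min ha hb) hx.1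

theorem continuousOn {f g : ℝ → E} (h : IsPrim f g) : ContinuousOn f (Ioi 0) := by
  intro x hx
  have hx : 0 < x := hx
  have h1 := intervalIntegral.continuousOn_primitive_interval'
    (h.int (half_pos hx) (by linarith : (0 : ℝ) < 2 * x)) left_mem_uIcc
  have h2 : ContinuousOn f (uIcc (x / 2) (2 * x)) := by
    refine (h1.const_add (f (x / 2))).congr fun y hy => ?_
    have hy' : 0 < y := uIcc_pos (half_pos hx) (by linarith) hy
    simp only [h.eq (half_pos hx) hy']; abel
  have : uIcc (x / 2) (2 * x) ∈ nhds x := by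
    rw [uIcc_of_le (by linarith)]; exact Icc_mem_nhds (by linarith) (by linarith)
  exact (h2.continuousAt this).continuousWithinAt

theorem congr_deriv {f g g' : ℝ → E} (h : IsPrim f g) (hg : ∀ᵐ x, 0 < x → g x = g' x) :
    IsPrim f g' := by
  have key : ∀ ⦃a b : ℝ⦄, 0 < a → 0 < b → ∀ᵐ x, x ∈ uIoc a b → g x = g' x := by
    intro a b ha hb
    filter_upwards [hg] with x hx hx'
    exact hx (uIcc_pos ha hb (uIoc_subset_uIcc hx'))
  refine ⟨fun a b ha hb => (h.int ha hb).congr_ae ?_, fun a b ha hb => ?_⟩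
  · exact (ae_restrict_iff' measurableSet_uIoc).2 (key ha hb)
  · rw [← h.eq ha hb]
    refine intervalIntegral.integral_congr_ae ?_
    filter_upwards [key ha hb] with x hx hx' using (hx hx').symm

theorem congr_deriv' {f g g' : ℝ → E} (h : IsPrim f g) (hg : ∀ x, 0 < x → g x = g' x) :
    IsPrim f g' := h.congr_deriv (Filter.Eventually.of_forall hg)

theorem congr {f f' g : ℝ → E} (h : IsPrim f g) (hf : ∀ x, 0 < x → f x = f' x) :
    IsPrim f' g :=
  ⟨h.int, fun a b ha hb => by rw [h.eq ha hb, hf a ha, hf b hb]⟩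

theorem add {f g f' g' : ℝ → E} (h : IsPrim f g) (h' : IsPrim f' g') :
    IsPrim (fun x => f x + f' x) (fun x => g x + g' x) :=
  ⟨fun _ _ ha hb => (h.int ha hb).add (h'.int ha hb), fun a b ha hb => by
    rw [intervalIntegral.integral_add (h.int ha hb) (h'.int ha hb), h.eq ha hb, h'.eq ha hb]
    abel⟩

theorem sub {f g f' g' : ℝ → E} (h : IsPrim f g) (h' : IsPrim f' g') :
    IsPrim (fun x => f x - f' x) (fun x => g x - g' x) :=
  ⟨fun _ _ ha hb => (h.int ha hb).sub (h'.int ha hb), fun a b ha hb => by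
    rw [intervalIntegral.integral_sub (h.int ha hb) (h'.int ha hb), h.eq ha hb, h'.eq ha hb]
    abel⟩

theorem comp_clm [CompleteSpace E] [CompleteSpace F] {f g : ℝ → E} (h : IsPrim f g)
    (L : E →L[ℝ] F) :
    IsPrim (fun x => L (f x)) (fun x => L (g x)) := by
  refine ⟨fun a b ha hb => ⟨L.integrable_comp (h.int ha hb).1, L.integrable_comp (h.int ha hb).2⟩,
    fun a b ha hb => ?_⟩
  rw [ContinuousLinearMap.intervalIntegral_comp_comm _ (h.int ha hb), h.eq ha hb, map_sub]

theorem re {f g : ℝ → ℂ} (h : IsPrim f g) : IsPrim (fun x => (f x).re) (fun x => (g x).re) :=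
  h.comp_clm Complex.reCLM

theorem im {f g : ℝ → ℂ} (h : IsPrim f g) : IsPrim (fun x => (f x).im) (fun x => (g x).im) :=
  h.comp_clm Complex.imCLM

theorem ofReal {f g : ℝ → ℝ} (h : IsPrim f g) :
    IsPrim (fun x => (f x : ℂ)) (fun x => (g x : ℂ)) :=
  h.comp_clm Complex.ofRealCLM

theorem conj {f g : ℝ → ℂ} (h : IsPrim f g) :
    IsPrim (fun x => (starRingEnd ℂ) (f x)) (fun x => (starRingEnd ℂ) (g x)) :=
  h.comp_clm (Complex.conjCLE : ℂ →L[ℝ] ℂ)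

theorem const_mul {f g : ℝ → ℝ} (h : IsPrim f g) (c : ℝ) :
    IsPrim (fun x => c * f x) (fun x => c * g x) :=
  h.comp_clm (c • ContinuousLinearMap.id ℝ ℝ)

theorem of_hasDerivAt [CompleteSpace E] {f g : ℝ → E} (h : ∀ x, 0 < x → HasDerivAt f (g x) x)
    (hg : ContinuousOn g (Ioi 0)) : IsPrim f g := by
  have key : ∀ ⦃a b : ℝ⦄, 0 < a → 0 < b → IntervalIntegrable g volume a b := fun a b ha hb =>
    (hg.mono fun x hx => uIcc_pos ha hb hx).intervalIntegrable
  exact ⟨key, fun a b ha hb => intervalIntegral.integral_eq_sub_of_hasDerivAt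
    (fun x hx => h x (uIcc_pos ha hb hx)) (key ha hb)⟩

/-- Integration by parts for absolutely continuous functions applies to the primitives of g and G
based at a; the constants f(a) and F(a) are then restored by linearity. -/
theorem mulReal {f g F G : ℝ → ℝ} (h : IsPrim f g) (H : IsPrim F G) :
    IsPrim (fun x => f x * F x) (fun x => g x * F x + f x * G x) := by
  have c1 : ∀ ⦃a b : ℝ⦄, 0 < a → 0 < b → IntervalIntegrable (fun x => g x * F x) volume a b :=
    fun a b ha hb => (h.int ha hb).mul_continuousOn
      (H.continuousOn.mono fun x hx => uIcc_pos ha hb hx)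
  have c2 : ∀ ⦃a b : ℝ⦄, 0 < a → 0 < b → IntervalIntegrable (fun x => f x * G x) volume a b :=
    fun a b ha hb => (H.int ha hb).continuousOn_mul
      (h.continuousOn.mono fun x hx => uIcc_pos ha hb hx)
  refine ⟨fun a b ha hb => (c1 ha hb).add (c2 ha hb), fun a b ha hb => ?_⟩
  set f1 : ℝ → ℝ := fun x => ∫ t in a..x, g t with hf1
  set F1 : ℝ → ℝ := fun x => ∫ t in a..x, G t with hF1
  have e1 : ∀ x ∈ uIcc a b, f x = f a + f1 x := fun x hx => by
    rw [hf1]; simp only; rw [h.eq ha (uIcc_pos ha hb hx)]; ring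
  have e2 : ∀ x ∈ uIcc a b, F x = F a + F1 x := fun x hx => by
    rw [hF1]; simp only; rw [H.eq ha (uIcc_pos ha hb hx)]; ring
  have ac1 := (h.int ha hb).absolutelyContinuousOnInterval_intervalIntegral (left_mem_uIcc)
  have ac2 := (H.int ha hb).absolutelyContinuousOnInterval_intervalIntegral (left_mem_uIcc)
  have k := ac1.integral_deriv_mul_eq_sub ac2
  have i1 : IntervalIntegrable (fun x => g x * F1 x + f1 x * G x) volume a b :=
    ((h.int ha hb).mul_continuousOn ac2.continuousOn).add
      ((H.int ha hb).continuousOn_mul ac1.continuousOn)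
  have k2 : ∫ x in a..b, (g x * F1 x + f1 x * G x) = f1 b * F1 b := by
    have : f1 b * F1 b = f1 b * F1 b - f1 a * F1 a := by simp [hf1]
    rw [this, ← k]
    refine intervalIntegral.integral_congr_ae ?_
    filter_upwards [(h.int ha hb).ae_hasDerivAt_integral, (H.int ha hb).ae_hasDerivAt_integral]
      with x hx hx' hm
    rw [(hx (uIoc_subset_uIcc hm) a left_mem_uIcc).deriv,
      (hx' (uIoc_subset_uIcc hm) a left_mem_uIcc).deriv]
  have k3 : ∫ x in a..b, (g x * F x + f x * G x)
      = ∫ x in a..b, ((g x * F1 x + f1 x * G x) + (F a * g x + f a * G x)) := by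
    refine intervalIntegral.integral_congr fun x hx => ?_
    rw [e1 x hx, e2 x hx]; ring
  rw [k3, intervalIntegral.integral_add i1 (((h.int ha hb).const_mul _).add
    ((H.int ha hb).const_mul _)), k2, intervalIntegral.integral_add ((h.int ha hb).const_mul _)
    ((H.int ha hb).const_mul _), intervalIntegral.integral_const_mul,
    intervalIntegral.integral_const_mul, h.eq ha hb, H.eq ha hb, e1 b right_mem_uIcc,
    e2 b right_mem_uIcc]
  ring

theorem complex_mk {f1 g1 f2 g2 : ℝ → ℝ} (h1 : IsPrim f1 g1) (h2 : IsPrim f2 g2) :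
    IsPrim (fun x => (⟨f1 x, f2 x⟩ : ℂ)) (fun x => (⟨g1 x, g2 x⟩ : ℂ)) := by
  have := h1.ofReal.add (h2.ofReal.comp_clm (Complex.I • ContinuousLinearMap.id ℝ ℂ))
  refine (this.congr fun x _ => ?_).congr_deriv' fun x _ => ?_ <;>
  · apply Complex.ext <;> simp

theorem mul {f g F G : ℝ → ℂ} (h : IsPrim f g) (H : IsPrim F G) :
    IsPrim (fun x => f x * F x) (fun x => g x * F x + f x * G x) := by
  have := complex_mk ((h.re.mulReal H.re).sub (h.im.mulReal H.im))
    ((h.re.mulReal H.im).add (h.im.mulReal H.re))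
  refine (this.congr fun x _ => ?_).congr_deriv' fun x _ => ?_ <;>
  · apply Complex.ext <;> simp <;> ring

theorem pow (n : ℕ) : IsPrim (fun x : ℝ => x ^ n) (fun x => n * x ^ (n - 1)) :=
  of_hasDerivAt (fun x _ => hasDerivAt_pow n x) (by fun_prop)

end IsPrim

/-! ### Weak derivatives on the half-line and their continuous representatives. -/

/-- `f` has weak derivative `g` on `(0, ∞)`. -/
def IsWeakPrim (f g : ℝ → ℂ) : Prop :=
  LocallyIntegrableOn f (Ioi 0) ∧ LocallyIntegrableOn g (Ioi 0) ∧
    ∀ θ : ℝ → ℝ, ContDiff ℝ ∞ θ → HasCompactSupport θ → tsupport θ ⊆ Ioi 0 →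
      ∫ x, deriv θ x • f x = - ∫ x, θ x • g x

theorem locallyIntegrableOn_intervalIntegrable {E : Type*} [NormedAddCommGroup E] {g : ℝ → E}
    (hg : LocallyIntegrableOn g (Ioi 0)) {a b : ℝ} (ha : 0 < a) (hb : 0 < b) :
    IntervalIntegrable g volume a b := by
  have := hg.integrableOn_compact_subset (t := uIcc a b) (fun x hx => IsPrim.uIcc_pos ha hb hx)
    isCompact_uIcc
  exact this.intervalIntegrable

theorem isPrim_primitive {g : ℝ → ℂ} (hg : LocallyIntegrableOn g (Ioi 0)) (c : ℂ) :
    IsPrim (fun x => c + ∫ t in (1 : ℝ)..x, g t) g := by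
  have := fun {a b : ℝ} => locallyIntegrableOn_intervalIntegrable hg (a := a) (b := b)
  refine ⟨fun a b ha hb => this ha hb, fun a b ha hb => ?_⟩
  rw [add_sub_add_left_eq_sub, intervalIntegral.integral_interval_sub_left (this one_pos hb)
    (this one_pos ha)]

/-- A compactly supported subset of `(0, ∞)` lies in some `(a, b)` with `0 < a ≤ b`. -/
theorem exists_Ioo_of_tsupport {E : Type*} [NormedAddCommGroup E] {θ : ℝ → E}
    (h1 : HasCompactSupport θ) (h2 : tsupport θ ⊆ Ioi 0) :
    ∃ a b : ℝ, 0 < a ∧ a < b ∧ tsupport θ ⊆ Ioo a b := by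
  rcases (tsupport θ).eq_empty_or_nonempty with h | h
  · exact ⟨1, 2, one_pos, one_lt_two, by simp [h]⟩
  · obtain ⟨x, hx, hx'⟩ := h1.isCompact.exists_isLeast h
    obtain ⟨y, hy, hy'⟩ := h1.isCompact.exists_isGreatest h
    have hx0 : 0 < x := h2 hx
    have hxy : x ≤ y := hx' hy
    exact ⟨x / 2, y + 1, half_pos hx0, by linarith, fun z hz =>
      ⟨by linarith [hx' hz], by linarith [hy' hz]⟩⟩

theorem integral_eq_interval {E : Type*} [NormedAddCommGroup E] [NormedSpace ℝ E] {φ : ℝ → E}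
    {a b : ℝ} (hab : a < b) (h : ∀ x, x ∉ Ioo a b → φ x = 0) :
    ∫ x, φ x = ∫ x in a..b, φ x := by
  rw [intervalIntegral.integral_of_le hab.le]
  refine (setIntegral_eq_integral_of_forall_compl_eq_zero fun x hx => h x fun hx' => hx ?_).symm
  exact Ioo_subset_Ioc_self hx'

theorem integrable_smul_of_tsupport {E : Type*} [NormedAddCommGroup E] [NormedSpace ℝ E]
    {φ : ℝ → ℝ} {T : ℝ → E} (h1 : Continuous φ) (h2 : HasCompactSupport φ)
    (h3 : tsupport φ ⊆ Ioi 0) (hT : LocallyIntegrableOn T (Ioi 0)) :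
    Integrable (fun x => φ x • T x) := by
  obtain ⟨a, b, ha, hab, hs⟩ := exists_Ioo_of_tsupport h2 h3
  have hi : IntegrableOn T (Icc a b) :=
    hT.integrableOn_compact_subset (fun x hx => lt_of_lt_of_le ha hx.1) isCompact_Icc
  have h4 : IntegrableOn (fun x => φ x • T x) (Icc a b) :=
    hi.continuousOn_smul h1.continuousOn isCompact_Icc
  refine (integrableOn_iff_integrable_of_support_subset ?_).1 h4
  intro x hx
  have : φ x ≠ 0 := fun h0 => hx (by simp [h0])
  exact Ioo_subset_Icc_self (hs (subset_tsupport _ this))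

/-- The product rule for θf, integrated over an interval containing the support of θ, has no
boundary terms. -/
theorem IsPrim.isWeakPrim {f g : ℝ → ℂ} (h : IsPrim f g)
    (hg : LocallyIntegrableOn g (Ioi 0)) : IsWeakPrim f g := by
  refine ⟨h.continuousOn.locallyIntegrableOn measurableSet_Ioi, hg, fun θ h1 h2 h3 => ?_⟩
  obtain ⟨a, b, ha, hab, hs⟩ := exists_Ioo_of_tsupport h2 h3
  have hb := ha.trans hab
  have z0 : ∀ x, x ∉ Ioo a b → θ x = 0 := fun x hx =>
    image_eq_zero_of_notMem_tsupport fun h => hx (hs h)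
  have z1 : ∀ x, x ∉ Ioo a b → deriv θ x = 0 := fun x hx => by
    by_contra h
    exact hx (hs (tsupport_deriv_subset (subset_tsupport _ h)))
  have hθ : IsPrim (fun x => (θ x : ℂ)) (fun x => ((deriv θ x : ℝ) : ℂ)) :=
    (IsPrim.of_hasDerivAt (fun x _ => (h1.differentiable (by simp) x).hasDerivAt)
      (h1.continuous_deriv (by simp)).continuousOn).ofReal
  have k := (hθ.mul h).eq ha hb
  rw [z0 a (by simp), z0 b (by simp)] at k
  have i1 : IntervalIntegrable (fun x => ((deriv θ x : ℝ) : ℂ) * f x) volume a b :=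
    (hθ.int ha hb).mul_continuousOn (h.continuousOn.mono fun x hx => IsPrim.uIcc_pos ha hb hx)
  have i2 : IntervalIntegrable (fun x => (θ x : ℂ) * g x) volume a b :=
    (h.int ha hb).continuousOn_mul (hθ.continuousOn.mono fun x hx => IsPrim.uIcc_pos ha hb hx)
  rw [intervalIntegral.integral_add i1 i2] at k
  rw [integral_eq_interval hab (fun x hx => by rw [z1 x hx, zero_smul]),
    integral_eq_interval hab (fun x hx => by rw [z0 x hx, zero_smul])]
  simp only [Complex.real_smul]
  simp only [Complex.ofReal_zero, zero_mul, sub_zero] at k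
  exact eq_neg_of_add_eq_zero_left k

theorem contDiff_primitive {φ : ℝ → ℝ} (hφ : ContDiff ℝ ∞ φ) :
    ContDiff ℝ ∞ (fun x => ∫ t in (0 : ℝ)..x, φ t) ∧
      ∀ x, HasDerivAt (fun x => ∫ t in (0 : ℝ)..x, φ t) (φ x) x := by
  have hd : ∀ x, HasDerivAt (fun x => ∫ t in (0 : ℝ)..x, φ t) (φ x) x := fun x =>
    (hφ.continuous.integral_hasStrictDerivAt 0 x).hasDerivAt
  refine ⟨?_, hd⟩
  rw [contDiff_infty_iff_deriv]
  refine ⟨fun x => (hd x).differentiableAt, ?_⟩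
  rwa [show deriv (fun x => ∫ t in (0 : ℝ)..x, φ t) = φ from funext fun x => (hd x).deriv]

/-- A function with vanishing weak derivative on `(0, ∞)` is constant. -/
theorem ae_const_of_weak_deriv_zero {T : ℝ → ℂ} (hT : LocallyIntegrableOn T (Ioi 0))
    (h : ∀ θ : ℝ → ℝ, ContDiff ℝ ∞ θ → HasCompactSupport θ → tsupport θ ⊆ Ioi 0 →
      ∫ x, deriv θ x • T x = 0) : ∃ c : ℂ, ∀ᵐ x, 0 < x → T x = c := by
  obtain ⟨η, hη⟩ : ∃ η : ContDiffBump (2 : ℝ), η.rOut = 1 :=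
    ⟨⟨1 / 2, 1, by norm_num, by norm_num⟩, rfl⟩
  set e : ℝ → ℝ := η.normed volume with he
  have e1 : ContDiff ℝ ∞ e := η.contDiff_normed
  have e2 : HasCompactSupport e := η.hasCompactSupport_normed
  have e3 : tsupport e ⊆ Ioi 0 := by
    rw [he, η.tsupport_normed_eq, hη]
    intro x hx
    rw [Real.closedBall_eq_Icc] at hx
    have : (1 : ℝ) ≤ x := by linarith [hx.1]
    exact lt_of_lt_of_le one_pos this
  have e4 : ∫ x, e x = 1 := η.integral_normed
  set c : ℂ := ∫ x, e x • T x with hc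
  have tsub : ∀ φ : ℝ → ℝ, Continuous φ → HasCompactSupport φ → tsupport φ ⊆ Ioi 0 →
      Integrable (fun x => φ x • T x) := fun φ h1 h2 h3 => integrable_smul_of_tsupport h1 h2 h3 hT
  refine ⟨c, ?_⟩
  have key := isOpen_Ioi.ae_eq_zero_of_integral_contDiff_smul_eq_zero (U := Ioi (0 : ℝ))
    (f := fun x => T x - c) (μ := volume)
    (hT.sub (continuousOn_const.locallyIntegrableOn measurableSet_Ioi)) ?_
  · filter_upwards [key] with x hx h0 using sub_eq_zero.1 (hx h0)
  intro φ h1 h2 h3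
  set I : ℝ := ∫ x, φ x with hI
  -- Subtracting I times a bump of mass one makes the integral vanish, so the primitive of ψ is
  -- again compactly supported in (0,∞) and is an admissible test function.
  set ψ : ℝ → ℝ := fun x => φ x - I * e x with hψ
  have p1 : ContDiff ℝ ∞ ψ := h1.sub (contDiff_const.mul e1)
  have p0 : ∀ x, x ∉ tsupport φ ∪ tsupport e → ψ x = 0 := fun x hx => by
    rw [hψ]; simp only
    rw [image_eq_zero_of_notMem_tsupport fun h => hx (Or.inl h),
      image_eq_zero_of_notMem_tsupport fun h => hx (Or.inr h)]; simp
  obtain ⟨a, b, ha, hab, hs⟩ := exists_Ioo_of_tsupport h2 h3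
  obtain ⟨a', b', ha', hab', hs'⟩ := exists_Ioo_of_tsupport e2 e3
  have p2 : ∀ x, x ∉ Ioo (min a a') (max b b') → ψ x = 0 := fun x hx => p0 x fun h => hx <| by
    rcases h with h | h
    · exact ⟨lt_of_le_of_lt (min_le_left _ _) (hs h).1, lt_of_lt_of_le (hs h).2 (le_max_left _ _)⟩
    · exact ⟨lt_of_le_of_lt (min_le_right _ _) (hs' h).1,
        lt_of_lt_of_le (hs' h).2 (le_max_right _ _)⟩
  set A := min a a'
  set B := max b b'
  have hA : 0 < A := lt_min ha ha'
  have hAB : A < B := lt_of_le_of_lt (min_le_left _ _) (lt_of_lt_of_le hab (le_max_left _ _))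
  have ψint : ∫ x, ψ x = 0 := by
    rw [hψ, integral_sub (h1.continuous.integrable_of_hasCompactSupport h2)
      ((e1.continuous.integrable_of_hasCompactSupport e2).const_mul I), integral_const_mul, e4]
    simp [hI]
  obtain ⟨q1, q2⟩ := contDiff_primitive p1
  set θ : ℝ → ℝ := fun x => ∫ t in (0 : ℝ)..x, ψ t with hθ
  have zl : ∀ x, x ≤ A → θ x = 0 := fun x hx => by
    have : ∫ t in (0 : ℝ)..x, ψ t = ∫ t in (0 : ℝ)..x, 0 := by
      refine intervalIntegral.integral_congr fun t ht => p2 t fun h => ?_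
      have : t ≤ A := ht.2.trans (max_le hA.le hx)
      linarith [h.1]
    simpa [hθ] using this
  have zr : ∀ x, B ≤ x → θ x = 0 := fun x hx => by
    have h5 : ∫ t in A..B, ψ t = 0 := by rw [← integral_eq_interval hAB p2, ψint]
    have h6 : ∫ t in B..x, ψ t = ∫ t in B..x, 0 := by
      refine intervalIntegral.integral_congr fun t ht => p2 t fun h => ?_
      rw [uIcc_of_le hx] at ht
      linarith [h.2, ht.1]
    have hi : ∀ s t : ℝ, IntervalIntegrable ψ volume s t := fun s t =>
      p1.continuous.intervalIntegrable s t
    have h7 := zl A le_rfl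
    simp only [hθ] at h7 ⊢
    rw [← intervalIntegral.integral_add_adjacent_intervals (hi 0 A) (hi A x),
      ← intervalIntegral.integral_add_adjacent_intervals (hi A B) (hi B x), h7, h5, h6]
    simp
  have hsupp : tsupport θ ⊆ Icc A B := by
    refine closure_minimal (fun x hx => ?_) isClosed_Icc
    by_contra hx'
    rw [mem_Icc, not_and_or, not_le, not_le] at hx'
    rcases hx' with h | h
    · exact hx (zl x h.le)
    · exact hx (zr x h.le)
  have h8 := h θ q1 (HasCompactSupport.of_support_subset_isCompact isCompact_Icc
    ((subset_tsupport _).trans hsupp)) (fun x hx => lt_of_lt_of_le hA (hsupp hx).1)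
  have h9 : ∀ x, deriv θ x • T x = φ x • T x - I • (e x • T x) := fun x => by
    rw [(q2 x).deriv, hψ]; simp only; rw [sub_smul, mul_smul]
  simp_rw [h9] at h8
  rw [integral_sub (g := fun x => I • e x • T x) (tsub φ h1.continuous h2 h3)
    ((tsub e e1.continuous e2 e3).smul I), integral_smul, ← hc] at h8
  simp_rw [smul_sub]
  rw [integral_sub (tsub φ h1.continuous h2 h3)
    ((h1.continuous.integrable_of_hasCompactSupport h2).smul_const c), integral_smul_const]
  exact h8

/-- A function with a weak derivative on `(0, ∞)` is a.e. equal to an absolutely continuous one. -/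
theorem IsWeakPrim.exists_isPrim {f g : ℝ → ℂ} (h : IsWeakPrim f g) :
    ∃ f' : ℝ → ℂ, IsPrim f' g ∧ ∀ᵐ x, 0 < x → f x = f' x := by
  obtain ⟨h1, h2, h3⟩ := h
  have hP := isPrim_primitive h2 0
  obtain ⟨k1, -, k3⟩ := hP.isWeakPrim h2
  obtain ⟨c, hc⟩ := ae_const_of_weak_deriv_zero (T := fun x => f x - (0 + ∫ t in (1 : ℝ)..x, g t))
    (h1.sub k1) fun θ t1 t2 t3 => by
      have i : ∀ {T : ℝ → ℂ}, LocallyIntegrableOn T (Ioi 0) →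
          Integrable (fun x => deriv θ x • T x) := fun hT =>
        integrable_smul_of_tsupport (t1.continuous_deriv (by simp)) t2.deriv
          ((tsupport_deriv_subset (f := θ)).trans t3) hT
      simp_rw [smul_sub]
      rw [integral_sub (i h1) (i k1), h3 θ t1 t2 t3, k3 θ t1 t2 t3, sub_self]
  refine ⟨_, isPrim_primitive h2 c, ?_⟩
  filter_upwards [hc] with x hx h0
  rw [← hx h0]; ring

/-! ### Disposing of boundary terms, and the weighted Cauchy–Schwarz inequality. -/

theorem not_integrableOn_inv_zero {c : ℝ} (hc : 0 < c) :
    ¬ IntegrableOn (fun x : ℝ => x⁻¹) (Ioo 0 c) := by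
  intro h
  have h' : IntervalIntegrable (fun x : ℝ => x⁻¹) volume 0 c := by
    rw [intervalIntegrable_iff_integrableOn_Ioo_of_le hc.le]; exact h
  rw [intervalIntegrable_inv_iff] at h'
  rcases h' with h | h
  · exact hc.ne h
  · exact h left_mem_uIcc

/-- If `e` is integrable on `(0, ∞)`, then `r * e r` is small for some `r` arbitrarily close to
`0` and for some arbitrarily large `r`. -/
theorem exists_small_near_zero {e : ℝ → ℝ} (he : IntegrableOn e (Ioi 0)) {ε c : ℝ} (hε : 0 < ε)
    (hc : 0 < c) : ∃ a, 0 < a ∧ a < c ∧ a * e a ≤ ε := by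
  by_contra! hcon
  refine not_integrableOn_inv_zero hc ?_
  have h1 : IntegrableOn (fun x => ε⁻¹ * e x) (Ioo 0 c) :=
    (he.mono_set Ioo_subset_Ioi_self).const_mul _
  refine Integrable.mono' h1 measurable_inv.aestronglyMeasurable ?_
  refine (ae_restrict_iff' measurableSet_Ioo).2 (Filter.Eventually.of_forall fun x hx => ?_)
  have := hcon x hx.1 hx.2
  rw [Real.norm_of_nonneg (inv_nonneg.2 hx.1.le), inv_mul_eq_div, inv_eq_one_div,
    div_le_div_iff₀ hx.1 hε]
  linarith

theorem exists_small_near_top {e : ℝ → ℝ} (he : IntegrableOn e (Ioi 0)) {ε c : ℝ} (hε : 0 < ε)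
    (hc : 0 < c) : ∃ b, c < b ∧ b * e b ≤ ε := by
  by_contra! hcon
  refine not_integrableOn_Ioi_inv (a := c) ?_
  have h1 : IntegrableOn (fun x => ε⁻¹ * e x) (Ioi c) :=
    (he.mono_set (Ioi_subset_Ioi hc.le)).const_mul _
  refine Integrable.mono' h1 measurable_inv.aestronglyMeasurable ?_
  refine (ae_restrict_iff' measurableSet_Ioi).2 (Filter.Eventually.of_forall fun x hx => ?_)
  have hx0 : 0 < x := hc.trans hx
  have := hcon x hx
  rw [Real.norm_of_nonneg (inv_nonneg.2 hx0.le), inv_mul_eq_div, inv_eq_one_div,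
    div_le_div_iff₀ hx0 hε]
  linarith

end HalfLine

namespace HalfLine

/-- A nonnegative function whose integrals over `[a, b]` are bounded by `A`, up to boundary terms
that vanish along suitable sequences, is integrable on `(0, ∞)` with integral at most `A`. -/
theorem integrableOn_and_le_of_boundary {f e : ℝ → ℝ} {A C : ℝ}
    (hf : ∀ x, 0 < x → 0 ≤ f x)
    (hi : ∀ ⦃a b : ℝ⦄, 0 < a → 0 < b → IntervalIntegrable f volume a b)
    (he : IntegrableOn e (Ioi 0)) (hC : 0 < C)
    (h : ∀ a b : ℝ, 0 < a → a < 1 → 1 < b → ∫ x in a..b, f x ≤ A + C * (a * e a + b * e b)) :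
    IntegrableOn f (Ioi 0) ∧ ∫ x in Ioi 0, f x ≤ A := by
  have key : ∀ a b : ℝ, 0 < a → a < b → ∫ x in a..b, f x ≤ A := by
    intro a b ha hab
    refine le_of_forall_pos_le_add fun η hη => ?_
    have hη' : 0 < η / (2 * C) := by positivity
    obtain ⟨a', h1, h2, h3⟩ := exists_small_near_zero he hη' (lt_min ha one_pos)
    obtain ⟨b', h4, h5⟩ := exists_small_near_top he hη'
      (lt_of_lt_of_le one_pos (le_max_right b 1))
    have hb' : 0 < b' := by linarith [le_max_right b 1]
    have := h a' b' h1 (h2.trans_le (min_le_right _ _)) ((le_max_right b 1).trans_lt h4)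
    -- Since f is nonnegative, the interval may be enlarged to endpoints at which the boundary terms
    -- happen to be small.
    have h6 : ∫ x in a..b, f x ≤ ∫ x in a'..b', f x := by
      refine intervalIntegral.integral_mono_interval (h2.trans_le (min_le_left _ _)).le hab.le
        ((le_max_left b 1).trans_lt h4).le ?_ (hi h1 hb')
      exact (ae_restrict_iff' measurableSet_Ioc).2
        (Filter.Eventually.of_forall fun x hx => hf x (h1.trans hx.1))
    have h7 : C * (a' * e a' + b' * e b') ≤ η := by
      have : C * (a' * e a' + b' * e b') ≤ C * (η / (2 * C) + η / (2 * C)) := by gcongr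
      refine this.trans (le_of_eq ?_)
      field_simp; ring
    linarith
  have hae : ∀ᵐ x ∂(volume.restrict (Ioi (0 : ℝ))), 0 ≤ f x :=
    (ae_restrict_iff' measurableSet_Ioi).2 (Filter.Eventually.of_forall fun x hx => hf x hx)
  have cov : AECover (volume.restrict (Ioi (0 : ℝ))) Filter.atTop
      (fun n : ℕ => Ioc (1 / ((n : ℝ) + 2)) ((n : ℝ) + 2)) := by
    refine (aecover_Ioi_of_Ioi ?_).inter (aecover_Iic ?_).restrict
    · have : Filter.Tendsto (fun n : ℕ => 1 / ((n : ℝ) + 2)) Filter.atTop (nhds 0) := by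
        refine Filter.Tendsto.const_div_atTop ?_ 1
        exact Filter.tendsto_atTop_add_const_right _ _ tendsto_natCast_atTop_atTop
      exact this
    · exact Filter.tendsto_atTop_add_const_right _ _ tendsto_natCast_atTop_atTop
  have pos : ∀ n : ℕ, 0 < 1 / ((n : ℝ) + 2) ∧ 1 / ((n : ℝ) + 2) < (n : ℝ) + 2 := fun n => by
    have : (0 : ℝ) ≤ n := Nat.cast_nonneg n
    refine ⟨by positivity, ?_⟩
    rw [div_lt_iff₀ (by positivity)]; nlinarith
  have hsub : ∀ n : ℕ, Ioc (1 / ((n : ℝ) + 2)) ((n : ℝ) + 2) ⊆ Ioi 0 :=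
    fun n x hx => (pos n).1.trans hx.1
  have hI : ∀ n : ℕ, ∫ x in Ioc (1 / ((n : ℝ) + 2)) ((n : ℝ) + 2), f x
      ∂(volume.restrict (Ioi (0 : ℝ))) ≤ A := fun n => by
    rw [Measure.restrict_restrict_of_subset (hsub n),
      ← intervalIntegral.integral_of_le (pos n).2.le]
    exact key _ _ (pos n).1 (pos n).2
  have hint : Integrable f (volume.restrict (Ioi (0 : ℝ))) := by
    refine cov.integrable_of_integral_bounded_of_nonneg_ae A (fun n => ?_) hae
      (Filter.Eventually.of_forall hI)
    rw [IntegrableOn, Measure.restrict_restrict_of_subset (hsub n)]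
    exact (hi (pos n).1 ((pos n).1.trans (pos n).2)).1
  exact ⟨hint, le_of_tendsto (cov.integral_tendsto_of_countably_generated hint)
    (Filter.Eventually.of_forall hI)⟩

theorem interval_le_integral {f g : ℝ → ℝ} {a b : ℝ} (ha : 0 < a) (hab : a ≤ b)
    (hf : IntervalIntegrable f volume a b) (hg : IntegrableOn g (Ioi 0))
    (hg0 : ∀ x, 0 < x → 0 ≤ g x) (hfg : ∀ x, 0 < x → f x ≤ g x) :
    ∫ x in a..b, f x ≤ ∫ x in Ioi 0, g x := by
  have hs : Ioc a b ⊆ Ioi 0 := fun x hx => ha.trans hx.1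
  have hg' : IntervalIntegrable g volume a b :=
    (intervalIntegrable_iff_integrableOn_Ioc_of_le hab).2 (hg.mono_set hs)
  refine (intervalIntegral.integral_mono_on hab hf hg'
    fun x hx => hfg x (ha.trans_le hx.1)).trans ?_
  rw [intervalIntegral.integral_of_le hab]
  exact setIntegral_mono_set hg ((ae_restrict_iff' measurableSet_Ioi).2
    (Filter.Eventually.of_forall fun x hx => hg0 x hx)) (Filter.Eventually.of_forall hs)

/-- The optimal parameter is t = √B/√A. Adding η to both roots avoids division by zero, and η tends
to 0 at the end. -/
theorem le_sqrt_mul_sqrt_of_forall {N A B : ℝ} (hA : 0 ≤ A) (hB : 0 ≤ B)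
    (h : ∀ t : ℝ, 0 < t → 2 * N ≤ t * A + B / t) : N ≤ √A * √B := by
  have key : ∀ η : ℝ, 0 < η → N ≤ (√A + η) * (√B + η) := by
    intro η hη
    have h1 := Real.sqrt_nonneg A
    have h2 := Real.sqrt_nonneg B
    have h3 := Real.sq_sqrt hA
    have h4 := Real.sq_sqrt hB
    have p1 : 0 < √A + η := by linarith
    have p2 : 0 < √B + η := by linarith
    have h5 := h ((√B + η) / (√A + η)) (by positivity)
    have e1 : (√B + η) / (√A + η) * A ≤ (√B + η) * (√A + η) := by
      rw [div_mul_eq_mul_div, div_le_iff₀ p1]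
      have : A ≤ (√A + η) * (√A + η) := by nlinarith
      calc (√B + η) * A ≤ (√B + η) * ((√A + η) * (√A + η)) := by gcongr
        _ = _ := by ring
    have e2 : B / ((√B + η) / (√A + η)) ≤ (√B + η) * (√A + η) := by
      rw [div_div_eq_mul_div, div_le_iff₀ p2]
      have : B ≤ (√B + η) * (√B + η) := by nlinarith
      calc B * (√A + η) ≤ ((√B + η) * (√B + η)) * (√A + η) := by gcongr
        _ = _ := by ring
    nlinarith
  have lim : Filter.Tendsto (fun η : ℝ => (√A + η) * (√B + η)) (nhdsWithin 0 (Ioi 0))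
      (nhds ((√A + 0) * (√B + 0))) :=
    (Continuous.tendsto (by fun_prop) 0).mono_left nhdsWithin_le_nhds
  have := ge_of_tendsto lim (eventually_nhdsWithin_of_forall key)
  simpa using this

/-- The weighted Cauchy-Schwarz inequality on `(0, ∞)`. -/
theorem integrableOn_and_cauchySchwarz {w f g : ℝ → ℝ}
    (hw : ∀ x, 0 < x → 0 ≤ w x) (hf : ∀ x, 0 < x → 0 ≤ f x) (hg : ∀ x, 0 < x → 0 ≤ g x)
    (hm : AEStronglyMeasurable (fun x => w x * (f x * g x)) (volume.restrict (Ioi 0)))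
    (hf2 : IntegrableOn (fun x => w x * f x ^ 2) (Ioi 0))
    (hg2 : IntegrableOn (fun x => w x * g x ^ 2) (Ioi 0)) :
    IntegrableOn (fun x => w x * (f x * g x)) (Ioi 0) ∧
    ∫ x in Ioi 0, w x * (f x * g x)
      ≤ √(∫ x in Ioi 0, w x * f x ^ 2) * √(∫ x in Ioi 0, w x * g x ^ 2) := by
  have hpt : ∀ t : ℝ, 0 < t → ∀ x, 0 < x →
      2 * (w x * (f x * g x)) ≤ t * (w x * f x ^ 2) + (w x * g x ^ 2) / t := by
    intro t ht x hx
    have h1 : t * (w x * f x ^ 2) + (w x * g x ^ 2) / t - 2 * (w x * (f x * g x))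
        = w x * (t * f x - g x) ^ 2 / t := by field_simp; ring
    have h2 : 0 ≤ w x * (t * f x - g x) ^ 2 / t := by have := hw x hx; positivity
    linarith
  have hint : IntegrableOn (fun x => w x * (f x * g x)) (Ioi 0) := by
    refine Integrable.mono' (hf2.add hg2) hm ((ae_restrict_iff' measurableSet_Ioi).2
      (Filter.Eventually.of_forall fun x hx => ?_))
    have h0 := mul_nonneg (hw x hx) (mul_nonneg (hf x hx) (hg x hx))
    rw [Real.norm_of_nonneg h0]
    have := hpt 1 one_pos x hx
    simp only [Pi.add_apply]
    linarith
  refine ⟨hint, le_sqrt_mul_sqrt_of_forall ?_ ?_ fun t ht => ?_⟩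
  · exact setIntegral_nonneg measurableSet_Ioi fun x hx => mul_nonneg (hw x hx) (sq_nonneg _)
  · exact setIntegral_nonneg measurableSet_Ioi fun x hx => mul_nonneg (hw x hx) (sq_nonneg _)
  · rw [← integral_const_mul, ← integral_const_mul, ← integral_div, ← integral_add
      (hf2.const_mul t) (hg2.div_const t)]
    exact setIntegral_mono_on (hint.const_mul 2) ((hf2.const_mul t).add (hg2.div_const t))
      measurableSet_Ioi fun x hx => hpt t ht x hx

/-! ### The radial equation: Hardy inequality and multiplier identities. -/

/-- The function `v` with derivative `p` has finite norm in `H¹((0, ∞), r^(2d+1) dr)`. -/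
structure RadialH1 (d : ℕ) (v p : ℝ → ℂ) : Prop where
  hv : IsPrim v p
  mp : AEStronglyMeasurable p (volume.restrict (Ioi 0))
  iv : IntegrableOn (fun r => r ^ (2 * d + 1) * ‖v r‖ ^ 2) (Ioi 0)
  ip : IntegrableOn (fun r => r ^ (2 * d + 1) * ‖p r‖ ^ 2) (Ioi 0)

open Complex in
/-- `v` with derivative `p` solves the radial equation
`p' + (2d+1)/r (p + ikv) + 2ikp - W v + (α + iε) v = G` on `(0, ∞)`. -/
structure RadialEq (d : ℕ) (v p G : ℝ → ℂ) (W W' : ℝ → ℝ) (k α ε : ℝ) : Prop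
    extends RadialH1 d v p where
  hp : IsPrim p (fun r => G r + W r * v r - (α + ε * I) * v r
    - ((2 * d + 1 : ℝ) / r : ℝ) * (p r + I * k * v r) - 2 * I * k * p r)
  hW : IsPrim W W'
  W0 : ∀ r, 0 < r → 0 ≤ W r
  mG : AEStronglyMeasurable G (volume.restrict (Ioi 0))
  iG : IntegrableOn (fun r => r ^ (2 * d + 1) * (r * ‖G r‖) ^ 2) (Ioi 0)

variable {d : ℕ} {v p G : ℝ → ℂ} {W W' : ℝ → ℝ} {k α ε : ℝ}

theorem sq_norm_eq (z : ℂ) : ‖z‖ ^ 2 = z.re * z.re + z.im * z.im := by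
  rw [Complex.sq_norm, Complex.normSq_apply]

theorem IsPrim.sq_norm (hv : IsPrim v p) :
    IsPrim (fun r => ‖v r‖ ^ 2) (fun r => 2 * ((starRingEnd ℂ) (v r) * p r).re) := by
  refine ((hv.conj.mul hv).re.congr fun r _ => ?_).congr_deriv' fun r _ => ?_
  · simp [sq_norm_eq]
  · simp; ring

namespace RadialH1

theorem mv (h : RadialH1 d v p) : AEStronglyMeasurable v (volume.restrict (Ioi 0)) :=
  h.hv.continuousOn.aestronglyMeasurable measurableSet_Ioi

/-- The Hardy inequality for radial functions in dimension `2d+2`. -/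
theorem hardy (hd : 1 ≤ d) (h : RadialH1 d v p) :
    IntegrableOn (fun r => r ^ (2 * d + 1) * (‖v r‖ / r) ^ 2) (Ioi 0) ∧
    ∫ r in Ioi 0, r ^ (2 * d + 1) * (‖v r‖ / r) ^ 2
      ≤ (∫ r in Ioi 0, r ^ (2 * d + 1) * ‖p r‖ ^ 2) / (d : ℝ) ^ 2 := by
  have hd0 : (0 : ℝ) < d := by exact_mod_cast hd
  have hv2 := h.hv.sq_norm.continuousOn
  -- The derivative of r^(2d)|v|² is integrated; completing the square (d|v| - r|p|)²/d in it
  -- produces the constant 1/d².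
  have P := (IsPrim.pow (2 * d)).mulReal h.hv.sq_norm
  have ci : ∀ ⦃a b : ℝ⦄, 0 < a → 0 < b →
      IntervalIntegrable (fun r => r ^ (2 * d + 1) * (‖v r‖ / r) ^ 2) volume a b := by
    intro a b ha hb
    refine ContinuousOn.intervalIntegrable ?_
    have : ContinuousOn (fun r : ℝ => r ^ (2 * d + 1) * (‖v r‖ / r) ^ 2) (Ioi 0) := by
      refine (by fun_prop : ContinuousOn (fun r : ℝ => r ^ (2 * d + 1)) (Ioi 0)).mul ?_
      exact (h.hv.continuousOn.norm.div continuousOn_id fun x hx => ne_of_gt hx).pow 2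
    exact this.mono fun x hx => IsPrim.uIcc_pos ha hb hx
  refine integrableOn_and_le_of_boundary (e := fun r => r ^ (2 * d + 1) * ‖v r‖ ^ 2)
    (C := 1 / d) (fun x hx => by positivity) ci h.iv (by positivity) fun a b ha ha1 hb => ?_
  have hb0 : 0 < b := by linarith
  have hab : a ≤ b := by linarith
  have E := P.eq ha hb0
  have I2 : IntervalIntegrable (fun r => r ^ (2 * d + 1) * ‖p r‖ ^ 2) volume a b :=
    (intervalIntegrable_iff_integrableOn_Ioc_of_le hab).2
      (h.ip.mono_set fun x hx => ha.trans hx.1)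
  have mono : ∫ r in a..b, ((d : ℝ) * (r ^ (2 * d + 1) * (‖v r‖ / r) ^ 2)
        - (1 / d : ℝ) * (r ^ (2 * d + 1) * ‖p r‖ ^ 2))
      ≤ ∫ r in a..b, (((2 * d : ℕ) : ℝ) * r ^ (2 * d - 1) * ‖v r‖ ^ 2
        + r ^ (2 * d) * (2 * ((starRingEnd ℂ) (v r) * p r).re)) := by
    refine intervalIntegral.integral_mono_on hab (((ci ha hb0).const_mul _).sub (I2.const_mul _))
      (P.int ha hb0) fun r hr => ?_
    have hr0 : 0 < r := ha.trans_le hr.1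
    obtain ⟨n, rfl⟩ : ∃ n, d = n + 1 := ⟨d - 1, by omega⟩
    have c : -((starRingEnd ℂ) (v r) * p r).re ≤ ‖v r‖ * ‖p r‖ := by
      refine (neg_le_abs _).trans ((Complex.abs_re_le_norm _).trans ?_)
      rw [norm_mul, RCLike.norm_conj]
    have e2 : 2 * (n + 1) - 1 = 2 * n + 1 := by omega
    rw [e2]
    have key : 0 ≤ r ^ (2 * n + 1) * ((((n + 1 : ℕ) : ℝ)) * ‖v r‖ - r * ‖p r‖) ^ 2
        / ((n + 1 : ℕ) : ℝ) := by positivity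
    have key2 : r ^ (2 * n + 1) * ((((n + 1 : ℕ) : ℝ)) * ‖v r‖ - r * ‖p r‖) ^ 2
        / ((n + 1 : ℕ) : ℝ) = ((n + 1 : ℕ) : ℝ) * (r ^ (2 * n + 1) * ‖v r‖ ^ 2)
          - 2 * r ^ (2 * n + 2) * (‖v r‖ * ‖p r‖)
          + (1 / ((n + 1 : ℕ) : ℝ)) * (r ^ (2 * n + 3) * ‖p r‖ ^ 2) := by
      field_simp; ring
    have key3 : r ^ (2 * (n + 1) + 1) * (‖v r‖ / r) ^ 2 = r ^ (2 * n + 1) * ‖v r‖ ^ 2 := by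
      field_simp; ring
    rw [key3]
    have key4 : 0 ≤ r ^ (2 * n + 2) * (‖v r‖ * ‖p r‖ + ((starRingEnd ℂ) (v r) * p r).re) := by
      have : 0 ≤ ‖v r‖ * ‖p r‖ + ((starRingEnd ℂ) (v r) * p r).re := by linarith
      positivity
    have e5 : r ^ (2 * (n + 1)) = r ^ (2 * n + 2) := by ring
    have e6 : r ^ (2 * (n + 1) + 1) = r ^ (2 * n + 3) := by ring
    rw [e5, e6]
    push_cast at *
    linarith
  rw [E, intervalIntegral.integral_sub ((ci ha hb0).const_mul _) (I2.const_mul _),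
    intervalIntegral.integral_const_mul, intervalIntegral.integral_const_mul] at mono
  have up := interval_le_integral ha hab I2 h.ip (fun x hx => by positivity) (fun x _ => le_rfl)
  -- Because b > 1, two extra powers of b turn the upper boundary term into b times a density known
  -- to be integrable. The lower boundary term has the favourable sign.
  have b1 : b ^ (2 * d) * ‖v b‖ ^ 2 ≤ b * (b ^ (2 * d + 1) * ‖v b‖ ^ 2) := by
    have : b ^ (2 * d) ≤ b ^ (2 * d + 2) := pow_le_pow_right₀ hb.le (by omega)
    calc _ ≤ b ^ (2 * d + 2) * ‖v b‖ ^ 2 := by gcongr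
      _ = _ := by ring
  have b2 : 0 ≤ a ^ (2 * d) * ‖v a‖ ^ 2 := by positivity
  have b3 : 0 ≤ a * (a ^ (2 * d + 1) * ‖v a‖ ^ 2) := by positivity
  set T := ∫ r in a..b, r ^ (2 * d + 1) * (‖v r‖ / r) ^ 2
  set X := ∫ r in Ioi 0, r ^ (2 * d + 1) * ‖p r‖ ^ 2
  set X' := ∫ r in a..b, r ^ (2 * d + 1) * ‖p r‖ ^ 2
  have h1 : (1 / d : ℝ) * X' ≤ (1 / d : ℝ) * X := by gcongr
  have fin : (d : ℝ) * T ≤ (1 / d : ℝ) * X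
      + (a * (a ^ (2 * d + 1) * ‖v a‖ ^ 2) + b * (b ^ (2 * d + 1) * ‖v b‖ ^ 2)) := by linarith
  have h2 : T = (1 / d : ℝ) * (d * T) := by field_simp
  rw [h2]
  calc (1 / d : ℝ) * (d * T) ≤ (1 / d : ℝ) * ((1 / d : ℝ) * X
      + (a * (a ^ (2 * d + 1) * ‖v a‖ ^ 2) + b * (b ^ (2 * d + 1) * ‖v b‖ ^ 2))) := by gcongr
    _ = _ := by field_simp

end RadialH1

namespace RadialEq

/-- Imaginary part of the equation multiplied by r^(2d+1) times the conjugate of v. The summand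
k|v|² in the flux absorbs the terms in which k multiplies |v|² or the real part of the conjugate of
v times p. -/
theorem hasDeriv_im (h : RadialEq d v p G W W' k α ε) :
    IsPrim (fun r => r ^ (2 * d + 1) * (((starRingEnd ℂ) (v r) * p r).im + k * ‖v r‖ ^ 2))
      (fun r => r ^ (2 * d + 1) * (((starRingEnd ℂ) (v r) * G r).im - ε * ‖v r‖ ^ 2)) := by
  refine ((IsPrim.pow (2 * d + 1)).mulReal
    ((h.hv.conj.mul h.hp).im.add (h.hv.sq_norm.const_mul k))).congr_deriv' fun r hr => ?_
  simp only [sq_norm_eq, Nat.add_sub_cancel]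
  simp
  field_simp
  ring

/-- Real part of the equation with the same multiplier. -/
theorem hasDeriv_re (h : RadialEq d v p G W W' k α ε) :
    IsPrim (fun r => r ^ (2 * d + 1) * ((starRingEnd ℂ) (v r) * p r).re)
      (fun r => r ^ (2 * d + 1) * (‖p r‖ ^ 2 + ((starRingEnd ℂ) (v r) * G r).re
        + W r * ‖v r‖ ^ 2 - α * ‖v r‖ ^ 2 + 2 * k * ((starRingEnd ℂ) (v r) * p r).im)) := by
  refine ((IsPrim.pow (2 * d + 1)).mulReal (h.hv.conj.mul h.hp).re).congr_deriv' fun r hr => ?_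
  simp only [sq_norm_eq, Nat.add_sub_cancel]
  simp
  field_simp
  ring

/-- Real part of the equation multiplied by r^(2d+1) times the conjugate of r p + (2d+1)/2 v + τ/2 r
v. The coefficients (2d+1)/2 and τ/2 are forced: they cancel the terms with Im(v̄p) that the first
multiplier produces from the first-order term in k and from iε = iτk. What remains of |p|² has
coefficient (d+1) - (2d+1) + (2d+1)/2 = 1/2. The extra flux τ/4 r^(2d+1)|v|² completes the τ-bracket
so that its part free of G and W is nonnegative. -/
theorem hasDeriv_morawetz {τ : ℝ} (h : RadialEq d v p G W W' k 0 (τ * k)) :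
    IsPrim (fun r => 1 / 2 * (r ^ (2 * d + 2) * (‖p r‖ ^ 2 - W r * ‖v r‖ ^ 2))
        + (2 * d + 1) / 2 * (r ^ (2 * d + 1) * ((starRingEnd ℂ) (v r) * p r).re)
        + τ / 2 * (r ^ (2 * d + 2) * ((starRingEnd ℂ) (v r) * p r).re)
        + τ / 4 * (r ^ (2 * d + 1) * ‖v r‖ ^ 2))
      (fun r => r ^ (2 * d + 1) * (1 / 2 * ‖p r‖ ^ 2
        + r * ((starRingEnd ℂ) (p r) * G r).re
        + (2 * d + 1) / 2 * ((starRingEnd ℂ) (v r) * G r).re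
        - 1 / 2 * ((W r + r * W' r) * ‖v r‖ ^ 2)
        + τ / 2 * (2 * ((starRingEnd ℂ) (v r) * p r).re + r * ‖p r‖ ^ 2
          + (2 * d + 1) / 2 * ‖v r‖ ^ 2 / r
          + r * ((starRingEnd ℂ) (v r) * G r).re + r * W r * ‖v r‖ ^ 2))) := by
  have q := (h.hv.conj.mul h.hp).re
  have n2 := h.hv.sq_norm
  refine (((((IsPrim.pow (2 * d + 2)).mulReal
    (h.hp.sq_norm.sub (h.hW.mulReal n2))).const_mul (1 / 2)).add
    (((IsPrim.pow (2 * d + 1)).mulReal q).const_mul ((2 * d + 1) / 2))).add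
    (((IsPrim.pow (2 * d + 2)).mulReal q).const_mul (τ / 2))).add
    (((IsPrim.pow (2 * d + 1)).mulReal n2).const_mul (τ / 4)) |>.congr_deriv' fun r hr => ?_
  have e : 2 * d + 2 - 1 = 2 * d + 1 := by omega
  simp only [sq_norm_eq, Nat.add_sub_cancel, e]
  simp
  field_simp
  ring

end RadialEq
end HalfLine

/-! ### A priori estimates for the radial equation. -/

namespace HalfLine

variable {d : ℕ} {v p G : ℝ → ℂ} {W W' : ℝ → ℝ} {k α ε : ℝ}

theorem abs_re_conj_mul_le (z w : ℂ) : |((starRingEnd ℂ) z * w).re| ≤ ‖z‖ * ‖w‖ := by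
  refine (Complex.abs_re_le_norm _).trans ?_
  rw [norm_mul, RCLike.norm_conj]

theorem abs_im_conj_mul_le (z w : ℂ) : |((starRingEnd ℂ) z * w).im| ≤ ‖z‖ * ‖w‖ := by
  refine (Complex.abs_im_le_norm _).trans ?_
  rw [norm_mul, RCLike.norm_conj]

/-- The factor r on the right is the point: with the weight r^(2d+1), a boundary term becomes r
times an integrable density, by Hardy, hence small along suitable sequences. -/
theorem norm_mul_norm_le {r : ℝ} (hr : 0 < r) (z w : ℂ) :
    ‖z‖ * ‖w‖ ≤ r * ((‖z‖ / r) ^ 2 + ‖w‖ ^ 2) := by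
  have h : r * ((‖z‖ / r) ^ 2 + ‖w‖ ^ 2) - ‖z‖ * ‖w‖
      = r * ((‖z‖ / r - ‖w‖ / 2) ^ 2 + 3 / 4 * ‖w‖ ^ 2) := by field_simp; ring
  have : 0 ≤ r * ((‖z‖ / r - ‖w‖ / 2) ^ 2 + 3 / 4 * ‖w‖ ^ 2) := by positivity
  linarith

theorem sq_norm_le {r : ℝ} (hr : 0 < r) (z : ℂ) : ‖z‖ ^ 2 ≤ r * ((‖z‖ / r) ^ 2 + ‖z‖ ^ 2) := by
  have := norm_mul_norm_le hr z z
  rwa [← sq] at this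

namespace RadialEq

theorem cauchySchwarz (h : RadialEq d v p G W W' k α ε) {f : ℝ → ℝ}
    (hm : AEStronglyMeasurable f (volume.restrict (Ioi 0))) (hf : ∀ r, 0 < r → 0 ≤ f r)
    (hi : IntegrableOn (fun r => r ^ (2 * d + 1) * f r ^ 2) (Ioi 0)) :
    IntegrableOn (fun r => r ^ (2 * d + 1) * (f r * (r * ‖G r‖))) (Ioi 0) ∧
    ∫ r in Ioi 0, r ^ (2 * d + 1) * (f r * (r * ‖G r‖))
      ≤ √(∫ r in Ioi 0, r ^ (2 * d + 1) * f r ^ 2)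
        * √(∫ r in Ioi 0, r ^ (2 * d + 1) * (r * ‖G r‖) ^ 2) := by
  refine integrableOn_and_cauchySchwarz (fun x hx => by positivity) hf
    (fun x hx => by positivity) ?_ hi h.iG
  have c1 : AEStronglyMeasurable (fun r : ℝ => r ^ (2 * d + 1)) (volume.restrict (Ioi 0)) :=
    (by fun_prop : Continuous fun r : ℝ => r ^ (2 * d + 1)).aestronglyMeasurable
  exact c1.mul (hm.mul (continuous_id.aestronglyMeasurable.mul h.mG.norm))

theorem mvr (h : RadialEq d v p G W W' k α ε) :
    AEStronglyMeasurable (fun r => ‖v r‖ / r) (volume.restrict (Ioi 0)) :=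
  (h.hv.continuousOn.norm.div continuousOn_id fun _ hx => ne_of_gt hx).aestronglyMeasurable
    measurableSet_Ioi

/-- The product |v||G| is split as (|v|/r)(r|G|); Cauchy–Schwarz and Hardy replace the first factor
by the norm of p divided by d. -/
theorem cs_v (hd : 1 ≤ d) (h : RadialEq d v p G W W' k α ε) :
    IntegrableOn (fun r => r ^ (2 * d + 1) * (‖v r‖ / r * (r * ‖G r‖))) (Ioi 0) ∧
    ∫ r in Ioi 0, r ^ (2 * d + 1) * (‖v r‖ / r * (r * ‖G r‖))
      ≤ √(∫ r in Ioi 0, r ^ (2 * d + 1) * ‖p r‖ ^ 2) / d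
        * √(∫ r in Ioi 0, r ^ (2 * d + 1) * (r * ‖G r‖) ^ 2) := by
  obtain ⟨h1, h2⟩ := h.hardy hd
  obtain ⟨h3, h4⟩ := h.cauchySchwarz h.mvr (fun r hr => by positivity) h1
  refine ⟨h3, h4.trans ?_⟩
  gcongr
  refine (Real.sqrt_le_sqrt h2).trans (le_of_eq ?_)
  rw [Real.sqrt_div' _ (by positivity), Real.sqrt_sq (by positivity)]

theorem boundary_integrable (hd : 1 ≤ d) (h : RadialEq d v p G W W' k α ε) :
    IntegrableOn (fun r => r ^ (2 * d + 1) * (‖p r‖ ^ 2 + ‖v r‖ ^ 2 + (‖v r‖ / r) ^ 2))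
      (Ioi 0) := by
  refine ((h.ip.add h.iv).add (h.hardy hd).1).congr (Filter.Eventually.of_forall fun r => ?_)
  simp only [Pi.add_apply]; ring

/-- The imaginary-part identity, multiplied by the sign s of ε and integrated; the boundary terms
vanish along sequences. -/
theorem dissipation (hd : 1 ≤ d) (h : RadialEq d v p G W W' k α ε) :
    |ε| * ∫ r in Ioi 0, r ^ (2 * d + 1) * ‖v r‖ ^ 2
      ≤ ∫ r in Ioi 0, r ^ (2 * d + 1) * (‖v r‖ / r * (r * ‖G r‖)) := by
  obtain ⟨s, hs, hs1⟩ : ∃ s : ℝ, s * ε = |ε| ∧ |s| = 1 := by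
    rcases le_total 0 ε with h0 | h0
    · exact ⟨1, by rw [abs_of_nonneg h0, one_mul], abs_one⟩
    · exact ⟨-1, by rw [abs_of_nonpos h0]; ring, by simp⟩
  rw [← integral_const_mul]
  have P := (h.hasDeriv_im).const_mul s
  have ci : ∀ ⦃a b : ℝ⦄, 0 < a → 0 < b →
      IntervalIntegrable (fun r => |ε| * (r ^ (2 * d + 1) * ‖v r‖ ^ 2)) volume a b := by
    intro a b ha hb
    exact ((((IsPrim.pow (2 * d + 1)).continuousOn.mul
      h.hv.sq_norm.continuousOn).mono fun x hx => IsPrim.uIcc_pos ha hb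
      hx).intervalIntegrable).const_mul _
  refine (integrableOn_and_le_of_boundary (C := 1 + |k|) (fun x hx => by positivity) ci
    (h.boundary_integrable hd) (by positivity) fun a b ha ha1 hb => ?_).2
  have hb0 : 0 < b := by linarith
  have hab : a ≤ b := by linarith
  have E := P.eq ha hb0
  have bd : ∀ r, 0 < r → |s * (r ^ (2 * d + 1) * (((starRingEnd ℂ) (v r) * p r).im
      + k * ‖v r‖ ^ 2))| ≤ (1 + |k|) * (r * (r ^ (2 * d + 1)
        * (‖p r‖ ^ 2 + ‖v r‖ ^ 2 + (‖v r‖ / r) ^ 2))) := by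
    intro r hr
    rw [abs_mul, hs1, one_mul, abs_mul, abs_of_nonneg (by positivity : 0 ≤ r ^ (2 * d + 1))]
    have h1 := (abs_im_conj_mul_le (v r) (p r)).trans (norm_mul_norm_le hr _ _)
    have h2 : |k * ‖v r‖ ^ 2| ≤ |k| * (r * ((‖v r‖ / r) ^ 2 + ‖v r‖ ^ 2)) := by
      rw [abs_mul, abs_of_nonneg (sq_nonneg ‖v r‖)]
      gcongr; exact sq_norm_le hr _
    have h3 : |((starRingEnd ℂ) (v r) * p r).im + k * ‖v r‖ ^ 2| ≤ (1 + |k|) * (r *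
        (‖p r‖ ^ 2 + ‖v r‖ ^ 2 + (‖v r‖ / r) ^ 2)) := by
      refine (abs_add_le _ _).trans ((add_le_add h1 h2).trans ?_)
      have a1 : 0 ≤ r * ‖v r‖ ^ 2 := by positivity
      have a2 : 0 ≤ |k| * (r * ‖p r‖ ^ 2) := by positivity
      nlinarith
    calc _ ≤ r ^ (2 * d + 1) * ((1 + |k|) * (r *
        (‖p r‖ ^ 2 + ‖v r‖ ^ 2 + (‖v r‖ / r) ^ 2))) := by gcongr
      _ = _ := by ring
  have up := interval_le_integral ha hab ((ci ha hb0).add (P.int ha hb0)) (h.cs_v hd).1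
    (fun x hx => by positivity) fun r hr => by
      have e1 : ‖v r‖ / r * (r * ‖G r‖) = ‖v r‖ * ‖G r‖ := by field_simp
      have h1 := abs_im_conj_mul_le (v r) (G r)
      have h2 : s * ((starRingEnd ℂ) (v r) * G r).im ≤ ‖v r‖ * ‖G r‖ := by
        refine (le_abs_self _).trans ?_
        rw [abs_mul, hs1, one_mul]; exact h1
      rw [e1, ← hs]
      calc _ = r ^ (2 * d + 1) * (s * ((starRingEnd ℂ) (v r) * G r).im) := by ring
        _ ≤ _ := by gcongr
  rw [intervalIntegral.integral_add (ci ha hb0) (P.int ha hb0), E] at up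
  have b1 := bd a ha
  have b2 := bd b hb0
  have b3 := neg_abs_le (s * (b ^ (2 * d + 1) * (((starRingEnd ℂ) (v b) * p b).im
      + k * ‖v b‖ ^ 2)))
  have b4 := le_abs_self (s * (a ^ (2 * d + 1) * (((starRingEnd ℂ) (v a) * p a).im
      + k * ‖v a‖ ^ 2)))
  linarith

/-- The real-part identity, with W|v|² kept on the left. Its two uses differ: for k = 0 it is the
quantitative energy inequality, while for general k only the integrability of r^(2d+1)W|v|² matters,
because W occurs in the Morawetz boundary terms. That is why the term with k is estimated crudely.
-/
theorem energy (hd : 1 ≤ d) (h : RadialEq d v p G W W' k α ε) {c : ℝ} (hc : 0 ≤ c)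
    (hαc : α ≤ c) :
    IntegrableOn (fun r => r ^ (2 * d + 1) * (‖p r‖ ^ 2 + W r * ‖v r‖ ^ 2)) (Ioi 0) ∧
    ∫ r in Ioi 0, r ^ (2 * d + 1) * (‖p r‖ ^ 2 + W r * ‖v r‖ ^ 2)
      ≤ ∫ r in Ioi 0, (r ^ (2 * d + 1) * (‖v r‖ / r * (r * ‖G r‖))
        + c * (r ^ (2 * d + 1) * ‖v r‖ ^ 2)
        + |k| * (r ^ (2 * d + 1) * ‖v r‖ ^ 2 + r ^ (2 * d + 1) * ‖p r‖ ^ 2)) := by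
  have P := h.hasDeriv_re
  have ci : ∀ ⦃a b : ℝ⦄, 0 < a → 0 < b → IntervalIntegrable
      (fun r => r ^ (2 * d + 1) * (‖p r‖ ^ 2 + W r * ‖v r‖ ^ 2)) volume a b := by
    intro a b ha hb
    exact (((IsPrim.pow (2 * d + 1)).continuousOn.mul (h.hp.sq_norm.continuousOn.add
      (h.hW.continuousOn.mul h.hv.sq_norm.continuousOn))).mono fun x hx =>
      IsPrim.uIcc_pos ha hb hx).intervalIntegrable
  have gi := ((h.cs_v hd).1.add (h.iv.const_mul c)).add ((h.iv.add h.ip).const_mul |k|)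
  refine integrableOn_and_le_of_boundary (C := 1) (fun x hx => ?_) ci
    (h.boundary_integrable hd) one_pos fun a b ha ha1 hb => ?_
  · have := h.W0 x hx
    positivity
  have hb0 : 0 < b := by linarith
  have hab : a ≤ b := by linarith
  have E := P.eq ha hb0
  have bd : ∀ r, 0 < r → |r ^ (2 * d + 1) * ((starRingEnd ℂ) (v r) * p r).re|
      ≤ r * (r ^ (2 * d + 1) * (‖p r‖ ^ 2 + ‖v r‖ ^ 2 + (‖v r‖ / r) ^ 2)) := by
    intro r hr
    rw [abs_mul, abs_of_nonneg (by positivity : 0 ≤ r ^ (2 * d + 1))]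
    have h1 := (abs_re_conj_mul_le (v r) (p r)).trans (norm_mul_norm_le hr _ _)
    have a1 : 0 ≤ r * ‖v r‖ ^ 2 := by positivity
    calc _ ≤ r ^ (2 * d + 1) * (r * (‖p r‖ ^ 2 + ‖v r‖ ^ 2 + (‖v r‖ / r) ^ 2)) := by
          gcongr; linarith
      _ = _ := by ring
  have up := interval_le_integral ha hab ((ci ha hb0).sub (P.int ha hb0)) gi
    (fun x hx => by simp only [Pi.add_apply]; positivity) fun r hr => by
      have e1 : ‖v r‖ / r * (r * ‖G r‖) = ‖v r‖ * ‖G r‖ := by field_simp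
      have h1 := (abs_le.1 (abs_re_conj_mul_le (v r) (G r))).1
      have h2 := abs_im_conj_mul_le (v r) (p r)
      have h3 : -(2 * k * ((starRingEnd ℂ) (v r) * p r).im)
          ≤ |k| * (‖v r‖ ^ 2 + ‖p r‖ ^ 2) := by
        refine (neg_le_abs _).trans ?_
        rw [abs_mul, abs_mul, abs_two]
        have := abs_nonneg k
        have h4 : 2 * |((starRingEnd ℂ) (v r) * p r).im| ≤ ‖v r‖ ^ 2 + ‖p r‖ ^ 2 := by
          nlinarith [sq_nonneg (‖v r‖ - ‖p r‖)]
        calc _ = |k| * (2 * |((starRingEnd ℂ) (v r) * p r).im|) := by ring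
          _ ≤ _ := by gcongr
      have h4 : α * ‖v r‖ ^ 2 ≤ c * ‖v r‖ ^ 2 := by gcongr
      simp only [Pi.add_apply]
      rw [e1]
      calc _ = r ^ (2 * d + 1) * (-((starRingEnd ℂ) (v r) * G r).re + α * ‖v r‖ ^ 2
            - (2 * k * ((starRingEnd ℂ) (v r) * p r).im)) := by ring
        _ ≤ r ^ (2 * d + 1) * (‖v r‖ * ‖G r‖ + c * ‖v r‖ ^ 2
            + |k| * (‖v r‖ ^ 2 + ‖p r‖ ^ 2)) := by
          gcongr
          linarith
        _ = _ := by ring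
  rw [intervalIntegral.integral_sub (ci ha hb0) (P.int ha hb0), E] at up
  have b1 := bd a ha
  have b2 := bd b hb0
  have b3 := le_abs_self (b ^ (2 * d + 1) * ((starRingEnd ℂ) (v b) * p b).re)
  have b4 := neg_abs_le (a ^ (2 * d + 1) * ((starRingEnd ℂ) (v a) * p a).re)
  simp only [Pi.add_apply] at up
  linarith

/-- The a priori estimate away from the positive half-axis. -/
theorem sectorial (hd : 1 ≤ d) (h : RadialEq d v p G W W' 0 α ε) {δ : ℝ} (hδ : 0 < δ)
    (hα : δ * α ≤ |ε|) :
    √(∫ r in Ioi 0, r ^ (2 * d + 1) * ‖p r‖ ^ 2)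
      ≤ (1 + 1 / δ) / d * √(∫ r in Ioi 0, r ^ (2 * d + 1) * (r * ‖G r‖) ^ 2) := by
  have hd0 : (0 : ℝ) < d := by exact_mod_cast hd
  -- Dissipation absorbs the spectral term: α‖v‖² ≤ |ε|‖v‖²/δ, which is at most 1/δ times the
  -- integral of r^(2d+1)|v||G|.
  have hα' : α ≤ |ε| / δ := by rw [le_div_iff₀ hδ]; linarith
  obtain ⟨h1, h2⟩ := h.energy hd (c := |ε| / δ) (by positivity) hα'
  obtain ⟨h3, h4⟩ := h.cs_v hd
  have h5 := h.dissipation hd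
  set X2 := ∫ r in Ioi 0, r ^ (2 * d + 1) * ‖p r‖ ^ 2 with hX2
  set M := √(∫ r in Ioi 0, r ^ (2 * d + 1) * (r * ‖G r‖) ^ 2)
  set N := ∫ r in Ioi 0, r ^ (2 * d + 1) * (‖v r‖ / r * (r * ‖G r‖))
  set Y2 := ∫ r in Ioi 0, r ^ (2 * d + 1) * ‖v r‖ ^ 2
  have h6 : X2 ≤ ∫ r in Ioi 0, r ^ (2 * d + 1) * (‖p r‖ ^ 2 + W r * ‖v r‖ ^ 2) := by
    refine setIntegral_mono_on h.ip h1 measurableSet_Ioi fun r hr => ?_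
    have hr : 0 < r := hr
    have : 0 ≤ W r * ‖v r‖ ^ 2 := mul_nonneg (h.W0 r hr) (sq_nonneg _)
    gcongr; linarith
  have h7 : X2 ≤ N + |ε| / δ * Y2 := by
    refine h6.trans (h2.trans (le_of_eq ?_))
    simp only [abs_zero, zero_mul, add_zero]
    rw [integral_add h3 (h.iv.const_mul _), integral_const_mul]
  have h8 : X2 ≤ (1 + 1 / δ) * (√X2 / d * M) := by
    have : |ε| / δ * Y2 ≤ N / δ := by
      rw [div_mul_eq_mul_div]; gcongr
    calc X2 ≤ N + N / δ := by linarith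
      _ = (1 + 1 / δ) * N := by ring
      _ ≤ _ := by gcongr
  have hX0 : 0 ≤ X2 := setIntegral_nonneg measurableSet_Ioi fun r hr => by
    have hr : 0 < r := hr
    positivity
  rcases (Real.sqrt_nonneg X2).eq_or_lt with h0 | h0
  · rw [← h0]; positivity
  · rw [← Real.mul_self_sqrt hX0] at h8
    refine le_of_mul_le_mul_right ?_ h0
    calc √X2 * √X2 ≤ _ := h8
      _ = _ := by rw [Real.mul_self_sqrt hX0]; ring

/-- The Morawetz estimate for the modulated function near the positive half-axis. -/
theorem morawetz (hd : 1 ≤ d) {τ δ b : ℝ} (h : RadialEq d v p G W W' k 0 (τ * k)) (hτ : 0 ≤ τ)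
    (hτδ : τ ^ 2 ≤ δ * |τ * k|) (hδ : 0 ≤ δ)
    (hQ : ∀ s t : ℝ, 0 < s → s < t → ∫ r in s..t, r ^ (2 * d + 1) * ((W r + r * W' r) * ‖v r‖ ^ 2)
      ≤ b ^ 2 * ∫ r in Ioi 0, r ^ (2 * d + 1) * ‖p r‖ ^ 2) :
    ∃ T : ℝ, 0 ≤ T ∧
      T ^ 2 ≤ δ * (√(∫ r in Ioi 0, r ^ (2 * d + 1) * ‖p r‖ ^ 2) / d
        * √(∫ r in Ioi 0, r ^ (2 * d + 1) * (r * ‖G r‖) ^ 2)) ∧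
      (1 - b ^ 2) * √(∫ r in Ioi 0, r ^ (2 * d + 1) * ‖p r‖ ^ 2) ^ 2
        ≤ √(∫ r in Ioi 0, r ^ (2 * d + 1) * (r * ‖G r‖) ^ 2)
          * ((4 * d + 1) / d * √(∫ r in Ioi 0, r ^ (2 * d + 1) * ‖p r‖ ^ 2) + T) := by
  have hd0 : (0 : ℝ) < d := by exact_mod_cast hd
  have hd1 : (1 : ℝ) ≤ d := by exact_mod_cast hd
  have P := h.hasDeriv_morawetz
  obtain ⟨h1, h2⟩ := h.cs_v hd
  obtain ⟨h3, h4⟩ := h.cauchySchwarz h.mp.norm (fun r _ => norm_nonneg _) h.ip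
  obtain ⟨h5, h6⟩ := h.cauchySchwarz h.mv.norm (fun r _ => norm_nonneg _) h.iv
  have h7 := h.dissipation hd
  have hE := (h.energy hd le_rfl le_rfl).1
  have hX0 : 0 ≤ ∫ r in Ioi 0, r ^ (2 * d + 1) * ‖p r‖ ^ 2 :=
    setIntegral_nonneg measurableSet_Ioi fun r hr => by
      have hr : 0 < r := hr
      positivity
  have hY0 : 0 ≤ ∫ r in Ioi 0, r ^ (2 * d + 1) * ‖v r‖ ^ 2 :=
    setIntegral_nonneg measurableSet_Ioi fun r hr => by
      have hr : 0 < r := hr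
      positivity
  have ei : IntegrableOn (fun r => r ^ (2 * d + 1) * (2 * ‖p r‖ ^ 2 + W r * ‖v r‖ ^ 2
      + ‖v r‖ ^ 2 + (‖v r‖ / r) ^ 2)) (Ioi 0) := by
    refine ((h.boundary_integrable hd).add hE).congr (Filter.Eventually.of_forall fun r => ?_)
    simp only [Pi.add_apply]; ring
  have ci : ∀ ⦃a b : ℝ⦄, 0 < a → 0 < b → IntervalIntegrable
      (fun r => 1 / 2 * (r ^ (2 * d + 1) * ‖p r‖ ^ 2)) volume a b := by
    intro a b ha hb
    exact ((((IsPrim.pow (2 * d + 1)).continuousOn.mul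
      h.hp.sq_norm.continuousOn).mono fun x hx =>
      IsPrim.uIcc_pos ha hb hx).intervalIntegrable).const_mul _
  have qi : ∀ ⦃a b : ℝ⦄, 0 < a → 0 < b → IntervalIntegrable
      (fun r => 1 / 2 * (r ^ (2 * d + 1) * ((W r + r * W' r) * ‖v r‖ ^ 2))) volume a b := by
    intro a b ha hb
    have hh : ∀ x ∈ uIcc a b, x ∈ Ioi (0 : ℝ) := fun x hx => IsPrim.uIcc_pos ha hb hx
    have c1 : IntervalIntegrable (fun r => W r + r * W' r) volume a b :=
      ((h.hW.continuousOn.mono hh).intervalIntegrable).add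
        ((h.hW.int ha hb).continuousOn_mul continuousOn_id)
    exact ((c1.mul_continuousOn (h.hv.sq_norm.continuousOn.mono hh)).continuousOn_mul
      ((IsPrim.pow (2 * d + 1)).continuousOn.mono hh)).const_mul _
  have gi := (h3.add (h1.const_mul ((2 * d + 1) / 2))).add (h5.const_mul (τ / 2))
  set X2 := ∫ r in Ioi 0, r ^ (2 * d + 1) * ‖p r‖ ^ 2 with hX2
  set M := √(∫ r in Ioi 0, r ^ (2 * d + 1) * (r * ‖G r‖) ^ 2)
  set N := ∫ r in Ioi 0, r ^ (2 * d + 1) * (‖v r‖ / r * (r * ‖G r‖))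
  set Y2 := ∫ r in Ioi 0, r ^ (2 * d + 1) * ‖v r‖ ^ 2
  have main := (integrableOn_and_le_of_boundary (C := 2 * d + 2 + τ)
    (f := fun r => 1 / 2 * (r ^ (2 * d + 1) * ‖p r‖ ^ 2))
    (A := (∫ r in Ioi 0, (r ^ (2 * d + 1) * (‖p r‖ * (r * ‖G r‖))
      + (2 * d + 1) / 2 * (r ^ (2 * d + 1) * (‖v r‖ / r * (r * ‖G r‖)))
      + τ / 2 * (r ^ (2 * d + 1) * (‖v r‖ * (r * ‖G r‖))))) + 1 / 2 * (b ^ 2 * X2))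
    (fun x hx => by positivity) ci ei (by positivity) fun s t hs hs1 ht => ?_).2
  -- T is τ‖v‖. The hypothesis τ² ≤ δ|τk| turns the dissipation bound for |τk|‖v‖² into the bound
  -- for T².
  · refine ⟨τ * √Y2, by positivity, ?_, ?_⟩
    · rw [mul_pow, Real.sq_sqrt hY0]
      calc τ ^ 2 * Y2 ≤ (δ * |τ * k|) * Y2 := by gcongr
        _ = δ * (|τ * k| * Y2) := by ring
        _ ≤ _ := mul_le_mul_of_nonneg_left (h7.trans h2) hδ
    · have s1 := integral_add (h3.add (h1.const_mul ((2 * d + 1) / 2))) (h5.const_mul (τ / 2))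
      have s2 := integral_add h3 (h1.const_mul ((2 * d + 1) / 2))
      simp only [Pi.add_apply] at s1
      rw [integral_const_mul, s1, s2, integral_const_mul, integral_const_mul] at main
      rw [Real.sq_sqrt hX0]
      have e1 : (2 * (d : ℝ) + 1) / 2 * N ≤ (2 * d + 1) / 2 * (√X2 / d * M) := by gcongr
      have e2 := mul_le_mul_of_nonneg_left h6 (by positivity : 0 ≤ τ / 2)
      -- The constant collects 2 from the multiplier r p and (2d+1)/d from (2d+1)/2 v combined with
      -- Hardy, after the estimate is doubled.
      have e3 : M * ((4 * (d : ℝ) + 1) / d * √X2 + τ * √Y2)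
          = 2 * (√X2 * M + (2 * d + 1) / 2 * (√X2 / d * M) + τ / 2 * (√Y2 * M)) := by
        field_simp; ring
      rw [e3]
      linarith
  have ht0 : 0 < t := by linarith
  have hst : s ≤ t := by linarith
  have E := P.eq hs ht0
  have bd : ∀ r, 0 < r → |1 / 2 * (r ^ (2 * d + 2) * (‖p r‖ ^ 2 - W r * ‖v r‖ ^ 2))
        + (2 * d + 1) / 2 * (r ^ (2 * d + 1) * ((starRingEnd ℂ) (v r) * p r).re)
        + τ / 2 * (r ^ (2 * d + 2) * ((starRingEnd ℂ) (v r) * p r).re)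
        + τ / 4 * (r ^ (2 * d + 1) * ‖v r‖ ^ 2)|
      ≤ (2 * d + 2 + τ) * (r * (r ^ (2 * d + 1) * (2 * ‖p r‖ ^ 2 + W r * ‖v r‖ ^ 2
        + ‖v r‖ ^ 2 + (‖v r‖ / r) ^ 2))) := by
    intro r hr
    have a1 := (abs_re_conj_mul_le (v r) (p r)).trans (norm_mul_norm_le hr _ _)
    have a2 := sq_norm_le hr (v r)
    have a3 : |((starRingEnd ℂ) (v r) * p r).re| ≤ ‖v r‖ ^ 2 + ‖p r‖ ^ 2 := by
      have := abs_re_conj_mul_le (v r) (p r)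
      nlinarith [sq_nonneg (‖v r‖ - ‖p r‖), sq_nonneg ‖v r‖, sq_nonneg ‖p r‖]
    have a4 : 0 ≤ W r * ‖v r‖ ^ 2 := mul_nonneg (h.W0 r hr) (sq_nonneg _)
    set c := ((starRingEnd ℂ) (v r) * p r).re
    set x := ‖p r‖ ^ 2
    set y := ‖v r‖ ^ 2
    set w := (‖v r‖ / r) ^ 2
    have hx : 0 ≤ x := sq_nonneg _
    have hy : 0 ≤ y := sq_nonneg _
    have hw : 0 ≤ w := sq_nonneg _
    have k0 : 1 / 2 * (r ^ (2 * d + 2) * (x - W r * y))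
        + (2 * d + 1) / 2 * (r ^ (2 * d + 1) * c) + τ / 2 * (r ^ (2 * d + 2) * c)
        + τ / 4 * (r ^ (2 * d + 1) * y)
      = r ^ (2 * d + 1) * (1 / 2 * (r * (x - W r * y)) + (2 * d + 1) / 2 * c
        + τ / 2 * (r * c) + τ / 4 * y) := by ring
    rw [k0, abs_mul, abs_of_nonneg (by positivity : 0 ≤ r ^ (2 * d + 1))]
    have k1 : |1 / 2 * (r * (x - W r * y)) + (2 * d + 1) / 2 * c
        + τ / 2 * (r * c) + τ / 4 * y| ≤ 1 / 2 * (r * (x + W r * y)) + (2 * d + 1) / 2 * |c|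
        + τ / 2 * (r * |c|) + τ / 4 * y := by
      have c1 : |1 / 2 * (r * (x - W r * y))| ≤ 1 / 2 * (r * (x + W r * y)) := by
        rw [abs_mul, abs_mul, abs_of_pos hr, abs_of_pos (by norm_num : (0 : ℝ) < 1 / 2)]
        gcongr
        rw [abs_le]; constructor <;> linarith
      have c2 : |(2 * (d : ℝ) + 1) / 2 * c| = (2 * d + 1) / 2 * |c| := by
        rw [abs_mul, abs_of_pos (by positivity)]
      have c3 : |τ / 2 * (r * c)| = τ / 2 * (r * |c|) := by
        rw [abs_mul, abs_mul, abs_of_pos hr, abs_of_nonneg (by positivity)]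
      have c4 : |τ / 4 * y| = τ / 4 * y := abs_of_nonneg (by positivity)
      refine (abs_add_le _ _).trans ?_
      rw [c4]
      gcongr
      refine (abs_add_le _ _).trans ?_
      rw [c3]
      gcongr
      refine (abs_add_le _ _).trans ?_
      rw [c2]
      gcongr
    have k2 : 1 / 2 * (r * (x + W r * y)) + (2 * d + 1) / 2 * |c|
        + τ / 2 * (r * |c|) + τ / 4 * y ≤ (2 * d + 2 + τ) * (r * (2 * x + W r * y + y + w)) := by
      have z1 : (2 * (d : ℝ) + 1) / 2 * |c| ≤ (2 * d + 1) / 2 * (r * (w + x)) := by gcongr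
      have z2 : τ / 2 * (r * |c|) ≤ τ / 2 * (r * (y + x)) := by gcongr
      have z3 : τ / 4 * y ≤ τ / 4 * (r * (w + y)) := by gcongr
      have t1 : 0 ≤ r * x := by positivity
      have t2 : 0 ≤ r * (W r * y) := by positivity
      have t3 : 0 ≤ r * y := by positivity
      have t4 : 0 ≤ r * w := by positivity
      have t5 : 0 ≤ τ * (r * x) := by positivity
      have t6 : 0 ≤ τ * (r * (W r * y)) := by positivity
      have t7 : 0 ≤ τ * (r * y) := by positivity
      have t8 : 0 ≤ τ * (r * w) := by positivity
      have t9 : 0 ≤ (d : ℝ) * (r * x) := by positivity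
      have t10 : 0 ≤ (d : ℝ) * (r * (W r * y)) := by positivity
      have t11 : 0 ≤ (d : ℝ) * (r * y) := by positivity
      have t12 : 0 ≤ (d : ℝ) * (r * w) := by positivity
      linarith
    calc _ ≤ r ^ (2 * d + 1) * ((2 * d + 2 + τ) * (r * (2 * x + W r * y + y + w))) := by
          gcongr; exact k1.trans k2
      _ = _ := by ring
  have up := interval_le_integral hs hst (((ci hs ht0).sub (P.int hs ht0)).sub (qi hs ht0)) gi
    (fun x hx => by simp only [Pi.add_apply]; positivity) fun r hr => by
      have e1 : ‖v r‖ / r * (r * ‖G r‖) = ‖v r‖ * ‖G r‖ := by field_simp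
      have g1 := (abs_le.1 (abs_re_conj_mul_le (v r) (G r))).1
      have g2 := (abs_le.1 (abs_re_conj_mul_le (p r) (G r))).1
      have g3 := (abs_le.1 (abs_re_conj_mul_le (v r) (p r))).1
      have g4 : 0 ≤ W r * ‖v r‖ ^ 2 := mul_nonneg (h.W0 r hr) (sq_nonneg _)
      -- A completed square: the first two terms are at least -|v|²/r, and (2d+1)/2 ≥ 1. This and
      -- the sign of W allow the corresponding τ-terms to be discarded.
      have g5 : 0 ≤ 2 * ((starRingEnd ℂ) (v r) * p r).re + r * ‖p r‖ ^ 2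
          + (2 * d + 1) / 2 * ‖v r‖ ^ 2 / r := by
        have s1 : 2 * (‖v r‖ * ‖p r‖) ≤ r * ‖p r‖ ^ 2 + ‖v r‖ ^ 2 / r := by
          have : r * ‖p r‖ ^ 2 + ‖v r‖ ^ 2 / r - 2 * (‖v r‖ * ‖p r‖)
              = (r * ‖p r‖ - ‖v r‖) ^ 2 / r := by field_simp; ring
          have h0 : 0 ≤ (r * ‖p r‖ - ‖v r‖) ^ 2 / r := by positivity
          linarith
        have s2 : 1 * ‖v r‖ ^ 2 / r ≤ (2 * d + 1) / 2 * ‖v r‖ ^ 2 / r := by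
          gcongr; linarith
        rw [one_mul] at s2
        linarith
      simp only [Pi.add_apply]
      rw [e1]
      set y := ‖v r‖ ^ 2
      set E5 := 2 * ((starRingEnd ℂ) (v r) * p r).re + r * ‖p r‖ ^ 2
          + (2 * d + 1) / 2 * y / r
      calc _ = r ^ (2 * d + 1) * (r * -((starRingEnd ℂ) (p r) * G r).re
            + (2 * d + 1) / 2 * -((starRingEnd ℂ) (v r) * G r).re
            + τ / 2 * (r * -((starRingEnd ℂ) (v r) * G r).re) - τ / 2 * E5
            - τ / 2 * (r * (W r * y))) := by ring
        _ ≤ r ^ (2 * d + 1) * (r * (‖p r‖ * ‖G r‖) + (2 * d + 1) / 2 * (‖v r‖ * ‖G r‖)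
            + τ / 2 * (r * (‖v r‖ * ‖G r‖)) - 0 - 0) := by
          gcongr
          · linarith
          · linarith
          · linarith
          · positivity
          · positivity
        _ = _ := by ring
  rw [intervalIntegral.integral_sub ((ci hs ht0).sub (P.int hs ht0)) (qi hs ht0),
    intervalIntegral.integral_sub (ci hs ht0) (P.int hs ht0), E] at up
  rw [intervalIntegral.integral_const_mul (1 / 2)
    (fun r => r ^ (2 * d + 1) * ((W r + r * W' r) * ‖v r‖ ^ 2))] at up
  have b1 := bd s hs
  have b2 := bd t ht0
  have hq := hQ s t hs (by linarith)
  have b3 := (le_abs_self _).trans b2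
  have b4 := neg_le.1 ((neg_le_abs _).trans b1)
  simp only [Pi.add_apply] at up
  linarith

end RadialEq
end HalfLine

/-! ### Dilations and polar coordinates for the Koranyi norm. -/

namespace Heisenberg

variable {d : ℕ}

/-- The homogeneous dilations `(z, t) ↦ (r z, r² t)`. -/
noncomputable def dil (r : ℝ) (p : Heis d) : Heis d := (r • p.1, r ^ 2 * p.2)

theorem zNorm_nonneg (p : Heis d) : 0 ≤ zNorm p := Real.sqrt_nonneg _

theorem zNorm_sq (p : Heis d) : zNorm p ^ 2 = ∑ j, ‖p.1 j‖ ^ 2 :=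
  Real.sq_sqrt (Finset.sum_nonneg fun _ _ => sq_nonneg _)

theorem koranyi_nonneg (p : Heis d) : 0 ≤ koranyi p :=
  Real.rpow_nonneg (by positivity) _

theorem koranyi_pow_four (p : Heis d) : koranyi p ^ 4 = zNorm p ^ 4 + p.2 ^ 2 := by
  unfold koranyi
  rw [← Real.rpow_natCast, ← Real.rpow_mul (by positivity)]
  norm_num

theorem continuous_zNorm : Continuous (zNorm : Heis d → ℝ) := by
  unfold zNorm; fun_prop

theorem continuous_koranyi : Continuous (koranyi : Heis d → ℝ) := by
  unfold koranyi
  exact ((continuous_zNorm.pow 4).add (continuous_snd.pow 2)).rpow_const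
    fun _ => Or.inr (by norm_num)

theorem continuous_dil : Continuous (fun x : ℝ × Heis d => dil x.1 x.2) := by
  unfold dil; fun_prop

theorem zNorm_dil (r : ℝ) (p : Heis d) : zNorm (dil r p) = |r| * zNorm p := by
  unfold zNorm dil
  rw [← Real.sqrt_sq_eq_abs, ← Real.sqrt_mul (sq_nonneg r), Finset.mul_sum]
  simp [mul_pow]

theorem koranyi_dil (r : ℝ) (p : Heis d) : koranyi (dil r p) = |r| * koranyi p := by
  refine (pow_left_inj₀ (koranyi_nonneg _) (mul_nonneg (abs_nonneg _) (koranyi_nonneg _))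
    (by norm_num : 4 ≠ 0)).1 ?_
  rw [mul_pow, koranyi_pow_four, koranyi_pow_four, zNorm_dil]
  have : |r| ^ 4 = r ^ 4 := Even.pow_abs (by decide) r
  simp only [dil, mul_pow, this]
  ring

theorem dil_dil (r s : ℝ) (p : Heis d) : dil r (dil s p) = dil (r * s) p := by
  simp [dil, mul_smul, mul_pow, mul_assoc]

theorem zNorm_le_koranyi (p : Heis d) : zNorm p ≤ koranyi p := by
  refine (pow_le_pow_iff_left₀ (zNorm_nonneg p) (koranyi_nonneg p) (by norm_num : 4 ≠ 0)).1 ?_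
  rw [koranyi_pow_four]
  nlinarith [sq_nonneg p.2]

theorem norm_apply_le_zNorm (p : Heis d) (j : Fin d) : ‖p.1 j‖ ≤ zNorm p := by
  refine Real.le_sqrt_of_sq_le ?_
  exact Finset.single_le_sum (f := fun j => ‖p.1 j‖ ^ 2) (fun _ _ => sq_nonneg _)
    (Finset.mem_univ j)

theorem abs_snd_le (p : Heis d) : |p.2| ≤ koranyi p ^ 2 := by
  refine abs_le_of_sq_le_sq (b := koranyi p ^ 2) ?_ (by positivity)
  have := koranyi_pow_four p
  have h2 : 0 ≤ zNorm p ^ 4 := by positivity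
  nlinarith

theorem isCompact_koranyi_le (b : ℝ) : IsCompact {p : Heis d | koranyi p ≤ b} := by
  refine Metric.isCompact_of_isClosed_isBounded (isClosed_le continuous_koranyi continuous_const)
    ?_
  refine (Metric.isBounded_closedBall (x := (0 : Heis d)) (r := max b (b ^ 2))).subset
    fun p hp => ?_
  have hp : koranyi p ≤ b := hp
  have hb : 0 ≤ b := (koranyi_nonneg p).trans hp
  rw [mem_closedBall_zero_iff, Prod.norm_def]
  refine max_le_max ?_ ?_
  · exact (pi_norm_le_iff_of_nonneg hb).2 fun j =>
      (norm_apply_le_zNorm p j).trans ((zNorm_le_koranyi p).trans hp)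
  · rw [Real.norm_eq_abs]
    exact (abs_snd_le p).trans (pow_le_pow_left₀ (koranyi_nonneg p) hp 2)

theorem koranyi_eq_zero {p : Heis d} (h : koranyi p = 0) : p = 0 := by
  have h1 : zNorm p = 0 := le_antisymm (h ▸ zNorm_le_koranyi p) (zNorm_nonneg p)
  have h2 := abs_snd_le p
  rw [h] at h2
  refine Prod.ext (funext fun j => ?_) ?_
  · exact norm_le_zero_iff.1 (h1 ▸ norm_apply_le_zNorm p j)
  · simpa using h2

theorem koranyi_pos {p : Heis d} (h : p ≠ 0) : 0 < koranyi p :=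
  (koranyi_nonneg p).lt_of_ne fun h' => h (koranyi_eq_zero h'.symm)

/-- The homogeneous dimension is 2d + 2: the real dimension 2d of z scales by r, and t scales by r².
-/
theorem map_dil_volume {r : ℝ} (hr : 0 < r) :
    Measure.map (dil r : Heis d → Heis d) volume
      = ENNReal.ofReal ((r ^ (2 * d + 2))⁻¹) • volume := by
  have h1 : (dil r : Heis d → Heis d) = Prod.map (fun z => r • z) (fun t => r ^ 2 • t) := by
    funext p; simp [dil, Prod.map]
  have h2 := Measure.map_addHaar_smul (volume : Measure (Fin d → ℂ)) hr.ne'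
  have h3 := Measure.map_addHaar_smul (volume : Measure ℝ) (pow_ne_zero 2 hr.ne')
  rw [h1, Measure.volume_eq_prod, ← Measure.map_prod_map _ _ (measurable_const_smul r)
    (measurable_const_smul (r ^ 2)), h2, h3, Measure.prod_smul_left, Measure.prod_smul_right,
    smul_smul]
  congr 1
  rw [← ENNReal.ofReal_mul (abs_nonneg _), ← abs_mul]
  congr 1
  rw [abs_of_pos (by positivity)]
  simp [Module.finrank_pi_fintype]
  rw [← mul_inv]
  ring

theorem lintegral_dil {r : ℝ} (hr : 0 < r) {F : Heis d → ℝ≥0∞} (hF : Measurable F) :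
    ∫⁻ p, F (dil r p) = ENNReal.ofReal ((r ^ (2 * d + 2))⁻¹) * ∫⁻ p, F p := by
  have hm : Measurable (dil r : Heis d → Heis d) :=
    (continuous_dil.comp (Continuous.prodMk_right r)).measurable
  rw [← lintegral_map hF hm, map_dil_volume hr, lintegral_smul_measure, smul_eq_mul]

theorem lintegral_Ioi_mul_left {a : ℝ} (ha : 0 < a) {g : ℝ → ℝ≥0∞} (hg : Measurable g) :
    ∫⁻ r in Ioi 0, g r = ENNReal.ofReal a * ∫⁻ s in Ioi 0, g (a * s) := by
  rw [← lintegral_indicator measurableSet_Ioi, ← lintegral_indicator measurableSet_Ioi]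
  conv_lhs => rw [← Real.smul_map_volume_mul_left ha.ne']
  rw [lintegral_smul_measure, lintegral_map (hg.indicator measurableSet_Ioi)
    (measurable_const_mul a), abs_of_pos ha, smul_eq_mul]
  congr 1
  refine lintegral_congr fun s => ?_
  by_cases hs : 0 < s
  · rw [indicator_of_mem (mem_Ioi.2 hs), indicator_of_mem (mem_Ioi.2 (mul_pos ha hs))]
  · rw [indicator_of_notMem (show s ∉ Ioi (0 : ℝ) from fun h => hs h), indicator_of_notMem
      (show a * s ∉ Ioi (0 : ℝ) from fun h => hs ((mul_pos_iff_of_pos_left ha).1 h))]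

/-- The surface measure on the unit sphere of the Koranyi norm. -/
noncomputable def sphereMeasure (d : ℕ) : Measure (Heis d) :=
  Measure.map (fun q => dil (koranyi q)⁻¹ q)
    ((volume.restrict {q : Heis d | 1 < koranyi q ∧ koranyi q < 2}).withDensity
      fun q => ENNReal.ofReal ((koranyi q ^ (2 * d + 1))⁻¹))

theorem measurableSet_annulus (a b : ℝ) :
    MeasurableSet {q : Heis d | a < koranyi q ∧ koranyi q < b} :=
  ((isOpen_lt continuous_const continuous_koranyi).inter
    (isOpen_lt continuous_koranyi continuous_const)).measurableSet

theorem measurable_normalize : Measurable (fun q : Heis d => dil (koranyi q)⁻¹ q) :=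
  continuous_dil.measurable.comp (continuous_koranyi.measurable.inv.prodMk measurable_id)

theorem measurable_weight :
    Measurable fun q : Heis d => ENNReal.ofReal ((koranyi q ^ (2 * d + 1))⁻¹) :=
  ((continuous_koranyi.measurable.pow_const _).inv).ennreal_ofReal

theorem lintegral_sphereMeasure {F : Heis d → ℝ≥0∞} (hF : Measurable F) :
    ∫⁻ ξ, F ξ ∂(sphereMeasure d)
      = ∫⁻ q in {q : Heis d | 1 < koranyi q ∧ koranyi q < 2},
        ENNReal.ofReal ((koranyi q ^ (2 * d + 1))⁻¹) * F (dil (koranyi q)⁻¹ q) := by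
  rw [sphereMeasure, lintegral_map hF measurable_normalize,
    lintegral_withDensity_eq_lintegral_mul _ measurable_weight
      (show Measurable fun q : Heis d => F (dil (koranyi q)⁻¹ q) from
        hF.comp measurable_normalize)]
  rfl

instance : IsFiniteMeasure (sphereMeasure d) := by
  refine ⟨?_⟩
  rw [← setLIntegral_one, setLIntegral_univ, lintegral_sphereMeasure measurable_const]
  refine lt_of_le_of_lt (setLIntegral_mono measurable_const (g := fun _ => 1)
    fun q hq => ?_) ?_
  · rw [mul_one]
    refine ENNReal.ofReal_le_one.2 (inv_le_one_of_one_le₀ (one_le_pow₀ hq.1.le))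
  · rw [setLIntegral_one]
    exact lt_of_le_of_lt (measure_mono fun q hq => hq.2.le)
      (isCompact_koranyi_le 2).measure_lt_top

theorem ae_sphereMeasure : ∀ᵐ ξ ∂(sphereMeasure d), koranyi ξ = 1 := by
  rw [sphereMeasure, ae_map_iff measurable_normalize.aemeasurable
    (measurableSet_eq_fun continuous_koranyi.measurable measurable_const)]
  refine (withDensity_absolutelyContinuous _ _).ae_le ?_
  refine (ae_restrict_iff' (measurableSet_annulus 1 2)).2 (Filter.Eventually.of_forall
    fun q hq => ?_)
  have h0 : 0 < koranyi q := one_pos.trans hq.1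
  rw [koranyi_dil, abs_of_pos (inv_pos.2 h0), inv_mul_cancel₀ h0.ne']

/-- The condition means ρ/2 < s < ρ, where ρ/s² integrates to one. This normalisation is why the
sphere measure, projected from the annulus 1 < ρ < 2 with density ρ^(-(2d+1)), gives polar
coordinates without a constant. -/
theorem lintegral_inv_sq {ρ : ℝ} (hρ : 0 < ρ) :
    ∫⁻ s in Ioi 0, (if 1 < ρ / s ∧ ρ / s < 2 then ENNReal.ofReal (ρ * (s ^ 2)⁻¹) else 0) = 1 := by
  have h1 : ∫⁻ s in Ioi 0, (if 1 < ρ / s ∧ ρ / s < 2 then ENNReal.ofReal (ρ * (s ^ 2)⁻¹) else 0)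
      = ∫⁻ s in Ioo (ρ / 2) ρ, ENNReal.ofReal (ρ * (s ^ 2)⁻¹) := by
    rw [← lintegral_indicator measurableSet_Ioi, ← lintegral_indicator measurableSet_Ioo]
    refine lintegral_congr fun s => ?_
    by_cases hs : 0 < s
    · rw [indicator_of_mem (mem_Ioi.2 hs), indicator_apply]
      have : (1 < ρ / s ∧ ρ / s < 2) ↔ s ∈ Ioo (ρ / 2) ρ := by
        rw [one_lt_div hs, div_lt_iff₀ hs, mem_Ioo, div_lt_iff₀ two_pos, and_comm, mul_comm s]
      simp only [this]
    · rw [indicator_of_notMem (show _ ∉ Ioi (0 : ℝ) from fun h => hs h), indicator_of_notMem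
        (fun h => hs ((half_pos hρ).trans h.1))]
  have hsub : ∀ s ∈ uIcc (ρ / 2) ρ, s ≠ 0 := fun s hs => by
    rw [uIcc_of_le (by linarith)] at hs
    exact ne_of_gt ((half_pos hρ).trans_le hs.1)
  have hc : ContinuousOn (fun s : ℝ => ρ * (s ^ 2)⁻¹) (uIcc (ρ / 2) ρ) :=
    continuousOn_const.mul ((continuousOn_pow 2).inv₀ fun s hs => pow_ne_zero 2 (hsub s hs))
  have h2 : ∫ s in (ρ / 2)..ρ, ρ * (s ^ 2)⁻¹ = 1 := by
    rw [intervalIntegral.integral_eq_sub_of_hasDerivAt (f := fun s => -(ρ * s⁻¹)) ?_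
      hc.intervalIntegrable]
    · field_simp; norm_num
    · intro s hs
      have := ((hasDerivAt_inv (hsub s hs)).const_mul ρ).neg
      convert! this using 1
      ring
  rw [h1, ← ofReal_integral_eq_lintegral_ofReal]
  · rw [← integral_Ioc_eq_integral_Ioo, ← intervalIntegral.integral_of_le (by linarith), h2,
      ENNReal.ofReal_one]
  · have := hc.intervalIntegrable (μ := volume)
    rw [intervalIntegrable_iff_integrableOn_Ioo_of_le (by linarith)] at this
    exact this
  · exact Filter.Eventually.of_forall fun s => by positivity

/-- Polar coordinates for the Koranyi norm. -/
theorem lintegral_polar {F : Heis d → ℝ≥0∞} (hF : Measurable F) :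
    ∫⁻ r in Ioi 0, ENNReal.ofReal (r ^ (2 * d + 1)) * ∫⁻ ξ, F (dil r ξ) ∂(sphereMeasure d)
      = ∫⁻ p, F p := by
  set A : Set (Heis d) := {q | 1 < koranyi q ∧ koranyi q < 2} with hA
  have mA : MeasurableSet A := measurableSet_annulus 1 2
  have md : Measurable fun x : ℝ × Heis d => dil x.1 x.2 := continuous_dil.measurable
  have mk : Measurable (koranyi : Heis d → ℝ) := continuous_koranyi.measurable
  have mw := measurable_weight (d := d)
  have mr : Measurable fun r : ℝ => ENNReal.ofReal (r ^ (2 * d + 1)) :=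
    (measurable_id.pow_const _).ennreal_ofReal
  -- The sphere integral is unfolded into an annulus integral. For fixed q the substitution is r =
  -- ρ(q)s; for fixed s the point q is then dilated by s. Interchanging the integrals leaves F(p)
  -- times an s-integral equal to one.
  calc _ = ∫⁻ r in Ioi 0, ∫⁻ q in A, ENNReal.ofReal (r ^ (2 * d + 1)) *
        (ENNReal.ofReal ((koranyi q ^ (2 * d + 1))⁻¹) * F (dil (r * (koranyi q)⁻¹) q)) := by
        refine lintegral_congr fun r => ?_
        rw [lintegral_sphereMeasure (F := fun ξ => F (dil r ξ))
          (hF.comp (md.comp (measurable_const.prodMk measurable_id))), ← lintegral_const_mul]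
        · simp_rw [dil_dil]
          rfl
        · refine mw.mul (hF.comp ?_)
          exact md.comp (measurable_const.prodMk measurable_normalize)
    _ = ∫⁻ q in A, ∫⁻ r in Ioi 0, ENNReal.ofReal (r ^ (2 * d + 1)) *
        (ENNReal.ofReal ((koranyi q ^ (2 * d + 1))⁻¹) * F (dil (r * (koranyi q)⁻¹) q)) := by
        refine lintegral_lintegral_swap (Measurable.aemeasurable ?_)
        refine (mr.comp measurable_fst).mul ((mw.comp measurable_snd).mul (hF.comp ?_))
        exact md.comp ((measurable_fst.mul (mk.comp measurable_snd).inv).prodMk measurable_snd)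
    _ = ∫⁻ q in A, ∫⁻ s in Ioi 0, ENNReal.ofReal (koranyi q) *
          (ENNReal.ofReal (s ^ (2 * d + 1)) * F (dil s q)) := by
        refine setLIntegral_congr_fun mA fun q hq => ?_
        have h0 : 0 < koranyi q := one_pos.trans hq.1
        rw [lintegral_Ioi_mul_left h0, ← lintegral_const_mul]
        · refine setLIntegral_congr_fun measurableSet_Ioi fun s hs => ?_
          have hs : 0 < s := hs
          have e1 : koranyi q * s * (koranyi q)⁻¹ = s := by field_simp
          rw [e1, ← mul_assoc (ENNReal.ofReal ((koranyi q * s) ^ (2 * d + 1))),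
            ← ENNReal.ofReal_mul (by positivity)]
          congr 3
          field_simp
          ring
        · refine (mr.comp (measurable_const_mul _)).mul (measurable_const.mul (hF.comp ?_))
          exact md.comp (((measurable_const_mul _).mul_const _).prodMk measurable_const)
        · refine mr.mul (measurable_const.mul (hF.comp ?_))
          exact md.comp ((measurable_id.mul_const _).prodMk measurable_const)
    _ = ∫⁻ s in Ioi 0, ∫⁻ q in A, ENNReal.ofReal (koranyi q) *
          (ENNReal.ofReal (s ^ (2 * d + 1)) * F (dil s q)) := by
        refine lintegral_lintegral_swap (Measurable.aemeasurable ?_)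
        refine (mk.comp measurable_fst).ennreal_ofReal.mul ((mr.comp measurable_snd).mul
          (hF.comp (md.comp (measurable_snd.prodMk measurable_fst))))
    _ = ∫⁻ s in Ioi 0, ∫⁻ p, (if 1 < koranyi p / s ∧ koranyi p / s < 2 then
          ENNReal.ofReal (koranyi p * (s ^ 2)⁻¹) else 0) * F p := by
        refine setLIntegral_congr_fun measurableSet_Ioi fun s hs => ?_
        have hs : 0 < s := hs
        have mcond : MeasurableSet {p : Heis d | 1 < koranyi p / s ∧ koranyi p / s < 2} :=
          (measurableSet_lt measurable_const (mk.div_const s)).inter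
            (measurableSet_lt (mk.div_const s) measurable_const)
        have mG : Measurable fun p : Heis d => (if 1 < koranyi p / s ∧ koranyi p / s < 2 then
          ENNReal.ofReal (koranyi p * (s ^ 2)⁻¹) else 0) * F p :=
          (Measurable.ite mcond ((mk.mul_const _).ennreal_ofReal) measurable_const).mul hF
        have h1 := lintegral_dil hs mG
        have h2 : ∫⁻ p, (if 1 < koranyi p / s ∧ koranyi p / s < 2 then
            ENNReal.ofReal (koranyi p * (s ^ 2)⁻¹) else 0) * F p
            = ENNReal.ofReal (s ^ (2 * d + 2)) * ∫⁻ p, (if 1 < koranyi (dil s p) / s ∧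
              koranyi (dil s p) / s < 2 then
              ENNReal.ofReal (koranyi (dil s p) * (s ^ 2)⁻¹) else 0) * F (dil s p) := by
          rw [h1, ← mul_assoc, ← ENNReal.ofReal_mul (by positivity),
            mul_inv_cancel₀ (by positivity), ENNReal.ofReal_one, one_mul]
        have md' : Measurable (dil s : Heis d → Heis d) :=
          md.comp (measurable_const.prodMk measurable_id)
        rw [h2, ← lintegral_const_mul _ (show Measurable fun p : Heis d =>
          (if 1 < koranyi (dil s p) / s ∧ koranyi (dil s p) / s < 2 then
            ENNReal.ofReal (koranyi (dil s p) * (s ^ 2)⁻¹) else 0) * F (dil s p)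
          from mG.comp md'), ← lintegral_indicator mA]
        refine lintegral_congr fun q => ?_
        have e1 : koranyi (dil s q) = s * koranyi q := by rw [koranyi_dil, abs_of_pos hs]
        have e2 : s * koranyi q / s = koranyi q := by field_simp
        rw [e1, e2]
        by_cases hq : 1 < koranyi q ∧ koranyi q < 2
        · rw [indicator_of_mem (show q ∈ A from hq), if_pos hq, ← mul_assoc, ← mul_assoc,
            ← ENNReal.ofReal_mul (koranyi_nonneg q), ← ENNReal.ofReal_mul (by positivity)]
          congr 2
          field_simp
          ring
        · rw [indicator_of_notMem (show q ∉ A from hq), if_neg hq]; simp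
    _ = ∫⁻ p, ∫⁻ s in Ioi 0, (if 1 < koranyi p / s ∧ koranyi p / s < 2 then
          ENNReal.ofReal (koranyi p * (s ^ 2)⁻¹) else 0) * F p := by
        refine lintegral_lintegral_swap (Measurable.aemeasurable ?_)
        have mq : Measurable fun x : ℝ × Heis d => koranyi x.2 / x.1 :=
          (mk.comp measurable_snd).div measurable_fst
        refine (Measurable.ite ((measurableSet_lt measurable_const mq).inter
            (measurableSet_lt mq measurable_const)) ?_ measurable_const).mul
            (hF.comp measurable_snd)
        exact ((mk.comp measurable_snd).mul (measurable_fst.pow_const 2).inv).ennreal_ofReal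
    _ = ∫⁻ p, F p := by
        refine lintegral_congr_ae ?_
        have h0 : ∀ᵐ p : Heis d, p ≠ 0 := by
          have : (volume.prod volume : Measure (Heis d)) {0} = 0 := measure_singleton _
          rw [ae_iff]
          simpa only [ne_eq, not_not] using! this
        filter_upwards [h0] with p hp
        rw [lintegral_mul_const, lintegral_inv_sq (koranyi_pos hp), one_mul]
        have mq : Measurable fun s : ℝ => koranyi p / s := measurable_const.div measurable_id
        refine Measurable.ite ((measurableSet_lt measurable_const mq).inter
          (measurableSet_lt mq measurable_const)) ?_ measurable_const
        exact (measurable_const.mul (measurable_id.pow_const 2).inv).ennreal_ofReal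

/-- The measure `r^(2d+1) dr` on `(0, ∞)`. -/
noncomputable def radialMeasure (d : ℕ) : Measure ℝ :=
  (volume.restrict (Ioi 0)).withDensity fun r => ENNReal.ofReal (r ^ (2 * d + 1))

instance : SFinite (radialMeasure d) := by unfold radialMeasure; infer_instance

theorem measurable_radialWeight :
    Measurable fun r : ℝ => ENNReal.ofReal (r ^ (2 * d + 1)) :=
  (measurable_id.pow_const _).ennreal_ofReal

theorem lintegral_radialMeasure {g : ℝ → ℝ≥0∞} (hg : Measurable g) :
    ∫⁻ r, g r ∂(radialMeasure d) = ∫⁻ r in Ioi 0, ENNReal.ofReal (r ^ (2 * d + 1)) * g r := by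
  rw [radialMeasure, lintegral_withDensity_eq_lintegral_mul _ measurable_radialWeight hg]
  rfl

theorem measurePreserving_polar :
    MeasurePreserving (fun x : ℝ × Heis d => dil x.1 x.2)
      ((radialMeasure d).prod (sphereMeasure d)) volume := by
  refine ⟨continuous_dil.measurable, Measure.ext_of_lintegral _ fun F hF => ?_⟩
  have hF' : Measurable fun x : ℝ × Heis d => F (dil x.1 x.2) :=
    hF.comp continuous_dil.measurable
  rw [lintegral_map hF continuous_dil.measurable, lintegral_prod _ hF'.aemeasurable,
    lintegral_radialMeasure hF'.lintegral_prod_right', lintegral_polar hF]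

end Heisenberg

/-! ### Integrals over Koranyi spheres. -/

namespace Heisenberg

variable {d : ℕ} {E : Type*} [NormedAddCommGroup E] [NormedSpace ℝ E]

/-- By polar coordinates, the preimage of a null set of radii is null. Hence almost-everywhere
statements about r pull back to the group, and composition with ρ respects almost-everywhere
classes. -/
theorem quasiMeasurePreserving_koranyi :
    Measure.QuasiMeasurePreserving (koranyi : Heis d → ℝ) volume (volume.restrict (Ioi 0)) := by
  refine ⟨continuous_koranyi.measurable, Measure.AbsolutelyContinuous.mk fun t ht h0 => ?_⟩
  rw [Measure.map_apply continuous_koranyi.measurable ht,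
    ← lintegral_indicator_one (continuous_koranyi.measurable ht),
    ← lintegral_polar (measurable_one.indicator (continuous_koranyi.measurable ht))]
  have h1 : ∀ᵐ r ∂(volume.restrict (Ioi (0 : ℝ))), r ∉ t := by
    rw [ae_iff]; simpa using h0
  refine (lintegral_congr_ae (g := fun _ => 0) ?_).trans (by simp)
  filter_upwards [h1, ae_restrict_mem measurableSet_Ioi] with r hr hr0
  have hr0 : 0 < r := hr0
  have : ∫⁻ ξ, (koranyi ⁻¹' t).indicator 1 (dil r ξ) ∂(sphereMeasure d) = 0 := by
    refine (lintegral_congr_ae (g := fun _ => 0) ?_).trans (by simp)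
    filter_upwards [ae_sphereMeasure] with ξ hξ
    refine indicator_of_notMem (fun h => hr ?_) _
    rwa [mem_preimage, koranyi_dil, hξ, mul_one, abs_of_pos hr0] at h
  rw [this, mul_zero]

theorem ae_koranyi {Q : ℝ → Prop} (h : ∀ᵐ r, 0 < r → Q r) : ∀ᵐ p : Heis d, Q (koranyi p) :=
  quasiMeasurePreserving_koranyi.ae ((ae_restrict_iff' measurableSet_Ioi).2 h)

theorem ae_radialMeasure {Q : ℝ → Prop} :
    (∀ᵐ r ∂(radialMeasure d), Q r) ↔ ∀ᵐ r, 0 < r → Q r := by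
  rw [radialMeasure, ae_withDensity_iff measurable_radialWeight,
    ae_restrict_iff' measurableSet_Ioi]
  refine Filter.eventually_congr (Filter.Eventually.of_forall fun r => ?_)
  refine forall_congr' fun hr => ?_
  have hr : 0 < r := hr
  have : ENNReal.ofReal (r ^ (2 * d + 1)) ≠ 0 := by
    rw [ne_eq, ENNReal.ofReal_eq_zero, not_le]; positivity
  simp [this]

theorem ae_polar {Q : Heis d → Prop} (h : ∀ᵐ p, Q p) :
    ∀ᵐ r, 0 < r → ∀ᵐ ξ ∂(sphereMeasure d), Q (dil r ξ) :=
  ae_radialMeasure.1 (Measure.ae_ae_of_ae_prod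
    (measurePreserving_polar.quasiMeasurePreserving.ae h))

/-- The integral over the sphere of radius `r`. -/
noncomputable def sphereInt (F : Heis d → E) (r : ℝ) : E := ∫ ξ, F (dil r ξ) ∂(sphereMeasure d)

theorem sphereInt_koranyi_smul (c : ℝ → ℝ) (F : Heis d → E) {r : ℝ} (hr : 0 < r) :
    sphereInt (fun p => c (koranyi p) • F p) r = c r • sphereInt F r := by
  unfold sphereInt
  rw [← integral_smul]
  refine integral_congr_ae ?_
  filter_upwards [ae_sphereMeasure] with ξ hξ
  rw [koranyi_dil, hξ, mul_one, abs_of_pos hr]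

theorem sphereInt_congr {F G : Heis d → E} (h : ∀ᵐ p, F p = G p) :
    ∀ᵐ r, 0 < r → sphereInt F r = sphereInt G r := by
  filter_upwards [ae_polar h] with r hr h0
  exact integral_congr_ae (hr h0)

theorem integrable_radialMeasure {g : ℝ → E} :
    Integrable g (radialMeasure d) ↔ IntegrableOn (fun r => r ^ (2 * d + 1) • g r) (Ioi 0) := by
  rw [radialMeasure, integrable_withDensity_iff_integrable_smul' measurable_radialWeight
    (Filter.Eventually.of_forall fun _ => ENNReal.ofReal_lt_top)]
  refine integrable_congr ((ae_restrict_iff' measurableSet_Ioi).2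
    (Filter.Eventually.of_forall fun r hr => ?_))
  have hr : 0 < r := hr
  simp only
  rw [ENNReal.toReal_ofReal (by positivity)]

theorem integral_radialMeasure (g : ℝ → E) :
    ∫ r, g r ∂(radialMeasure d) = ∫ r in Ioi 0, r ^ (2 * d + 1) • g r := by
  rw [radialMeasure, integral_withDensity_eq_integral_toReal_smul measurable_radialWeight
    (Filter.Eventually.of_forall fun _ => ENNReal.ofReal_lt_top)]
  refine setIntegral_congr_fun measurableSet_Ioi fun r hr => ?_
  have hr : 0 < r := hr
  rw [ENNReal.toReal_ofReal (by positivity)]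

theorem integrable_polar {F : Heis d → E} (hF : Integrable F) :
    (∀ᵐ r, 0 < r → Integrable (fun ξ => F (dil r ξ)) (sphereMeasure d)) ∧
    IntegrableOn (fun r => r ^ (2 * d + 1) • sphereInt F r) (Ioi 0) := by
  have h : Integrable (fun x : ℝ × Heis d => F (dil x.1 x.2))
      ((radialMeasure d).prod (sphereMeasure d)) :=
    measurePreserving_polar.integrable_comp_of_integrable hF
  exact ⟨ae_radialMeasure.1 h.prod_right_ae, integrable_radialMeasure.1 h.integral_prod_left⟩

theorem integral_polar {F : Heis d → E} (hF : Integrable F) :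
    ∫ p, F p = ∫ r in Ioi 0, r ^ (2 * d + 1) • sphereInt F r := by
  have h : Integrable (fun x : ℝ × Heis d => F (dil x.1 x.2))
      ((radialMeasure d).prod (sphereMeasure d)) :=
    measurePreserving_polar.integrable_comp_of_integrable hF
  have hm : AEStronglyMeasurable F (Measure.map (fun x : ℝ × Heis d => dil x.1 x.2)
      ((radialMeasure d).prod (sphereMeasure d))) := by
    rw [measurePreserving_polar.map_eq]; exact hF.1
  conv_lhs => rw [← measurePreserving_polar.map_eq]
  rw [integral_map continuous_dil.measurable.aemeasurable hm, integral_prod _ h,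
    ← integral_radialMeasure]
  rfl

theorem lintegral_polar_ae {F : Heis d → ℝ≥0∞} (hF : AEMeasurable F) :
    ∫⁻ p, F p = ∫⁻ r in Ioi 0, ENNReal.ofReal (r ^ (2 * d + 1)) *
      ∫⁻ ξ, F (dil r ξ) ∂(sphereMeasure d) := by
  obtain ⟨G, hG, hFG⟩ := hF
  rw [lintegral_congr_ae hFG, ← lintegral_polar hG]
  refine lintegral_congr_ae ((ae_restrict_iff' measurableSet_Ioi).2 ?_)
  filter_upwards [ae_polar hFG] with r hr h0
  rw [lintegral_congr_ae (hr h0)]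

theorem locallyIntegrableOn_of_Icc {F : Type*} [NormedAddCommGroup F] {g : ℝ → F}
    (h : ∀ a b : ℝ, 0 < a → a < b → IntegrableOn g (Icc a b)) :
    LocallyIntegrableOn g (Ioi 0) := by
  rw [locallyIntegrableOn_iff isOpen_Ioi.isLocallyClosed]
  intro K hK hKc
  rcases K.eq_empty_or_nonempty with rfl | hne
  · exact integrableOn_empty
  obtain ⟨x, hx, hx'⟩ := hKc.exists_isLeast hne
  obtain ⟨y, hy, hy'⟩ := hKc.exists_isGreatest hne
  have hx0 : 0 < x := hK hx
  have hxy : x ≤ y := hx' hy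
  exact (h x (y + 1) hx0 (by linarith)).mono_set fun z hz => ⟨hx' hz, by linarith [hy' hz]⟩

/-- On a shell a ≤ ρ ≤ b, which is compact, F is integrable; polar coordinates give integrability
with the weight r^(2d+1), which is bounded away from zero there. -/
theorem locallyIntegrable_polar {F : Heis d → E} (hF : LocallyIntegrable F) :
    LocallyIntegrableOn (sphereInt F) (Ioi 0) := by
  refine locallyIntegrableOn_of_Icc fun a b ha hab => ?_
  have hK : IsCompact {p : Heis d | koranyi p ∈ Icc a b} :=
    (isCompact_koranyi_le b).of_isClosed_subset (isClosed_Icc.preimage continuous_koranyi)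
      fun p hp => hp.2
  have h1 : Integrable ({p : Heis d | koranyi p ∈ Icc a b}.indicator F) :=
    (integrable_indicator_iff hK.measurableSet).2 (hF.integrableOn_isCompact hK)
  have h2 : {p : Heis d | koranyi p ∈ Icc a b}.indicator F
      = fun p => (Icc a b).indicator (fun _ => (1 : ℝ)) (koranyi p) • F p := by
    funext p
    by_cases hp : koranyi p ∈ Icc a b
    · rw [indicator_of_mem (show p ∈ {p : Heis d | koranyi p ∈ Icc a b} from hp),
        indicator_of_mem hp, one_smul]
    · rw [indicator_of_notMem (show p ∉ {p : Heis d | koranyi p ∈ Icc a b} from hp),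
        indicator_of_notMem hp, zero_smul]
  rw [h2] at h1
  have h3 := (integrable_polar h1).2.mono_set (fun x hx => ha.trans_le hx.1 : Icc a b ⊆ Ioi 0)
  have hc : ContinuousOn (fun r : ℝ => (r ^ (2 * d + 1))⁻¹) (Icc a b) :=
    (continuousOn_pow _).inv₀ fun r hr => pow_ne_zero _ (ha.trans_le hr.1).ne'
  refine (h3.continuousOn_smul hc isCompact_Icc).congr_fun (fun r hr => ?_) measurableSet_Icc
  have hr0 : 0 < r := ha.trans_le hr.1
  simp only
  rw [sphereInt_koranyi_smul _ _ hr0, indicator_of_mem hr, one_smul, smul_smul,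
    inv_mul_cancel₀ (by positivity), one_smul]

theorem continuous_comp_koranyi {θ : ℝ → ℝ} (h : Continuous θ) :
    Continuous fun p : Heis d => θ (koranyi p) := h.comp continuous_koranyi

theorem hasCompactSupport_comp_koranyi {F : Type*} [NormedAddCommGroup F] {θ : ℝ → F} (h : HasCompactSupport θ) :
    HasCompactSupport fun p : Heis d => θ (koranyi p) := by
  obtain ⟨b, hb⟩ := h.isCompact.bddAbove
  refine HasCompactSupport.of_support_subset_isCompact (isCompact_koranyi_le b) fun p hp => ?_
  exact hb (subset_tsupport _ hp)

theorem integrable_koranyi_smul {θ : ℝ → ℝ} (h1 : Continuous θ) (h2 : HasCompactSupport θ)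
    {F : Heis d → E} (hF : LocallyIntegrable F) : Integrable fun p => θ (koranyi p) • F p :=
  hF.integrable_smul_left_of_hasCompactSupport (continuous_comp_koranyi h1)
    (hasCompactSupport_comp_koranyi h2)

theorem integral_koranyi_smul {θ : ℝ → ℝ} (h1 : Continuous θ) (h2 : HasCompactSupport θ)
    (h3 : tsupport θ ⊆ Ioi 0) {F : Heis d → E} (hF : LocallyIntegrable F) :
    ∫ p, θ (koranyi p) • F p = ∫ r, θ r • (r ^ (2 * d + 1) • sphereInt F r) := by
  rw [integral_polar (integrable_koranyi_smul h1 h2 hF)]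
  rw [← setIntegral_eq_integral_of_forall_compl_eq_zero (s := Ioi (0 : ℝ))
    (f := fun r => θ r • (r ^ (2 * d + 1) • sphereInt F r)) fun r hr => ?_]
  · refine setIntegral_congr_fun measurableSet_Ioi fun r hr => ?_
    rw [sphereInt_koranyi_smul _ _ hr, smul_comm]
  · rw [image_eq_zero_of_notMem_tsupport fun h => hr (h3 h), zero_smul]

/-- Fubini on each ball ρ ≤ n, followed by a countable union over n. -/
theorem ae_integrable_sphere {F : Heis d → E} (hF : LocallyIntegrable F) :
    ∀ᵐ r, 0 < r → Integrable (fun ξ => F (dil r ξ)) (sphereMeasure d) := by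
  have h : ∀ n : ℕ, ∀ᵐ r : ℝ, 0 < r → r < n →
      Integrable (fun ξ => F (dil r ξ)) (sphereMeasure d) := by
    intro n
    have h1 : Integrable ({p : Heis d | koranyi p ≤ n}.indicator F) :=
      (integrable_indicator_iff (isCompact_koranyi_le n).measurableSet).2
        (hF.integrableOn_isCompact (isCompact_koranyi_le n))
    filter_upwards [(integrable_polar h1).1] with r hr h0 hn
    refine (hr h0).congr ?_
    filter_upwards [ae_sphereMeasure] with ξ hξ
    refine indicator_of_mem ?_ _
    rw [mem_ofPred_eq, koranyi_dil, hξ, mul_one, abs_of_pos h0]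
    exact hn.le
  filter_upwards [ae_all_iff.2 h] with r hr h0
  obtain ⟨n, hn⟩ := exists_nat_gt r
  exact hr n h0 hn

theorem le_of_ae_le_of_continuousOn {f g : ℝ → ℝ} (hf : ContinuousOn f (Ioi 0)) (hg : ContinuousOn g (Ioi 0))
    (h : ∀ᵐ r, 0 < r → f r ≤ g r) : ∀ r, 0 < r → f r ≤ g r := by
  intro r hr
  by_contra! hlt
  have ho : IsOpen (Ioi 0 ∩ (fun r => f r - g r) ⁻¹' (Ioi 0)) :=
    (hf.sub hg).isOpen_inter_preimage isOpen_Ioi isOpen_Ioi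
  have hne : (Ioi 0 ∩ (fun r => f r - g r) ⁻¹' (Ioi 0)).Nonempty := ⟨r, hr, sub_pos.2 hlt⟩
  refine (ho.measure_pos volume hne).ne' ?_
  refine measure_mono_null (fun x hx => ?_) (ae_iff.1 h)
  rw [mem_ofPred_eq, Classical.not_imp, not_le]
  exact ⟨hx.1, sub_pos.1 hx.2⟩

end Heisenberg

/-! ### Horizontal calculus of the Koranyi gauge and radial test functions. -/

namespace Heisenberg

variable {d : ℕ}

/-- The squared Euclidean norm `|z|²`. -/
noncomputable def zSq (p : Heis d) : ℝ := ∑ j, ‖p.1 j‖ ^ 2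

/-- The fourth power `|z|⁴ + t²` of the Koranyi norm. -/
noncomputable def gauge (p : Heis d) : ℝ := zSq p ^ 2 + p.2 ^ 2

/-- The horizontal derivatives of `gauge`. -/
noncomputable def gaugeDeriv : Fin d ⊕ Fin d → Heis d → ℝ
  | Sum.inl j, p => 4 * (zSq p * (p.1 j).re + (p.1 j).im * p.2)
  | Sum.inr j, p => 4 * (zSq p * (p.1 j).im - (p.1 j).re * p.2)

theorem zNorm_sq_eq_zSq (p : Heis d) : zNorm p ^ 2 = zSq p := zNorm_sq p

theorem zSq_nonneg (p : Heis d) : 0 ≤ zSq p := Finset.sum_nonneg fun _ _ => sq_nonneg _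

theorem koranyi_pow_four_eq_gauge (p : Heis d) : koranyi p ^ 4 = gauge p := by
  rw [koranyi_pow_four, gauge, ← zNorm_sq_eq_zSq]; ring

theorem koranyi_eq_rpow_gauge (p : Heis d) : koranyi p = gauge p ^ (1 / 4 : ℝ) := by
  rw [koranyi, gauge, ← zNorm_sq_eq_zSq]; ring_nf

theorem contDiff_zSq : ContDiff ℝ ∞ (zSq : Heis d → ℝ) := by
  unfold zSq
  refine ContDiff.sum fun j _ => ContDiff.norm_sq ℝ ?_
  fun_prop

theorem contDiff_gauge : ContDiff ℝ ∞ (gauge : Heis d → ℝ) := by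
  unfold gauge
  exact (contDiff_zSq.pow 2).add (contDiff_snd.pow 2)

theorem contDiff_re_apply (j : Fin d) : ContDiff ℝ ∞ (fun p : Heis d => (p.1 j).re) :=
  Complex.reCLM.contDiff.comp (by fun_prop : ContDiff ℝ ∞ (fun p : Heis d => p.1 j))

theorem contDiff_im_apply (j : Fin d) : ContDiff ℝ ∞ (fun p : Heis d => (p.1 j).im) :=
  Complex.imCLM.contDiff.comp (by fun_prop : ContDiff ℝ ∞ (fun p : Heis d => p.1 j))

theorem contDiff_gaugeDeriv (k : Fin d ⊕ Fin d) : ContDiff ℝ ∞ (gaugeDeriv k : Heis d → ℝ) := by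
  rcases k with j | j
  · exact contDiff_const.mul ((contDiff_zSq.mul (contDiff_re_apply j)).add
      ((contDiff_im_apply j).mul contDiff_snd))
  · exact contDiff_const.mul ((contDiff_zSq.mul (contDiff_im_apply j)).sub
      ((contDiff_re_apply j).mul contDiff_snd))

theorem sum_norm_sq_add_single (z : Fin d → ℂ) (j : Fin d) (w : ℂ) :
    ∑ i, ‖(z + Pi.single j w : Fin d → ℂ) i‖ ^ 2
      = ∑ i, ‖z i‖ ^ 2 + (2 * ((z j).re * w.re + (z j).im * w.im) + ‖w‖ ^ 2) := by
  have h : ∑ i, (‖(z + Pi.single j w : Fin d → ℂ) i‖ ^ 2 - ‖z i‖ ^ 2)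
      = 2 * ((z j).re * w.re + (z j).im * w.im) + ‖w‖ ^ 2 := by
    rw [Finset.sum_eq_single j]
    · simp only [Pi.add_apply, Pi.single_eq_same, HalfLine.sq_norm_eq, Complex.add_re,
        Complex.add_im]
      ring
    · intro i _ hi
      simp [Pi.single_eq_of_ne hi]
    · simp
  rw [Finset.sum_sub_distrib] at h
  linarith

theorem zSq_line_inl (p : Heis d) (j : Fin d) (s : ℝ) :
    zSq (p + s • hField (Sum.inl j) p) = zSq p + 2 * s * (p.1 j).re + s ^ 2 := by
  have : (p + s • hField (Sum.inl j) p).1 = p.1 + Pi.single j (s : ℂ) := by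
    simp only [hField, Prod.fst_add, Prod.smul_fst]
    rw [← Pi.single_smul]; simp
  unfold zSq
  rw [this, sum_norm_sq_add_single]
  simp; ring

theorem zSq_line_inr (p : Heis d) (j : Fin d) (s : ℝ) :
    zSq (p + s • hField (Sum.inr j) p) = zSq p + 2 * s * (p.1 j).im + s ^ 2 := by
  have : (p + s • hField (Sum.inr j) p).1 = p.1 + Pi.single j (s * Complex.I) := by
    simp only [hField, Prod.fst_add, Prod.smul_fst]
    rw [← Pi.single_smul]; simp
  unfold zSq
  rw [this, sum_norm_sq_add_single]
  simp; ring

/-- Reduces every explicit derivative of a polynomial in the coordinates to a one-variable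
computation along a line. -/
theorem fderiv_eq_of_line {f : Heis d → ℝ} (hf : ContDiff ℝ ∞ f) {p v : Heis d} {g : ℝ → ℝ}
    {c : ℝ} (hg : ∀ s, f (p + s • v) = g s) (hc : HasDerivAt g c 0) : fderiv ℝ f p v = c := by
  rw [← (hf.differentiable (by simp) p).lineDeriv_eq_fderiv, lineDeriv]
  rw [show (fun t : ℝ => f (p + t • v)) = g from funext hg]
  exact hc.deriv

theorem hasDerivAt_quadratic (a b c : ℝ) :
    HasDerivAt (fun s : ℝ => a + 2 * s * b + s ^ 2 * c) (2 * b) 0 := by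
  have h := (((hasDerivAt_id (0 : ℝ)).const_mul 2).mul_const b).const_add a
  have h2 := ((hasDerivAt_pow 2 (0 : ℝ)).mul_const c)
  convert! h.add h2 using 1
  simp

theorem hasDerivAt_affine (a b : ℝ) : HasDerivAt (fun s : ℝ => a + s * b) b 0 := by
  convert! ((hasDerivAt_id (0 : ℝ)).mul_const b).const_add a using 1
  simp

theorem hDeriv_gauge (k : Fin d ⊕ Fin d) (p : Heis d) :
    hDeriv k gauge p = gaugeDeriv k p := by
  rcases k with j | j
  · refine fderiv_eq_of_line contDiff_gauge (g := fun s => (zSq p + 2 * s * (p.1 j).re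
      + s ^ 2 * 1) ^ 2 + (p.2 + s * (2 * (p.1 j).im)) ^ 2) (fun s => ?_) ?_
    · rw [gauge, zSq_line_inl]; simp [hField]
    · refine (((hasDerivAt_quadratic _ _ _).pow 2).add ((hasDerivAt_affine _ _).pow 2)).congr_deriv
        ?_
      simp [gaugeDeriv]; ring
  · refine fderiv_eq_of_line contDiff_gauge (g := fun s => (zSq p + 2 * s * (p.1 j).im
      + s ^ 2 * 1) ^ 2 + (p.2 + s * (-2 * (p.1 j).re)) ^ 2) (fun s => ?_) ?_
    · rw [gauge, zSq_line_inr]; simp [hField]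
    · refine (((hasDerivAt_quadratic _ _ _).pow 2).add ((hasDerivAt_affine _ _).pow 2)).congr_deriv
        ?_
      simp [gaugeDeriv]; ring

theorem hDeriv_gaugeDeriv_inl (j : Fin d) (p : Heis d) :
    hDeriv (Sum.inl j) (gaugeDeriv (Sum.inl j)) p
      = 4 * zSq p + 8 * ‖p.1 j‖ ^ 2 := by
  refine fderiv_eq_of_line (contDiff_gaugeDeriv _) (g := fun s => 4 * ((zSq p
    + 2 * s * (p.1 j).re + s ^ 2 * 1) * ((p.1 j).re + s * 1)
    + (p.1 j).im * (p.2 + s * (2 * (p.1 j).im)))) (fun s => ?_) ?_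
  · rw [gaugeDeriv, zSq_line_inl]; simp [hField]
  · refine ((((hasDerivAt_quadratic _ _ _).mul (hasDerivAt_affine _ _)).add
      ((hasDerivAt_affine _ _).const_mul _)).const_mul 4).congr_deriv ?_
    rw [HalfLine.sq_norm_eq]; simp; ring

theorem hDeriv_gaugeDeriv_inr (j : Fin d) (p : Heis d) :
    hDeriv (Sum.inr j) (gaugeDeriv (Sum.inr j)) p
      = 4 * zSq p + 8 * ‖p.1 j‖ ^ 2 := by
  refine fderiv_eq_of_line (contDiff_gaugeDeriv _) (g := fun s => 4 * ((zSq p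
    + 2 * s * (p.1 j).im + s ^ 2 * 1) * ((p.1 j).im + s * 1)
    - (p.1 j).re * (p.2 + s * (-2 * (p.1 j).re)))) (fun s => ?_) ?_
  · rw [gaugeDeriv, zSq_line_inr]; simp [hField]
  · refine ((((hasDerivAt_quadratic _ _ _).mul (hasDerivAt_affine _ _)).sub
      ((hasDerivAt_affine _ _).const_mul _)).const_mul 4).congr_deriv ?_
    rw [HalfLine.sq_norm_eq]; simp; ring

/-- This is the horizontal divergence of ∇ρ⁴. Together with |∇ρ⁴|² = 16|z|²ρ⁴ it shows that
ρ^(-(2d+4))∇ρ⁴ is divergence free away from the origin. -/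
theorem sum_hDeriv_gaugeDeriv (p : Heis d) :
    ∑ k, hDeriv k (gaugeDeriv k) p = 8 * (d + 2) * zSq p := by
  rw [Fintype.sum_sum_type]
  simp_rw [hDeriv_gaugeDeriv_inl, hDeriv_gaugeDeriv_inr, Finset.sum_add_distrib,
    ← Finset.mul_sum]
  simp
  rw [show ∑ j, ‖p.1 j‖ ^ 2 = zSq p from rfl]
  ring

theorem sum_sq_gaugeDeriv (p : Heis d) :
    ∑ k, gaugeDeriv k p ^ 2 = 16 * zSq p * gauge p := by
  rw [Fintype.sum_sum_type, ← Finset.sum_add_distrib]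
  have : ∀ j, gaugeDeriv (Sum.inl j) p ^ 2 + gaugeDeriv (Sum.inr j) p ^ 2
      = 16 * gauge p * ‖p.1 j‖ ^ 2 := fun j => by
    simp only [gaugeDeriv, gauge, HalfLine.sq_norm_eq]; ring
  simp_rw [this]
  rw [← Finset.mul_sum, show ∑ j, ‖p.1 j‖ ^ 2 = zSq p from rfl]
  ring

theorem fderiv_gauge_euler (p : Heis d) : fderiv ℝ gauge p (p.1, 2 * p.2) = 4 * gauge p := by
  refine fderiv_eq_of_line contDiff_gauge (g := fun s => ((1 + s * 1) ^ 2 * zSq p) ^ 2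
    + (p.2 + s * (2 * p.2)) ^ 2) (fun s => ?_) ?_
  · have : (p + s • ((p.1, 2 * p.2) : Heis d)) = ((1 + s) • p.1, p.2 + s * (2 * p.2)) := by
      ext <;> simp <;> ring
    rw [this, gauge, zSq, zSq]
    simp only [Pi.smul_apply, norm_smul, mul_pow, ← Finset.mul_sum, Real.norm_eq_abs, sq_abs,
      mul_one]
  · refine (((((hasDerivAt_affine _ _).pow 2).mul_const _).pow 2).add
      ((hasDerivAt_affine _ _).pow 2)).congr_deriv ?_
    rw [gauge]; simp; ring

theorem gauge_zero : gauge (0 : Heis d) = 0 := by simp [gauge, zSq]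

theorem koranyi_zero : koranyi (0 : Heis d) = 0 := by
  have := koranyi_pow_four_eq_gauge (0 : Heis d)
  rw [gauge_zero] at this
  exact pow_eq_zero_iff (by norm_num) |>.1 this

theorem gauge_pos {p : Heis d} (h : p ≠ 0) : 0 < gauge p := by
  rw [← koranyi_pow_four_eq_gauge]; exact pow_pos (koranyi_pos h) 4

theorem hasFDerivAt_koranyi {p : Heis d} (h : p ≠ 0) :
    HasFDerivAt koranyi ((4 * koranyi p ^ 3)⁻¹ • fderiv ℝ gauge p) p := by
  have h1 : HasFDerivAt (gauge : Heis d → ℝ) (fderiv ℝ gauge p) p :=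
    (contDiff_gauge.differentiable (by simp) p).hasFDerivAt
  have h2 := h1.rpow_const (p := (1 / 4 : ℝ)) (Or.inl (gauge_pos h).ne')
  have h3 : (fun q : Heis d => gauge q ^ (1 / 4 : ℝ)) = koranyi :=
    funext fun q => (koranyi_eq_rpow_gauge q).symm
  rw [h3] at h2
  refine h2.congr_fderiv ?_
  congr 1
  rw [mul_inv, Real.rpow_sub (gauge_pos h), Real.rpow_one, ← koranyi_eq_rpow_gauge,
    ← koranyi_pow_four_eq_gauge]
  have := (koranyi_pos h).ne'
  field_simp

/-- Smooth functions with compact support in `(0, ∞)`. -/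
structure IsTest (θ : ℝ → ℝ) : Prop where
  smooth : ContDiff ℝ ∞ θ
  compact : HasCompactSupport θ
  supp : tsupport θ ⊆ Ioi 0

namespace IsTest

variable {θ : ℝ → ℝ}

theorem eventually_zero (h : IsTest θ) {x : ℝ} (hx : x ≤ 0) : θ =ᶠ[nhds x] 0 :=
  notMem_tsupport_iff_eventuallyEq.1 fun h' => not_lt.2 hx (h.supp h')

theorem zero (h : IsTest θ) {x : ℝ} (hx : x ≤ 0) : θ x = 0 := (h.eventually_zero hx).eq_of_nhds

theorem deriv (h : IsTest θ) : IsTest (deriv θ) :=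
  ⟨(contDiff_infty_iff_deriv.1 h.smooth).2, h.compact.deriv,
    (closure_mono support_deriv_subset).trans
    (by rw [closure_eq_iff_isClosed.2 (isClosed_tsupport θ)]; exact h.supp)⟩

/-- A test function vanishes near zero, so the singularity of r^(-n) is not seen. This lets the
weight r^(2d+1) be absorbed into test functions. -/
theorem mul_inv_pow (h : IsTest θ) (n : ℕ) : IsTest fun r => θ r * (r ^ n)⁻¹ := by
  refine ⟨contDiff_iff_contDiffAt.2 fun x => ?_, h.compact.mul_right,
    (closure_mono (Function.support_mul_subset_left _ _)).trans h.supp⟩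
  rcases le_or_gt x 0 with hx | hx
  · refine (contDiffAt_const (c := (0 : ℝ))).congr_of_eventuallyEq ?_
    filter_upwards [h.eventually_zero hx] with y hy
    simp [hy]
  · exact h.smooth.contDiffAt.mul ((contDiffAt_id.pow n).inv (pow_ne_zero n hx.ne'))

theorem hasDerivAt (h : IsTest θ) (x : ℝ) : HasDerivAt θ (_root_.deriv θ x) x :=
  (h.smooth.differentiable (by simp) x).hasDerivAt

theorem deriv_mul_inv_pow (h : IsTest θ) (n : ℕ) {r : ℝ} (hr : 0 < r) :
    _root_.deriv (fun r => θ r * (r ^ n)⁻¹) r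
      = _root_.deriv θ r * (r ^ n)⁻¹ - n * θ r * (r ^ (n + 1))⁻¹ := by
  have := ((h.hasDerivAt r).mul ((hasDerivAt_pow n r).inv (pow_ne_zero n hr.ne'))).deriv
  refine Eq.trans this ?_
  rcases n with _ | n
  · simp
  · simp only [Nat.add_sub_cancel, Pi.inv_apply]
    field_simp
    ring

theorem eventually_zero_comp (h : IsTest θ) :
    (fun p : Heis d => θ (koranyi p)) =ᶠ[nhds 0] 0 := by
  have : Filter.Tendsto (koranyi : Heis d → ℝ) (nhds 0) (nhds 0) := by
    have := continuous_koranyi (d := d) |>.tendsto 0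
    rwa [koranyi_zero] at this
  exact this.eventually (h.eventually_zero le_rfl)

theorem hasFDerivAt_comp (h : IsTest θ) (p : Heis d) :
    HasFDerivAt (fun p : Heis d => θ (koranyi p))
      ((_root_.deriv θ (koranyi p) * (4 * koranyi p ^ 3)⁻¹) • fderiv ℝ gauge p) p := by
  by_cases hp : p = 0
  · subst hp
    rw [koranyi_zero, h.deriv.zero le_rfl, zero_mul, zero_smul]
    exact (hasFDerivAt_const (0 : ℝ) (0 : Heis d)).congr_of_eventuallyEq h.eventually_zero_comp
  · have := (h.hasDerivAt (koranyi p)).comp_hasFDerivAt p (hasFDerivAt_koranyi hp)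
    rw [mul_smul]; exact this

theorem hDeriv_comp (h : IsTest θ) (k : Fin d ⊕ Fin d) (p : Heis d) :
    hDeriv k (fun p : Heis d => θ (koranyi p)) p
      = _root_.deriv θ (koranyi p) * (4 * koranyi p ^ 3)⁻¹ * gaugeDeriv k p := by
  rw [hDeriv, (h.hasFDerivAt_comp p).fderiv, ← hDeriv_gauge]
  rfl

theorem contDiff_comp (h : IsTest θ) : ContDiff ℝ ∞ (fun p : Heis d => θ (koranyi p)) := by
  refine contDiff_iff_contDiffAt.2 fun p => ?_
  by_cases hp : p = 0
  · subst hp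
    exact (contDiffAt_const (c := (0 : ℝ))).congr_of_eventuallyEq h.eventually_zero_comp
  · refine h.smooth.contDiffAt.comp p ?_
    have h3 : (fun q : Heis d => gauge q ^ (1 / 4 : ℝ)) = koranyi :=
      funext fun q => (koranyi_eq_rpow_gauge q).symm
    rw [← h3]
    exact contDiff_gauge.contDiffAt.rpow_const_of_ne (gauge_pos hp).ne'

end IsTest

theorem hDeriv_mul {f g : Heis d → ℝ} (hf : ContDiff ℝ ∞ f) (hg : ContDiff ℝ ∞ g)
    (k : Fin d ⊕ Fin d) (p : Heis d) :
    hDeriv k (fun p => f p * g p) p = hDeriv k f p * g p + f p * hDeriv k g p := by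
  have : fderiv ℝ (fun p => f p * g p) p = f p • fderiv ℝ g p + g p • fderiv ℝ f p :=
    ((hf.differentiable (by simp) p).hasFDerivAt.mul
    (hg.differentiable (by simp) p).hasFDerivAt).fderiv
  rw [hDeriv, this]
  simp only [add_apply, smul_apply, smul_eq_mul, hDeriv]
  ring

instance : (volume : Measure (Heis d)).IsAddHaarMeasure :=
  Measure.prod.instIsAddHaarMeasure (volume : Measure (Fin d → ℂ)) (volume : Measure ℝ)

theorem integral_mul_fderiv {ψ : Heis d → ℝ} (h1 : ContDiff ℝ ∞ ψ)
    (h2 : HasCompactSupport ψ) {w : Heis d → ℝ} (hw : ContDiff ℝ ∞ w) (e : Heis d) :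
    ∫ p, w p * fderiv ℝ ψ p e = - ∫ p, fderiv ℝ w p e * ψ p := by
  have cd : ∀ {f : Heis d → ℝ}, ContDiff ℝ ∞ f → Continuous fun p => fderiv ℝ f p e :=
    fun hf => (hf.continuous_fderiv (by simp)).clm_apply continuous_const
  have cs : HasCompactSupport fun p => fderiv ℝ ψ p e := h2.fderiv_apply (𝕜 := ℝ) e
  refine integral_mul_fderiv_eq_neg_fderiv_mul_of_integrable ?_ ?_ ?_
    (fun x _ => hw.differentiable (by simp) x) (fun x _ => h1.differentiable (by simp) x)
  · exact ((cd hw).mul h1.continuous).integrable_of_hasCompactSupport h2.mul_left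
  · exact (hw.continuous.mul (cd h1)).integrable_of_hasCompactSupport cs.mul_left
  · exact (hw.continuous.mul h1.continuous).integrable_of_hasCompactSupport h2.mul_left

theorem continuous_hField (k : Fin d ⊕ Fin d) : Continuous (hField k : Heis d → Heis d) := by
  rcases k with j | j
  · exact continuous_const.prodMk (continuous_const.mul (contDiff_im_apply j).continuous)
  · exact continuous_const.prodMk (continuous_const.mul (contDiff_re_apply j).continuous)

theorem continuous_hDeriv {F : Type*} [NormedAddCommGroup F] [NormedSpace ℝ F]
    {ψ : Heis d → F} (h : ContDiff ℝ ∞ ψ) (k : Fin d ⊕ Fin d) : Continuous (hDeriv k ψ) :=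
  (h.continuous_fderiv (by simp)).clm_apply (continuous_hField k)

theorem hasCompactSupport_hDeriv {F : Type*} [NormedAddCommGroup F] [NormedSpace ℝ F]
    {ψ : Heis d → F} (h : HasCompactSupport ψ) (k : Fin d ⊕ Fin d) :
    HasCompactSupport (hDeriv k ψ) := by
  refine (h.fderiv (𝕜 := ℝ)).mono' fun p hp => subset_tsupport _ ?_
  intro h0
  exact hp (by simp [hDeriv, h0])

/-- Each horizontal field is a constant vector plus w ∂_t with w independent of t, hence divergence
free. -/
theorem integral_hDeriv_eq_zero {ψ : Heis d → ℝ} (h1 : ContDiff ℝ ∞ ψ)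
    (h2 : HasCompactSupport ψ) (k : Fin d ⊕ Fin d) : ∫ p, hDeriv k ψ p = 0 := by
  obtain ⟨e, w, hw, hk, hw0⟩ : ∃ (e : Heis d) (w : Heis d → ℝ), ContDiff ℝ ∞ w ∧
      (∀ p, hField k p = e + w p • ((0, 1) : Heis d)) ∧
      ∀ p, fderiv ℝ w p ((0, 1) : Heis d) = 0 := by
    rcases k with j | j
    · refine ⟨(Pi.single j 1, 0), fun p => 2 * (p.1 j).im,
        contDiff_const.mul (contDiff_im_apply j), fun p => ?_, fun p => ?_⟩
      · ext <;> simp [hField]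
      · exact fderiv_eq_of_line (contDiff_const.mul (contDiff_im_apply j))
          (g := fun _ => 2 * (p.1 j).im) (fun s => by simp) (hasDerivAt_const _ _)
    · refine ⟨(Pi.single j Complex.I, 0), fun p => -2 * (p.1 j).re,
        contDiff_const.mul (contDiff_re_apply j), fun p => ?_, fun p => ?_⟩
      · ext <;> simp [hField]
      · exact fderiv_eq_of_line (contDiff_const.mul (contDiff_re_apply j))
          (g := fun _ => -2 * (p.1 j).re) (fun s => by simp) (hasDerivAt_const _ _)
  have cd : ∀ e : Heis d, Continuous fun p => fderiv ℝ ψ p e :=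
    fun e => (h1.continuous_fderiv (by simp)).clm_apply continuous_const
  have cs : ∀ e : Heis d, HasCompactSupport fun p => fderiv ℝ ψ p e :=
    fun e => h2.fderiv_apply (𝕜 := ℝ) e
  have e1 : ∀ p, hDeriv k ψ p = 1 * fderiv ℝ ψ p e + w p * fderiv ℝ ψ p ((0, 1) : Heis d) :=
    fun p => by rw [hDeriv, hk, map_add, map_smul]; simp
  simp_rw [e1]
  have i1 : Integrable fun p => 1 * fderiv ℝ ψ p e :=
    (continuous_const.mul (cd e)).integrable_of_hasCompactSupport (cs e).mul_left
  have i2 : Integrable fun p => w p * fderiv ℝ ψ p ((0, 1) : Heis d) :=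
    (hw.continuous.mul (cd _)).integrable_of_hasCompactSupport (cs _).mul_left
  rw [integral_add i1 i2,
    integral_mul_fderiv h1 h2 contDiff_const, integral_mul_fderiv h1 h2 hw]
  simp [hw0]

end Heisenberg

/-! ### Mass and second moment of the Koranyi sphere. -/

namespace Heisenberg

variable {d : ℕ}

/-- The mass of the Koranyi sphere. -/
noncomputable def sphereMass (d : ℕ) : ℝ := (sphereMeasure d).real univ

/-- The second moment `∫ |z|²` of the Koranyi sphere. -/
noncomputable def sphereMoment (d : ℕ) : ℝ := ∫ ξ, zSq ξ ∂(sphereMeasure d)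

theorem zSq_dil (r : ℝ) (p : Heis d) : zSq (dil r p) = r ^ 2 * zSq p := by
  rw [← zNorm_sq_eq_zSq, ← zNorm_sq_eq_zSq, zNorm_dil, mul_pow, sq_abs]

theorem sphereInt_const {E : Type*} [NormedAddCommGroup E] [NormedSpace ℝ E] [CompleteSpace E]
    (c : E) (r : ℝ) : sphereInt (fun _ : Heis d => c) r = sphereMass d • c := by
  simp [sphereInt, sphereMass]

theorem sphereInt_zSq (r : ℝ) : sphereInt (zSq : Heis d → ℝ) r = r ^ 2 * sphereMoment d := by
  simp_rw [sphereInt, sphereMoment, zSq_dil, integral_const_mul]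

theorem setIntegral_pow_mul_exp (n : ℕ) :
    IntegrableOn (fun y : ℝ => y ^ n * Real.exp (-y ^ 4)) (Ioi 0) ∧
    ∫ y in Ioi (0 : ℝ), y ^ n * Real.exp (-y ^ 4) = 1 / 4 * Real.Gamma (((n : ℝ) + 1) / 4) := by
  have hn : (-1 : ℝ) < n := lt_of_lt_of_le (by norm_num) (Nat.cast_nonneg n)
  have e : ∀ y : ℝ, y ^ (n : ℝ) * Real.exp (-y ^ (4 : ℝ)) = y ^ n * Real.exp (-y ^ 4) := by
    intro y
    rw [Real.rpow_natCast]
    norm_cast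
  have h1 := integrableOn_rpow_mul_exp_neg_rpow hn (by norm_num : (0 : ℝ) < 4)
  have h2 := integral_rpow_mul_exp_neg_rpow (by norm_num : (0 : ℝ) < 4) hn
  simp_rw [e] at h1 h2
  exact ⟨h1, h2⟩

/-- Integration of functions of `|z|` over `ℂ^d`. -/
theorem exists_integral_zNorm (hd : 1 ≤ d) : ∃ C : ℝ, 0 < C ∧ ∀ f : ℝ → ℝ,
    IntegrableOn (fun y => y ^ (2 * d - 1) * f y) (Ioi 0) →
    Integrable (fun z : Fin d → ℂ => f (√(∑ j, ‖z j‖ ^ 2))) ∧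
    ∫ z : Fin d → ℂ, f (√(∑ j, ‖z j‖ ^ 2)) = C * ∫ y in Ioi 0, y ^ (2 * d - 1) * f y := by
  have : Nonempty (Fin d) := ⟨⟨0, hd⟩⟩
  set L := (PiLp.continuousLinearEquiv 2 ℝ (fun _ : Fin d => ℂ)).symm
  set μ : Measure (EuclideanSpace ℂ (Fin d)) := Measure.map L volume with hμ
  have hμh : μ.IsAddHaarMeasure := L.isAddHaarMeasure_map volume
  have hdim : Module.finrank ℝ (EuclideanSpace ℂ (Fin d)) = 2 * d := by
    rw [← L.toLinearEquiv.finrank_eq, Module.finrank_pi_fintype]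
    simp [mul_comm]
  have hnorm : ∀ z : Fin d → ℂ, ‖(L z : EuclideanSpace ℂ (Fin d))‖ = √(∑ j, ‖z j‖ ^ 2) :=
    fun z => EuclideanSpace.norm_eq _
  have hL : MeasurableEmbedding L := L.toHomeomorph.measurableEmbedding
  refine ⟨(2 * d : ℕ) * μ.real (Metric.ball 0 1), ?_, fun f hf => ⟨?_, ?_⟩⟩
  · have h1 : 0 < μ.real (Metric.ball 0 1) :=
      ENNReal.toReal_pos (Metric.measure_ball_pos μ 0 one_pos).ne' measure_ball_lt_top.ne
    have h2 : (0 : ℝ) < (2 * d : ℕ) := by exact_mod_cast (by omega : 0 < 2 * d)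
    positivity
  · have h := (integrable_fun_norm_addHaar μ (f := f)).2 (by rw [hdim]; exact hf)
    rw [hμ, hL.integrable_map_iff] at h
    refine h.congr (Filter.Eventually.of_forall fun z => ?_)
    simp only [Function.comp, hnorm]
  · have h := integral_fun_norm_addHaar μ f
    rw [hμ, hL.integral_map, ← hμ, hdim] at h
    simp_rw [hnorm] at h
    rw [h, nsmul_eq_mul, smul_eq_mul, mul_assoc]
    rfl

/-- The integrals of e^(-ρ⁴) and |z|²e^(-ρ⁴) are computed twice. In Koranyi polar coordinates they
are Gamma values times the mass and the moment. As products, since e^(-ρ⁴) = e^(-|z|⁴)e^(-t²), they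
are Gamma values times the same two constants C and T, which drop out of the ratio. -/
theorem sphere_constants (hd : 1 ≤ d) : 0 < sphereMass d ∧ 0 < sphereMoment d ∧
    sphereMoment d / sphereMass d
      = 2 / d * (Real.Gamma (((d : ℝ) + 1) / 2) / Real.Gamma ((d : ℝ) / 2)) ^ 2 := by
  obtain ⟨C, hC, hf⟩ := exists_integral_zNorm hd
  have hd0 : (0 : ℝ) < d := by exact_mod_cast hd
  have e1 : ∀ y : ℝ, y ^ (2 * d - 1) * (y ^ 2 * Real.exp (-y ^ 4))
      = y ^ (2 * d + 1) * Real.exp (-y ^ 4) := fun y => by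
    rw [← mul_assoc, ← pow_add]; congr 2; omega
  have k0 := setIntegral_pow_mul_exp (2 * d - 1)
  have k1 := setIntegral_pow_mul_exp (2 * d + 1)
  have k2 := setIntegral_pow_mul_exp (2 * d + 3)
  obtain ⟨a0, b0⟩ := hf (fun y => Real.exp (-y ^ 4)) k0.1
  obtain ⟨a1, b1⟩ := hf (fun y => y ^ 2 * Real.exp (-y ^ 4)) (by simp_rw [e1]; exact k1.1)
  simp_rw [e1] at b1
  rw [k0.2] at b0
  rw [k1.2] at b1
  have g0 := integrable_exp_neg_mul_sq (b := 1) one_pos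
  set T := ∫ t : ℝ, Real.exp (-1 * t ^ 2) with hT
  have hT0 : 0 < T := by rw [hT, integral_gaussian]; positivity
  have r2 : ∀ p : Heis d, (√(∑ j, ‖p.1 j‖ ^ 2)) ^ 2 = zSq p := fun p =>
    Real.sq_sqrt (zSq_nonneg p)
  have r4 : ∀ p : Heis d, (√(∑ j, ‖p.1 j‖ ^ 2)) ^ 4 = zSq p ^ 2 := fun p => by
    rw [show (4 : ℕ) = 2 * 2 from rfl, pow_mul, r2]
  have eq0 : ∀ p : Heis d, Real.exp (-(√(∑ j, ‖p.1 j‖ ^ 2)) ^ 4) * Real.exp (-1 * p.2 ^ 2)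
      = Real.exp (-koranyi p ^ 4) • 1 := fun p => by
    rw [r4, ← Real.exp_add, koranyi_pow_four_eq_gauge, gauge, smul_eq_mul, mul_one]
    congr 1; ring
  have eq1 : ∀ p : Heis d, (√(∑ j, ‖p.1 j‖ ^ 2)) ^ 2 * Real.exp (-(√(∑ j, ‖p.1 j‖ ^ 2)) ^ 4)
      * Real.exp (-1 * p.2 ^ 2) = Real.exp (-koranyi p ^ 4) • zSq p := fun p => by
    rw [r4, r2, mul_assoc, ← Real.exp_add, koranyi_pow_four_eq_gauge, gauge, smul_eq_mul,
      mul_comm]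
    congr 2; ring
  have i0 : Integrable (fun p : Heis d => Real.exp (-koranyi p ^ 4) • (1 : ℝ)) := by
    have := a0.mul_prod g0
    simp_rw [eq0] at this; exact this
  have i1 : Integrable (fun p : Heis d => Real.exp (-koranyi p ^ 4) • zSq p) := by
    have := a1.mul_prod g0
    simp_rw [eq1] at this; exact this
  have j0 : ∫ p : Heis d, Real.exp (-koranyi p ^ 4) • (1 : ℝ)
      = C * (1 / 4 * Real.Gamma ((((2 * d - 1 : ℕ) : ℝ) + 1) / 4)) * T := by
    rw [← b0, hT, ← integral_prod_mul]
    simp_rw [← eq0]; rfl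
  have j1 : ∫ p : Heis d, Real.exp (-koranyi p ^ 4) • zSq p
      = C * (1 / 4 * Real.Gamma ((((2 * d + 1 : ℕ) : ℝ) + 1) / 4)) * T := by
    rw [← b1, hT, ← integral_prod_mul]
    simp_rw [← eq1]; rfl
  have l0 : ∫ p : Heis d, Real.exp (-koranyi p ^ 4) • (1 : ℝ)
      = 1 / 4 * Real.Gamma ((((2 * d + 1 : ℕ) : ℝ) + 1) / 4) * sphereMass d := by
    rw [integral_polar i0, ← k1.2, ← integral_mul_const]
    refine setIntegral_congr_fun measurableSet_Ioi fun r hr => ?_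
    rw [sphereInt_koranyi_smul (fun r => Real.exp (-r ^ 4)) _ hr, sphereInt_const]
    simp only [smul_eq_mul]; ring
  have l1 : ∫ p : Heis d, Real.exp (-koranyi p ^ 4) • zSq p
      = 1 / 4 * Real.Gamma ((((2 * d + 3 : ℕ) : ℝ) + 1) / 4) * sphereMoment d := by
    rw [integral_polar i1, ← k2.2, ← integral_mul_const]
    refine setIntegral_congr_fun measurableSet_Ioi fun r hr => ?_
    rw [sphereInt_koranyi_smul (fun r => Real.exp (-r ^ 4)) _ hr, sphereInt_zSq]
    simp only [smul_eq_mul]; ring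
  have c0 : (((2 * d - 1 : ℕ) : ℝ) + 1) / 4 = d / 2 := by
    rw [Nat.cast_sub (by omega)]; push_cast; ring
  have c1 : (((2 * d + 1 : ℕ) : ℝ) + 1) / 4 = (d + 1) / 2 := by push_cast; ring
  have c2 : (((2 * d + 3 : ℕ) : ℝ) + 1) / 4 = d / 2 + 1 := by push_cast; ring
  rw [c0] at j0
  rw [c1] at j1 l0
  rw [c2, Real.Gamma_add_one (by positivity)] at l1
  have p0 : 0 < Real.Gamma ((d : ℝ) / 2) := Real.Gamma_pos_of_pos (by positivity)
  have p1 : 0 < Real.Gamma (((d : ℝ) + 1) / 2) := Real.Gamma_pos_of_pos (by positivity)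
  set A := Real.Gamma ((d : ℝ) / 2)
  set B := Real.Gamma (((d : ℝ) + 1) / 2)
  have s0 : sphereMass d = C * A * T / B := by
    rw [eq_div_iff p1.ne']
    have := l0.symm.trans j0
    linarith
  have s1 : sphereMoment d = C * B * T / (d / 2 * A) := by
    rw [eq_div_iff (by positivity)]
    have := l1.symm.trans j1
    linarith
  refine ⟨s0 ▸ by positivity, s1 ▸ by positivity, ?_⟩
  rw [s0, s1]
  field_simp

/-- The phase constant is the inverse root of the mean value of `|z|²` over the sphere. -/
theorem sqrt_mul_gamma_ratio (hd : 1 ≤ d) :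
    √((d : ℝ) / 2) * (Real.Gamma ((d : ℝ) / 2) / Real.Gamma (((d : ℝ) + 1) / 2))
      = √(sphereMass d / sphereMoment d) := by
  have hd0 : (0 : ℝ) < d := by exact_mod_cast hd
  have p0 : 0 < Real.Gamma ((d : ℝ) / 2) := Real.Gamma_pos_of_pos (by positivity)
  have p1 : 0 < Real.Gamma (((d : ℝ) + 1) / 2) := Real.Gamma_pos_of_pos (by positivity)
  rw [← inv_div (sphereMoment d), (sphere_constants hd).2.2,
    ← Real.sqrt_sq (by positivity : 0 ≤ Real.Gamma ((d : ℝ) / 2) / Real.Gamma (((d : ℝ) + 1) / 2)),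
    ← Real.sqrt_mul (by positivity)]
  congr 1
  field_simp

end Heisenberg

/-! ### From weak derivatives and weak solutions on the group to the half-line. -/

namespace HalfLine

theorem locallyIntegrableOn_congr {E : Type*} [NormedAddCommGroup E] {f g : ℝ → E}
    (hf : LocallyIntegrableOn f (Ioi 0)) (h : ∀ᵐ r, 0 < r → f r = g r) :
    LocallyIntegrableOn g (Ioi 0) := by
  refine Heisenberg.locallyIntegrableOn_of_Icc fun a b ha hab => ?_
  refine (hf.integrableOn_compact_subset (fun x hx => ha.trans_le hx.1) isCompact_Icc).congr_fun_ae
    ((ae_restrict_iff' measurableSet_Icc).2 ?_)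
  filter_upwards [h] with r hr hm using hr (ha.trans_le hm.1)

theorem locallyIntegrableOn_smul {E : Type*} [NormedAddCommGroup E] [NormedSpace ℝ E] {f : ℝ → E}
    {c : ℝ → ℝ} (hf : LocallyIntegrableOn f (Ioi 0)) (hc : ContinuousOn c (Ioi 0)) :
    LocallyIntegrableOn (fun r => c r • f r) (Ioi 0) := by
  refine Heisenberg.locallyIntegrableOn_of_Icc fun a b ha hab => ?_
  exact (hf.integrableOn_compact_subset (fun x hx => ha.trans_le hx.1)
    isCompact_Icc).continuousOn_smul (hc.mono fun x hx => ha.trans_le hx.1) isCompact_Icc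

end HalfLine

namespace Heisenberg

open HalfLine

variable {d : ℕ}

theorem IsTest.continuous {θ : ℝ → ℝ} (h : IsTest θ) : Continuous θ := h.smooth.continuous

theorem IsTest.integral {E : Type*} [NormedAddCommGroup E] [NormedSpace ℝ E] {θ : ℝ → ℝ}
    (h : IsTest θ) {F : Heis d → E} (hF : LocallyIntegrable F) :
    ∫ p, θ (koranyi p) • F p = ∫ r, θ r • (r ^ (2 * d + 1) • sphereInt F r) :=
  integral_koranyi_smul h.continuous h.compact h.supp hF

theorem locallyIntegrable_clm {E F : Type*} [NormedAddCommGroup E] [NormedSpace ℝ E]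
    [NormedAddCommGroup F] [NormedSpace ℝ F] {f : Heis d → E} (hf : LocallyIntegrable f)
    (L : E →L[ℝ] F) : LocallyIntegrable fun p => L (f p) := by
  rw [locallyIntegrable_iff]
  exact fun K hK => L.integrable_comp (hf.integrableOn_isCompact hK)

theorem locallyIntegrable_continuous_smul {E : Type*} [NormedAddCommGroup E] [NormedSpace ℝ E]
    {f : Heis d → E} (hf : LocallyIntegrable f) {c : Heis d → ℝ} (hc : Continuous c) :
    LocallyIntegrable fun p => c p • f p := by
  rw [locallyIntegrable_iff]
  exact fun K hK => (hf.integrableOn_isCompact hK).continuousOn_smul hc.continuousOn hK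

theorem sphereInt_koranyi_mul (c : ℝ → ℂ) (F : Heis d → ℂ) {r : ℝ} (hr : 0 < r) :
    sphereInt (fun p => c (koranyi p) * F p) r = c r * sphereInt F r := by
  unfold sphereInt
  rw [← integral_const_mul]
  refine integral_congr_ae ?_
  filter_upwards [ae_sphereMeasure] with ξ hξ
  rw [koranyi_dil, hξ, mul_one, abs_of_pos hr]

theorem sphereInt_mul_of_radial {u F : Heis d → ℂ} {U : ℝ → ℂ} (hU : ∀ᵐ p, u p = U (koranyi p)) :
    ∀ᵐ r, 0 < r → sphereInt (fun p => F p * u p) r = U r * sphereInt F r := by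
  filter_upwards [sphereInt_congr (F := fun p => F p * u p) (G := fun p => U (koranyi p) * F p)
    (by filter_upwards [hU] with p hp; rw [hp, mul_comm])] with r hr h0
  rw [hr h0, sphereInt_koranyi_mul _ _ h0]

theorem sphereInt_of_radial {u : Heis d → ℂ} {U : ℝ → ℂ} (hU : ∀ᵐ p, u p = U (koranyi p)) :
    ∀ᵐ r, 0 < r → sphereInt u r = sphereMass d * U r := by
  filter_upwards [sphereInt_mul_of_radial (F := fun _ => 1) hU] with r hr h0
  have := hr h0
  rw [sphereInt_const] at this
  simp only [one_mul] at this
  rw [this, Complex.real_smul, mul_one, mul_comm]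

/-- The component of a horizontal vector field along the horizontal gradient of `ρ⁴`. -/
noncomputable def radialPart (g : Heis d → EuclideanSpace ℂ (Fin d ⊕ Fin d)) (p : Heis d) : ℂ :=
  ∑ k, gaugeDeriv k p • g p k

theorem locallyIntegrable_component {g : Heis d → EuclideanSpace ℂ (Fin d ⊕ Fin d)}
    (hg : LocallyIntegrable g) (k : Fin d ⊕ Fin d) : LocallyIntegrable fun p => g p k :=
  locallyIntegrable_clm hg
    ((EuclideanSpace.proj k : EuclideanSpace ℂ (Fin d ⊕ Fin d) →L[ℂ] ℂ).restrictScalars ℝ)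

theorem locallyIntegrable_radialPart {g : Heis d → EuclideanSpace ℂ (Fin d ⊕ Fin d)}
    (hg : LocallyIntegrable g) : LocallyIntegrable (radialPart g) :=
  locallyIntegrable_finsetSum _ fun k _ => locallyIntegrable_continuous_smul
    (locallyIntegrable_component hg k) (contDiff_gaugeDeriv k).continuous

/-- The radial derivative of a radial function with horizontal gradient `g`. -/
noncomputable def radialSlope (g : Heis d → EuclideanSpace ℂ (Fin d ⊕ Fin d)) (r : ℝ) : ℂ :=
  (4 * sphereMoment d * r ^ 3)⁻¹ • sphereInt (radialPart g) r

theorem locallyIntegrableOn_radialSlope {g : Heis d → EuclideanSpace ℂ (Fin d ⊕ Fin d)}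
    (hd : 1 ≤ d) (hg : LocallyIntegrable g) : LocallyIntegrableOn (radialSlope g) (Ioi 0) := by
  refine locallyIntegrableOn_smul (locallyIntegrable_polar (locallyIntegrable_radialPart hg)) ?_
  refine (by fun_prop : ContinuousOn (fun r : ℝ => 4 * sphereMoment d * r ^ 3) (Ioi 0)).inv₀
    fun r hr => ?_
  have hr : 0 < r := hr
  have := (sphere_constants hd).2.1
  positivity

theorem locallyIntegrableOn_profile (hd : 1 ≤ d) {u : Heis d → ℂ} (hu : LocallyIntegrable u)
    {U : ℝ → ℂ} (hU : ∀ᵐ p, u p = U (koranyi p)) : LocallyIntegrableOn U (Ioi 0) := by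
  have hS := (sphere_constants hd).1
  refine locallyIntegrableOn_congr (locallyIntegrableOn_smul (locallyIntegrable_polar hu)
    (c := fun _ => (sphereMass d)⁻¹) continuousOn_const) ?_
  filter_upwards [sphereInt_of_radial hU] with r hr h0
  rw [hr h0, Complex.real_smul, ← mul_assoc, ← Complex.ofReal_mul, inv_mul_cancel₀ hS.ne']
  simp

/-- The weak gradient is tested with the components of the field ζ(ρ)∇ρ⁴, and the result is read in
polar coordinates. For u = v(ρ) the component of ∇u along ∇ρ⁴ is 4|z|²ρ v', whose integral over the
sphere of radius r is 4κr³v'; this explains the normalisation of `radialSlope`. -/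
theorem isWeakPrim_of_hasWeakHGrad (hd : 1 ≤ d) {u : Heis d → ℂ}
    {g : Heis d → EuclideanSpace ℂ (Fin d ⊕ Fin d)} (hg : HasWeakHGrad u g)
    {U : ℝ → ℂ} (hU : ∀ᵐ p, u p = U (koranyi p)) : IsWeakPrim U (radialSlope g) := by
  obtain ⟨h1, h2, h3⟩ := hg
  have hκ := (sphere_constants hd).2.1
  refine ⟨locallyIntegrableOn_profile hd h1 hU, locallyIntegrableOn_radialSlope hd h2,
    fun θ t1 t2 t3 => ?_⟩
  have hθ : IsTest θ := ⟨t1, t2, t3⟩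
  -- With this exponent the divergence of ζ(ρ)∇ρ⁴ contains only the derivative of θ.
  have hζ := hθ.mul_inv_pow (2 * d + 4)
  have hc := hθ.deriv.mul_inv_pow (2 * d + 3)
  set ζ : ℝ → ℝ := fun r => θ r * (r ^ (2 * d + 4))⁻¹ with hζd
  set c : ℝ → ℝ := fun r => deriv θ r * (r ^ (2 * d + 3))⁻¹ with hcd
  have smΦ : ∀ k : Fin d ⊕ Fin d, ContDiff ℝ ∞ fun p : Heis d => gaugeDeriv k p * ζ (koranyi p) :=
    fun k => (contDiff_gaugeDeriv k).mul hζ.contDiff_comp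
  have csΦ : ∀ k : Fin d ⊕ Fin d,
      HasCompactSupport fun p : Heis d => gaugeDeriv k p * ζ (koranyi p) :=
    fun k => (hasCompactSupport_comp_koranyi hζ.compact).mul_left
  have key : ∀ p : Heis d, ∑ k, hDeriv k (fun p => gaugeDeriv k p * ζ (koranyi p)) p
      = c (koranyi p) * (4 * zSq p) := by
    intro p
    have : ∀ k, hDeriv k (fun p => gaugeDeriv k p * ζ (koranyi p)) p
        = ζ (koranyi p) * hDeriv k (gaugeDeriv k) p
          + deriv ζ (koranyi p) * (4 * koranyi p ^ 3)⁻¹ * gaugeDeriv k p ^ 2 := fun k => by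
      rw [hDeriv_mul (contDiff_gaugeDeriv k) hζ.contDiff_comp, hζ.hDeriv_comp]; ring
    simp_rw [this]
    rw [Finset.sum_add_distrib, ← Finset.mul_sum, ← Finset.mul_sum, sum_hDeriv_gaugeDeriv,
      sum_sq_gaugeDeriv, ← koranyi_pow_four_eq_gauge]
    rcases (koranyi_nonneg p).eq_or_lt with h0 | h0
    · rw [← h0, hζ.zero le_rfl, hζ.deriv.zero le_rfl, hc.zero le_rfl]; ring
    · rw [hθ.deriv_mul_inv_pow _ h0]
      simp only [hζd, hcd]
      push_cast
      field_simp
      ring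
  have i1 : ∀ k : Fin d ⊕ Fin d, Integrable fun p =>
      hDeriv k (fun p => gaugeDeriv k p * ζ (koranyi p)) p • u p := fun k =>
    h1.integrable_smul_left_of_hasCompactSupport (continuous_hDeriv (smΦ k) k)
      (hasCompactSupport_hDeriv (csΦ k) k)
  have i2 : ∀ k : Fin d ⊕ Fin d, Integrable fun p =>
      (gaugeDeriv k p * ζ (koranyi p)) • g p k := fun k =>
    (locallyIntegrable_component h2 k).integrable_smul_left_of_hasCompactSupport
      (smΦ k).continuous (csΦ k)
  have main : ∫ p, c (koranyi p) • ((4 * zSq p) • u p)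
      = - ∫ p, ζ (koranyi p) • radialPart g p := by
    calc _ = ∫ p, ∑ k, hDeriv k (fun p => gaugeDeriv k p * ζ (koranyi p)) p • u p := by
          refine integral_congr_ae (Filter.Eventually.of_forall fun p => ?_)
          simp only
          rw [← Finset.sum_smul, key, smul_smul]
      _ = ∑ k, - ∫ p, (gaugeDeriv k p * ζ (koranyi p)) • g p k := by
          rw [integral_finsetSum _ fun k _ => i1 k]
          exact Finset.sum_congr rfl fun k _ => h3 _ (smΦ k) (csΦ k) k
      _ = _ := by
          rw [Finset.sum_neg_distrib, ← integral_finsetSum _ fun k _ => i2 k]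
          congr 1
          refine integral_congr_ae (Filter.Eventually.of_forall fun p => ?_)
          simp only [radialPart, Finset.smul_sum, smul_smul]
          exact Finset.sum_congr rfl fun k _ => by rw [mul_comm]
  have l1 : LocallyIntegrable fun p : Heis d => (4 * zSq p) • u p :=
    locallyIntegrable_continuous_smul h1 (continuous_const.mul contDiff_zSq.continuous)
  rw [hc.integral l1, hζ.integral (locallyIntegrable_radialPart h2)] at main
  have hsph : ∀ᵐ r, 0 < r → sphereInt (fun p : Heis d => (4 * zSq p) • u p) r
      = (4 * sphereMoment d * r ^ 2) • U r := by
    have e : (fun p : Heis d => (4 * zSq p) • u p) = fun p => (4 * (zSq p : ℂ)) * u p := by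
      funext p; rw [Complex.real_smul]; push_cast; rfl
    rw [e]
    filter_upwards [sphereInt_mul_of_radial (F := fun p => 4 * (zSq p : ℂ)) hU] with r hr h0
    rw [hr h0]
    have : sphereInt (fun p : Heis d => 4 * (zSq p : ℂ)) r
        = ((4 * (r ^ 2 * sphereMoment d) : ℝ) : ℂ) := by
      rw [← sphereInt_zSq, sphereInt, sphereInt, integral_const_mul, integral_complex_ofReal]
      push_cast; rfl
    rw [this, Complex.real_smul]; push_cast; ring
  have m1 : ∫ r, c r • (r ^ (2 * d + 1) • sphereInt (fun p : Heis d => (4 * zSq p) • u p) r)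
      = (4 * sphereMoment d) • ∫ r, deriv θ r • U r := by
    rw [← integral_smul]
    refine integral_congr_ae ?_
    filter_upwards [hsph] with r hr
    rcases le_or_gt r 0 with h0 | h0
    · rw [hc.zero h0, hθ.deriv.zero h0]; simp
    · rw [hr h0, smul_smul, smul_smul, smul_smul]
      congr 1
      simp only [hcd]
      field_simp
      ring
  have m2 : ∫ r, ζ r • (r ^ (2 * d + 1) • sphereInt (radialPart g) r)
      = (4 * sphereMoment d) • ∫ r, θ r • radialSlope g r := by
    rw [← integral_smul]
    refine integral_congr_ae (Filter.Eventually.of_forall fun r => ?_)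
    simp only
    rcases le_or_gt r 0 with h0 | h0
    · rw [hζ.zero h0, hθ.zero h0]; simp
    · rw [radialSlope, smul_smul, smul_smul, smul_smul]
      congr 1
      simp only [hζd]
      field_simp
      ring
  rw [m1, m2, ← smul_neg] at main
  exact smul_right_injective ℂ (by positivity : 4 * sphereMoment d ≠ 0) main

theorem hDeriv_ofReal {φ : Heis d → ℝ} (h : ContDiff ℝ ∞ φ) (k : Fin d ⊕ Fin d) (p : Heis d) :
    hDeriv k (fun p => (φ p : ℂ)) p = ((hDeriv k φ p : ℝ) : ℂ) := by
  have := (Complex.ofRealCLM.hasFDerivAt.comp p (h.differentiable (by simp) p).hasFDerivAt).fderiv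
  rw [hDeriv, hDeriv]
  exact congrArg (fun T => T (hField k p)) this

theorem inner_hGrad_radial {θ : ℝ → ℝ} (hθ : IsTest θ)
    (g : Heis d → EuclideanSpace ℂ (Fin d ⊕ Fin d)) (p : Heis d) :
    inner ℂ (hGrad (fun p : Heis d => (θ (koranyi p) : ℂ)) p) (g p)
      = (deriv θ (koranyi p) * (koranyi p ^ 3)⁻¹) • ((1 / 4 : ℝ) • radialPart g p) := by
  rw [PiLp.inner_apply, radialPart, Finset.smul_sum, Finset.smul_sum]
  refine Finset.sum_congr rfl fun k _ => ?_
  rw [hGrad]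
  simp only [RCLike.inner_apply]
  rw [hDeriv_ofReal hθ.contDiff_comp, Complex.conj_ofReal, hθ.hDeriv_comp, mul_comm,
    ← Complex.real_smul, smul_smul, smul_smul]
  congr 1
  rw [mul_inv]; ring

/-- For a test function θ(ρ) only the component of g along ∇ρ⁴ enters, and the radial factor u
leaves each sphere integral. The equation then says that r^(2d+1) times the radial slope has a weak
derivative given by the spherical integrals of V and f. -/
theorem isWeakPrim_of_isWeakSolution (hd : 1 ≤ d) {V : Heis d → ℝ} {lam : ℂ} {f u : Heis d → ℂ}
    {g : Heis d → EuclideanSpace ℂ (Fin d ⊕ Fin d)}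
    (hVu : LocallyIntegrable fun p => (V p : ℂ) * u p) (hf : LocallyIntegrable f)
    (hg : HasWeakHGrad u g)
    (hsol : ∀ v : Heis d → ℂ, ContDiff ℝ ∞ v → HasCompactSupport v →
        - (∫ p, inner ℂ (hGrad v p) (g p))
          - (∫ p, (starRingEnd ℂ) (v p) * ((V p : ℂ) * u p))
          + lam * (∫ p, (starRingEnd ℂ) (v p) * u p)
        = ∫ p, (starRingEnd ℂ) (v p) * f p)
    {U : ℝ → ℂ} (hU : ∀ᵐ p, u p = U (koranyi p)) :
    IsWeakPrim (fun r => r ^ (2 * d + 1) • radialSlope g r)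
      (fun r => (r ^ (2 * d + 1) * (sphereMoment d)⁻¹) • (sphereInt (fun p => (V p : ℂ)) r * U r
        - lam * sphereMass d * U r + sphereInt f r)) := by
  obtain ⟨h1, h2, -⟩ := hg
  have hκ := (sphere_constants hd).2.1
  have lU := locallyIntegrableOn_profile hd h1 hU
  have lVu : LocallyIntegrableOn (fun r => sphereInt (fun p => (V p : ℂ)) r * U r) (Ioi 0) := by
    refine locallyIntegrableOn_congr (locallyIntegrable_polar hVu) ?_
    filter_upwards [sphereInt_mul_of_radial (F := fun p => (V p : ℂ)) hU] with r hr h0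
    rw [hr h0, mul_comm]
  have lcU : LocallyIntegrableOn (fun r => lam * sphereMass d * U r) (Ioi 0) := by
    refine locallyIntegrableOn_of_Icc fun a b ha hab => ?_
    exact (lU.integrableOn_compact_subset (fun x hx => ha.trans_le hx.1)
      isCompact_Icc).const_mul _
  have lf := locallyIntegrable_polar hf
  have lG := (lVu.sub lcU).add lf
  refine ⟨locallyIntegrableOn_smul (locallyIntegrableOn_radialSlope hd h2)
    (continuousOn_pow _), locallyIntegrableOn_smul lG
    ((continuousOn_pow _).mul continuousOn_const), fun θ t1 t2 t3 => ?_⟩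
  have hθ : IsTest θ := ⟨t1, t2, t3⟩
  have hc := hθ.deriv.mul_inv_pow 3
  set c : ℝ → ℝ := fun r => deriv θ r * (r ^ 3)⁻¹ with hcd
  have eq := hsol (fun p => (θ (koranyi p) : ℂ)) (Complex.ofRealCLM.contDiff.comp hθ.contDiff_comp)
    ((hasCompactSupport_comp_koranyi hθ.compact).comp_left Complex.ofReal_zero)
  simp_rw [inner_hGrad_radial hθ, Complex.conj_ofReal, ← Complex.real_smul (x := θ _)] at eq
  have l4 : LocallyIntegrable fun p => (1 / 4 : ℝ) • radialPart g p :=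
    locallyIntegrable_continuous_smul (locallyIntegrable_radialPart h2) continuous_const
  rw [hc.integral l4, hθ.integral hVu, hθ.integral h1, hθ.integral hf] at eq
  have m1 : ∫ r, c r • (r ^ (2 * d + 1) • sphereInt (fun p => (1 / 4 : ℝ) • radialPart g p) r)
      = sphereMoment d • ∫ r, deriv θ r • (r ^ (2 * d + 1) • radialSlope g r) := by
    rw [← integral_smul]
    refine integral_congr_ae (Filter.Eventually.of_forall fun r => ?_)
    simp only
    rcases le_or_gt r 0 with h0 | h0
    · rw [hc.zero h0, hθ.deriv.zero h0]; simp
    · have : sphereInt (fun p => (1 / 4 : ℝ) • radialPart g p) r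
          = (1 / 4 : ℝ) • sphereInt (radialPart g) r := by
        unfold sphereInt; rw [integral_smul]
      rw [this, radialSlope, smul_smul, smul_smul, smul_smul, smul_smul, smul_smul]
      congr 1
      simp only [hcd]
      field_simp
  have w : ∀ {G : ℝ → ℂ}, LocallyIntegrableOn G (Ioi 0) →
      Integrable fun r => θ r • (r ^ (2 * d + 1) • G r) := fun hG =>
    integrable_smul_of_tsupport hθ.continuous hθ.compact hθ.supp
      (locallyIntegrableOn_smul hG (continuousOn_pow _))
  have m2 : ∫ r, θ r • (r ^ (2 * d + 1) • sphereInt (fun p => (V p : ℂ) * u p) r)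
      = ∫ r, θ r • (r ^ (2 * d + 1) • (sphereInt (fun p => (V p : ℂ)) r * U r)) := by
    refine integral_congr_ae ?_
    filter_upwards [sphereInt_mul_of_radial (F := fun p => (V p : ℂ)) hU] with r hr
    rcases le_or_gt r 0 with h0 | h0
    · rw [hθ.zero h0]; simp
    · rw [hr h0, mul_comm (U r)]
  have m3 : lam * ∫ r, θ r • (r ^ (2 * d + 1) • sphereInt u r)
      = ∫ r, θ r • (r ^ (2 * d + 1) • (lam * sphereMass d * U r)) := by
    rw [← integral_const_mul]
    refine integral_congr_ae ?_
    filter_upwards [sphereInt_of_radial hU] with r hr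
    rcases le_or_gt r 0 with h0 | h0
    · rw [hθ.zero h0]; simp
    · rw [hr h0]; simp only [Complex.real_smul]; ring
  have m4 : ∫ r, θ r • ((r ^ (2 * d + 1) * (sphereMoment d)⁻¹) •
        (sphereInt (fun p => (V p : ℂ)) r * U r - lam * sphereMass d * U r + sphereInt f r))
      = (sphereMoment d)⁻¹ • ((∫ r, θ r • (r ^ (2 * d + 1) •
          (sphereInt (fun p => (V p : ℂ)) r * U r)))
        - (∫ r, θ r • (r ^ (2 * d + 1) • (lam * sphereMass d * U r)))
        + ∫ r, θ r • (r ^ (2 * d + 1) • sphereInt f r)) := by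
    rw [← integral_sub (w lVu) (w lcU)]
    erw [← integral_add ((w lVu).sub (w lcU)) (w lf)]
    rw [← integral_smul]
    refine integral_congr_ae (Filter.Eventually.of_forall fun r => ?_)
    simp only [Complex.real_smul, Pi.sub_apply]
    push_cast
    ring
  rw [m1, m2, m3] at eq
  rw [m4, ← eq, ← smul_neg, eq_inv_smul_iff₀ hκ.ne']
  ring

/-- Directions spanning the Euler field `(z, 2t)`. -/
noncomputable def eulerDir : (Fin d ⊕ Fin d) ⊕ Unit → Heis d
  | Sum.inl (Sum.inl j) => (Pi.single j 1, 0)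
  | Sum.inl (Sum.inr j) => (Pi.single j Complex.I, 0)
  | Sum.inr _ => (0, 1)

/-- The coefficients of the Euler field along `eulerDir`. -/
noncomputable def eulerCoord : (Fin d ⊕ Fin d) ⊕ Unit → Heis d → ℝ
  | Sum.inl (Sum.inl j), p => (p.1 j).re
  | Sum.inl (Sum.inr j), p => (p.1 j).im
  | Sum.inr _, p => 2 * p.2

theorem contDiff_eulerCoord (i : (Fin d ⊕ Fin d) ⊕ Unit) :
    ContDiff ℝ ∞ (eulerCoord i : Heis d → ℝ) := by
  rcases i with (j | j) | _
  · exact contDiff_re_apply j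
  · exact contDiff_im_apply j
  · exact contDiff_const.mul contDiff_snd

theorem sum_eulerCoord_smul (p : Heis d) :
    ∑ i, eulerCoord i p • eulerDir i = (p.1, 2 * p.2) := by
  rw [Fintype.sum_sum_type, Fintype.sum_sum_type]
  simp only [eulerCoord, eulerDir]
  refine Prod.ext (funext fun j => ?_) ?_
  · simp only [Prod.fst_add, Prod.fst_sum, Prod.smul_fst, Pi.add_apply, Finset.sum_apply,
      Pi.smul_apply, Pi.single_apply]
    simp [Complex.re_add_im]
  · simp [Prod.snd_sum]

theorem sum_fderiv_eulerCoord (p : Heis d) :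
    ∑ i, fderiv ℝ (eulerCoord i : Heis d → ℝ) p (eulerDir i) = 2 * d + 2 := by
  have h1 : ∀ j : Fin d, fderiv ℝ (eulerCoord (Sum.inl (Sum.inl j)) : Heis d → ℝ) p
      (eulerDir (Sum.inl (Sum.inl j))) = 1 := fun j =>
    fderiv_eq_of_line (contDiff_eulerCoord _) (g := fun s => (p.1 j).re + s * 1)
      (fun s => by simp [eulerCoord, eulerDir]) (hasDerivAt_affine _ _)
  have h2 : ∀ j : Fin d, fderiv ℝ (eulerCoord (Sum.inl (Sum.inr j)) : Heis d → ℝ) p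
      (eulerDir (Sum.inl (Sum.inr j))) = 1 := fun j =>
    fderiv_eq_of_line (contDiff_eulerCoord _) (g := fun s => (p.1 j).im + s * 1)
      (fun s => by simp [eulerCoord, eulerDir]) (hasDerivAt_affine _ _)
  have h3 : fderiv ℝ (eulerCoord (Sum.inr ()) : Heis d → ℝ) p (eulerDir (Sum.inr ())) = 2 :=
    fderiv_eq_of_line (contDiff_eulerCoord _) (g := fun s => 2 * p.2 + s * 2)
      (fun s => by simp [eulerCoord, eulerDir]; ring) (hasDerivAt_affine _ _)
  rw [Fintype.sum_sum_type, Fintype.sum_sum_type]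
  simp [h1, h2, h3]
  ring

/-- The derivative of `V` along the Euler field. -/
noncomputable def eulerDeriv (D : Heis d → Heis d →L[ℝ] ℝ) (p : Heis d) : ℝ := D p (p.1, 2 * p.2)

theorem eulerDeriv_eq_sum (D : Heis d → Heis d →L[ℝ] ℝ) (p : Heis d) :
    eulerDeriv D p = ∑ i, eulerCoord i p • D p (eulerDir i) := by
  rw [eulerDeriv, ← sum_eulerCoord_smul, map_sum]
  simp

theorem locallyIntegrable_eulerDeriv {D : Heis d → Heis d →L[ℝ] ℝ} (h : LocallyIntegrable D) :
    LocallyIntegrable (eulerDeriv D) := by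
  rw [show eulerDeriv D = fun p => ∑ i, eulerCoord i p • D p (eulerDir i) from
    funext (eulerDeriv_eq_sum D)]
  exact locallyIntegrable_finsetSum _ fun i _ => locallyIntegrable_continuous_smul
    (locallyIntegrable_clm h (ContinuousLinearMap.apply ℝ ℝ (eulerDir i)))
    (contDiff_eulerCoord i).continuous

/-- The weak derivative is tested with ζ(ρ) times the Euler field (z, 2t), which generates the
dilations and is therefore transversal to the spheres. V itself is not radial; only its spherical
integrals are differentiated. -/
theorem isWeakPrim_of_hasWeakFDeriv {V : Heis d → ℝ} {D : Heis d → Heis d →L[ℝ] ℝ}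
    (h : HasWeakFDeriv V D) : IsWeakPrim (fun r => ((sphereInt V r : ℝ) : ℂ))
      (fun r => ((r⁻¹ * sphereInt (eulerDeriv D) r : ℝ) : ℂ)) := by
  obtain ⟨h1, h2, h3⟩ := h
  have l1 := locallyIntegrable_polar h1
  have l2 : LocallyIntegrableOn (fun r => r⁻¹ * sphereInt (eulerDeriv D) r) (Ioi 0) :=
    locallyIntegrableOn_smul (locallyIntegrable_polar (locallyIntegrable_eulerDeriv h2))
      (continuousOn_id.inv₀ fun r hr => ne_of_gt hr)
  have lc : ∀ {f : ℝ → ℝ}, LocallyIntegrableOn f (Ioi 0) →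
      LocallyIntegrableOn (fun r => (f r : ℂ)) (Ioi 0) := fun hf => by
    refine locallyIntegrableOn_of_Icc fun a b ha hab => ?_
    exact (hf.integrableOn_compact_subset (fun x hx => ha.trans_le hx.1) isCompact_Icc).ofReal
  refine ⟨lc l1, lc l2, fun θ t1 t2 t3 => ?_⟩
  have hθ : IsTest θ := ⟨t1, t2, t3⟩
  -- The Euler field has divergence 2d + 2, so division by r^(2d+2) cancels the zeroth-order term.
  have hζ := hθ.mul_inv_pow (2 * d + 2)
  have hc := hθ.deriv.mul_inv_pow (2 * d + 1)
  set ζ : ℝ → ℝ := fun r => θ r * (r ^ (2 * d + 2))⁻¹ with hζd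
  set c : ℝ → ℝ := fun r => deriv θ r * (r ^ (2 * d + 1))⁻¹ with hcd
  have smΦ : ∀ i, ContDiff ℝ ∞ fun p : Heis d => eulerCoord i p * ζ (koranyi p) :=
    fun i => (contDiff_eulerCoord i).mul hζ.contDiff_comp
  have csΦ : ∀ i, HasCompactSupport fun p : Heis d => eulerCoord i p * ζ (koranyi p) :=
    fun i => (hasCompactSupport_comp_koranyi hζ.compact).mul_left
  have key : ∀ p : Heis d, ∑ i, fderiv ℝ (fun p => eulerCoord i p * ζ (koranyi p)) p (eulerDir i)
      = c (koranyi p) := by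
    intro p
    have : ∀ i, fderiv ℝ (fun p => eulerCoord i p * ζ (koranyi p)) p (eulerDir i)
        = ζ (koranyi p) * fderiv ℝ (eulerCoord i) p (eulerDir i)
          + fderiv ℝ (fun p : Heis d => ζ (koranyi p)) p (eulerCoord i p • eulerDir i) := by
      intro i
      have e : fderiv ℝ (fun p => eulerCoord i p * ζ (koranyi p)) p
          = eulerCoord i p • fderiv ℝ (fun p : Heis d => ζ (koranyi p)) p
            + ζ (koranyi p) • fderiv ℝ (eulerCoord i) p :=
        (((contDiff_eulerCoord i).differentiable (by simp) p).hasFDerivAt.mul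
          (hζ.contDiff_comp.differentiable (by simp) p).hasFDerivAt).fderiv
      rw [e, map_smul]
      simp only [add_apply, smul_apply, smul_eq_mul]
      ring
    simp_rw [this]
    rw [Finset.sum_add_distrib, ← Finset.mul_sum, sum_fderiv_eulerCoord, ← map_sum,
      sum_eulerCoord_smul, (hζ.hasFDerivAt_comp p).fderiv]
    simp only [smul_apply, smul_eq_mul]
    rw [fderiv_gauge_euler, ← koranyi_pow_four_eq_gauge]
    rcases (koranyi_nonneg p).eq_or_lt with h0 | h0
    · rw [← h0, hζ.zero le_rfl, hζ.deriv.zero le_rfl, hc.zero le_rfl]; ring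
    · rw [hθ.deriv_mul_inv_pow _ h0]
      simp only [hζd, hcd]
      push_cast
      field_simp
      ring
  have i1 : ∀ i, Integrable fun p =>
      V p * fderiv ℝ (fun p => eulerCoord i p * ζ (koranyi p)) p (eulerDir i) := fun i => by
    have := h1.integrable_smul_left_of_hasCompactSupport
      (((smΦ i).continuous_fderiv (by simp)).clm_apply (continuous_const (y := eulerDir i)))
      ((csΦ i).fderiv_apply (𝕜 := ℝ) (eulerDir i))
    simpa only [smul_eq_mul, mul_comm] using this
  have i2 : ∀ i, Integrable fun p =>
      D p (eulerDir i) * (eulerCoord i p * ζ (koranyi p)) := fun i => by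
    have := (locallyIntegrable_clm h2 (ContinuousLinearMap.apply ℝ ℝ
      (eulerDir i))).integrable_smul_left_of_hasCompactSupport (smΦ i).continuous (csΦ i)
    simpa only [smul_eq_mul, mul_comm, ContinuousLinearMap.apply_apply] using this
  have main : ∫ p, c (koranyi p) • V p = - ∫ p, ζ (koranyi p) • eulerDeriv D p := by
    calc _ = ∫ p, ∑ i, V p * fderiv ℝ (fun p => eulerCoord i p * ζ (koranyi p)) p (eulerDir i) := by
          refine integral_congr_ae (Filter.Eventually.of_forall fun p => ?_)
          simp only
          rw [← Finset.mul_sum, key, smul_eq_mul, mul_comm]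
      _ = ∑ i, - ∫ p, D p (eulerDir i) * (eulerCoord i p * ζ (koranyi p)) := by
          rw [integral_finsetSum _ fun i _ => i1 i]
          exact Finset.sum_congr rfl fun i _ => h3 _ (smΦ i) (csΦ i) _
      _ = _ := by
          rw [Finset.sum_neg_distrib, ← integral_finsetSum _ fun i _ => i2 i]
          congr 1
          refine integral_congr_ae (Filter.Eventually.of_forall fun p => ?_)
          simp only [eulerDeriv_eq_sum, smul_eq_mul, Finset.mul_sum]
          exact Finset.sum_congr rfl fun i _ => by ring
  rw [hc.integral h1, hζ.integral (locallyIntegrable_eulerDeriv h2)] at main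
  have m1 : ∫ r, c r • (r ^ (2 * d + 1) • sphereInt V r) = ∫ r, deriv θ r * sphereInt V r := by
    refine integral_congr_ae (Filter.Eventually.of_forall fun r => ?_)
    simp only
    rcases le_or_gt r 0 with h0 | h0
    · rw [hc.zero h0, hθ.deriv.zero h0]; simp
    · simp only [hcd, smul_eq_mul]
      field_simp
  have m2 : ∫ r, ζ r • (r ^ (2 * d + 1) • sphereInt (eulerDeriv D) r)
      = ∫ r, θ r * (r⁻¹ * sphereInt (eulerDeriv D) r) := by
    refine integral_congr_ae (Filter.Eventually.of_forall fun r => ?_)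
    simp only
    rcases le_or_gt r 0 with h0 | h0
    · rw [hζ.zero h0, hθ.zero h0]; simp
    · simp only [hζd, smul_eq_mul]
      field_simp
      ring
  rw [m1, m2] at main
  simp_rw [Complex.real_smul, ← Complex.ofReal_mul]
  rw [integral_complex_ofReal, integral_complex_ofReal, main, Complex.ofReal_neg]

end Heisenberg

/-! ### Norms of radial functions and of spherical means. -/

namespace Heisenberg

open HalfLine

variable {d : ℕ}

theorem eLpNorm_two_sq {α E : Type*} [MeasurableSpace α] [NormedAddCommGroup E] (F : α → E)
    (μ : Measure α) : eLpNorm F 2 μ ^ 2 = ∫⁻ x, ‖F x‖ₑ ^ 2 ∂μ := by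
  have := eLpNorm_nnreal_pow_eq_lintegral (f := F) (μ := μ) (p := 2) (by norm_num)
  simp only [NNReal.coe_ofNat, ENNReal.coe_ofNat, ENNReal.rpow_ofNat] at this
  exact this

theorem enorm_sq_eq_ofReal {E : Type*} [NormedAddCommGroup E] (x : E) :
    ‖x‖ₑ ^ 2 = ENNReal.ofReal (‖x‖ ^ 2) := by
  rw [ENNReal.ofReal_pow (norm_nonneg _), ofReal_norm]

theorem aemeasurable_polar {F : Heis d → ℝ≥0∞} (hF : AEMeasurable F) :
    ∀ᵐ r, 0 < r → AEMeasurable (fun ξ => F (dil r ξ)) (sphereMeasure d) := by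
  obtain ⟨G, hG, h⟩ := hF
  filter_upwards [ae_polar h] with r hr h0
  exact ⟨fun ξ => G (dil r ξ),
    hG.comp (continuous_dil.measurable.comp measurable_prodMk_left), hr h0⟩

theorem lintegral_radial_mul {e : ℝ → ℝ≥0∞} (he : AEMeasurable e (volume.restrict (Ioi 0)))
    {w : Heis d → ℝ≥0∞} (hw : AEMeasurable w) :
    ∫⁻ p, e (koranyi p) * w p = ∫⁻ r in Ioi 0, ENNReal.ofReal (r ^ (2 * d + 1)) *
      (e r * ∫⁻ ξ, w (dil r ξ) ∂(sphereMeasure d)) := by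
  have hm : AEMeasurable fun p => e (koranyi p) * w p :=
    (he.comp_quasiMeasurePreserving quasiMeasurePreserving_koranyi).mul hw
  rw [lintegral_polar_ae hm]
  refine lintegral_congr_ae ((ae_restrict_iff' measurableSet_Ioi).2 ?_)
  filter_upwards [aemeasurable_polar hw] with r hr h0
  congr 1
  rw [← lintegral_const_mul'' _ (hr h0)]
  refine lintegral_congr_ae ?_
  filter_upwards [ae_sphereMeasure] with ξ hξ
  rw [koranyi_dil, hξ, mul_one, abs_of_pos h0]

theorem integrable_zSq_sphere : Integrable (zSq : Heis d → ℝ) (sphereMeasure d) := by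
  refine Integrable.of_bound contDiff_zSq.continuous.aestronglyMeasurable 1 ?_
  filter_upwards [ae_sphereMeasure] with ξ hξ
  rw [Real.norm_of_nonneg (zSq_nonneg _), ← zNorm_sq_eq_zSq]
  have := zNorm_le_koranyi ξ
  nlinarith [zNorm_nonneg ξ]

theorem sphereMoment_nonneg (d : ℕ) : 0 ≤ sphereMoment d :=
  integral_nonneg fun ξ => zSq_nonneg ξ

theorem lintegral_zSq_dil (r : ℝ) : ∫⁻ ξ, ENNReal.ofReal (zSq (dil r ξ)) ∂(sphereMeasure d)
    = ENNReal.ofReal (r ^ 2 * sphereMoment d) := by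
  simp_rw [zSq_dil]
  rw [← ofReal_integral_eq_lintegral_ofReal (integrable_zSq_sphere.const_mul _)
    (Filter.Eventually.of_forall fun ξ => mul_nonneg (sq_nonneg r) (zSq_nonneg ξ)),
    integral_const_mul, sphereMoment]

theorem lintegral_sq_radial {v : ℝ → ℂ} (hv : AEStronglyMeasurable v (volume.restrict (Ioi 0))) :
    ∫⁻ p : Heis d, ‖v (koranyi p)‖ₑ ^ 2
      = ENNReal.ofReal (sphereMass d) * ∫⁻ r in Ioi 0, ENNReal.ofReal (r ^ (2 * d + 1) * ‖v r‖ ^ 2)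
      := by
  have h := lintegral_radial_mul (d := d) (e := fun r => ‖v r‖ₑ ^ 2) (hv.enorm.pow_const 2)
    (w := fun _ => 1) aemeasurable_const
  simp only [mul_one, lintegral_const, one_mul] at h
  rw [h, ← lintegral_const_mul' _ _ ENNReal.ofReal_ne_top]
  refine setLIntegral_congr_fun measurableSet_Ioi fun r hr => ?_
  have hr : 0 < r := hr
  rw [sphereMass, Measure.real, ENNReal.ofReal_toReal (measure_ne_top _ _),
    ENNReal.ofReal_mul (by positivity), enorm_sq_eq_ofReal]
  ring

theorem lintegral_sq_radial_mul_zSq {v : ℝ → ℂ}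
    (hv : AEStronglyMeasurable v (volume.restrict (Ioi 0))) :
    ∫⁻ p : Heis d, ‖v (koranyi p)‖ₑ ^ 2 * ENNReal.ofReal (zSq p)
      = ENNReal.ofReal (sphereMoment d) *
        ∫⁻ r in Ioi 0, ENNReal.ofReal (r ^ (2 * d + 1) * (r * ‖v r‖) ^ 2) := by
  rw [lintegral_radial_mul (d := d) (e := fun r => ‖v r‖ₑ ^ 2) (hv.enorm.pow_const 2)
    contDiff_zSq.continuous.measurable.ennreal_ofReal.aemeasurable,
    ← lintegral_const_mul' _ _ ENNReal.ofReal_ne_top]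
  refine setLIntegral_congr_fun measurableSet_Ioi fun r hr => ?_
  have hr : 0 < r := hr
  rw [lintegral_zSq_dil, enorm_sq_eq_ofReal, ← ENNReal.ofReal_mul (by positivity),
    ← ENNReal.ofReal_mul (by positivity), ← ENNReal.ofReal_mul (sphereMoment_nonneg d)]
  congr 1
  ring

/-- Cauchy–Schwarz on spheres. -/
theorem enorm_sphereInt_sq_le {F : Heis d → ℂ} {A B : Heis d → ℝ≥0∞} (hA : AEMeasurable A)
    (hB : AEMeasurable B) (h : ∀ᵐ p, ‖F p‖ₑ ^ 2 ≤ A p * B p) :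
    ∀ᵐ r, 0 < r → ‖sphereInt F r‖ₑ ^ 2
      ≤ (∫⁻ ξ, A (dil r ξ) ∂(sphereMeasure d)) * ∫⁻ ξ, B (dil r ξ) ∂(sphereMeasure d) := by
  filter_upwards [aemeasurable_polar hA, aemeasurable_polar hB, ae_polar h] with r h1 h2 h3 h0
  have e2 : ∀ x : ℝ≥0∞, (x ^ (1 / 2 : ℝ)) ^ 2 = x := fun x => by
    rw [← ENNReal.rpow_natCast, ← ENNReal.rpow_mul]; norm_num
  have e1 : ∀ x : ℝ≥0∞, (x ^ 2) ^ (1 / 2 : ℝ) = x := fun x => by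
    rw [← ENNReal.rpow_natCast, ← ENNReal.rpow_mul]; norm_num
  have step : ‖sphereInt F r‖ₑ
      ≤ ((∫⁻ ξ, A (dil r ξ) ∂(sphereMeasure d)) * ∫⁻ ξ, B (dil r ξ) ∂(sphereMeasure d))
        ^ (1 / 2 : ℝ) := by
    have hol := ENNReal.lintegral_mul_le_Lp_mul_Lq (sphereMeasure d) Real.HolderConjugate.two_two
      ((h1 h0).pow_const (1 / 2 : ℝ)) ((h2 h0).pow_const (1 / 2 : ℝ))
    simp only [ENNReal.rpow_ofNat, e2, Pi.mul_apply] at hol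
    rw [ENNReal.mul_rpow_of_nonneg _ _ (by norm_num)]
    refine (enorm_integral_le_lintegral_enorm _).trans (le_trans (lintegral_mono_ae ?_) hol)
    filter_upwards [h3 h0] with ξ hξ
    rw [← e1 ‖F (dil r ξ)‖ₑ, ← ENNReal.mul_rpow_of_nonneg _ _ (by norm_num)]
    exact ENNReal.rpow_le_rpow hξ (by norm_num)
  calc _ ≤ _ := pow_le_pow_left' step 2
    _ = _ := e2 _

/-- The horizontal gradient of a radial function with radial derivative `h`. -/
noncomputable def radialGrad (h : ℝ → ℂ) (p : Heis d) : EuclideanSpace ℂ (Fin d ⊕ Fin d) :=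
  WithLp.toLp 2 fun k => (gaugeDeriv k p * (4 * koranyi p ^ 3)⁻¹) • h (koranyi p)

/-- From |∇ρ⁴|² = 16|z|²ρ⁴: the factor |z|²/ρ² is not radial, which is why κ, and not the mass of
the sphere, appears in gradient norms. -/
theorem norm_sq_radialGrad (h : ℝ → ℂ) {p : Heis d} (hp : 0 < koranyi p) :
    ‖radialGrad h p‖ ^ 2 = ‖((koranyi p)⁻¹ : ℝ) • h (koranyi p)‖ ^ 2 * zSq p := by
  rw [EuclideanSpace.norm_sq_eq]
  simp only [radialGrad, norm_smul, mul_pow, Real.norm_eq_abs, sq_abs]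
  rw [← Finset.sum_mul, ← Finset.sum_mul, sum_sq_gaugeDeriv, ← koranyi_pow_four_eq_gauge]
  field_simp
  ring

theorem ae_koranyi_pos : ∀ᵐ p : Heis d, 0 < koranyi p :=
  ae_koranyi (Filter.Eventually.of_forall fun _ h => h)

theorem lintegral_sq_radialGrad {h : ℝ → ℂ}
    (hm : AEStronglyMeasurable h (volume.restrict (Ioi 0))) :
    ∫⁻ p : Heis d, ‖radialGrad h p‖ₑ ^ 2
      = ENNReal.ofReal (sphereMoment d) *
        ∫⁻ r in Ioi 0, ENNReal.ofReal (r ^ (2 * d + 1) * ‖h r‖ ^ 2) := by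
  have hm' : AEStronglyMeasurable (fun r : ℝ => (r⁻¹ : ℝ) • h r) (volume.restrict (Ioi 0)) :=
    measurable_inv.aestronglyMeasurable.smul hm
  trans ∫⁻ p : Heis d, ‖((koranyi p)⁻¹ : ℝ) • h (koranyi p)‖ₑ ^ 2 * ENNReal.ofReal (zSq p)
  · refine lintegral_congr_ae ?_
    filter_upwards [ae_koranyi_pos] with p hp
    rw [enorm_sq_eq_ofReal, enorm_sq_eq_ofReal, ← ENNReal.ofReal_mul (by positivity),
      norm_sq_radialGrad h hp]
  · rw [lintegral_sq_radial_mul_zSq hm']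
    congr 1
    refine setLIntegral_congr_fun measurableSet_Ioi fun r hr => ?_
    have hr : 0 < r := hr
    rw [norm_smul, Real.norm_of_nonneg (by positivity), mul_inv_cancel_left₀ hr.ne']

theorem aestronglyMeasurable_comp_koranyi {v : ℝ → ℂ}
    (hv : AEStronglyMeasurable v (volume.restrict (Ioi 0))) :
    AEStronglyMeasurable fun p : Heis d => v (koranyi p) :=
  hv.comp_quasiMeasurePreserving quasiMeasurePreserving_koranyi

theorem aestronglyMeasurable_radialGrad {h : ℝ → ℂ}
    (hm : AEStronglyMeasurable h (volume.restrict (Ioi 0))) :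
    AEStronglyMeasurable (radialGrad h : Heis d → _) := by
  have e : (radialGrad h : Heis d → _) = fun p => ∑ k,
      (gaugeDeriv k p * (4 * koranyi p ^ 3)⁻¹) •
        (h (koranyi p) • EuclideanSpace.single k (1 : ℂ)) := by
    funext p
    refine PiLp.ext fun k => ?_
    simp [radialGrad, Finset.sum_apply, Pi.single_apply, -Fintype.sum_sum_type]
  rw [e]
  refine Finset.aestronglyMeasurable_fun_sum _ fun k _ => ?_
  refine ((contDiff_gaugeDeriv k).continuous.measurable.mul
    (continuous_koranyi.measurable.pow_const 3 |>.const_mul 4).inv).aestronglyMeasurable.smul ?_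
  exact (aestronglyMeasurable_comp_koranyi hm).smul_const _

theorem memLp_two_of_lintegral {α E : Type*} [MeasurableSpace α] [NormedAddCommGroup E]
    {F : α → E} {μ : Measure α} (hF : AEStronglyMeasurable F μ) (h : ∫⁻ x, ‖F x‖ₑ ^ 2 ∂μ < ⊤) :
    MemLp F 2 μ := by
  refine ⟨hF, ?_⟩
  rw [← eLpNorm_two_sq] at h
  exact (ENNReal.pow_lt_top_iff.1 h).resolve_right two_ne_zero

theorem lintegral_lt_top_of_memLp_two {α E : Type*} [MeasurableSpace α] [NormedAddCommGroup E]
    {F : α → E} {μ : Measure α} (h : MemLp F 2 μ) : ∫⁻ x, ‖F x‖ₑ ^ 2 ∂μ < ⊤ := by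
  rw [← eLpNorm_two_sq]
  exact ENNReal.pow_lt_top h.2

theorem radialH1_memLp {v h : ℝ → ℂ} (H : RadialH1 d v h) :
    MemLp (fun p : Heis d => v (koranyi p)) 2 ∧ MemLp (radialGrad h : Heis d → _) 2 := by
  refine ⟨memLp_two_of_lintegral (aestronglyMeasurable_comp_koranyi H.mv) ?_,
    memLp_two_of_lintegral (aestronglyMeasurable_radialGrad H.mp) ?_⟩
  · rw [lintegral_sq_radial H.mv]
    exact ENNReal.mul_lt_top ENNReal.ofReal_lt_top H.iv.lintegral_lt_top
  · rw [lintegral_sq_radialGrad H.mp]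
    exact ENNReal.mul_lt_top ENNReal.ofReal_lt_top H.ip.lintegral_lt_top

theorem ae_zSq_pos (hd : 1 ≤ d) : ∀ᵐ p : Heis d, 0 < zSq p := by
  have : Nonempty (Fin d) := ⟨⟨0, hd⟩⟩
  have h : ∀ᵐ z : Fin d → ℂ, z ≠ 0 := by
    rw [ae_iff]; simp
  have h2 : ∀ᵐ p : Heis d, p.1 ≠ 0 := Measure.quasiMeasurePreserving_fst.ae h
  filter_upwards [h2] with p hp
  refine (zSq_nonneg p).lt_of_ne fun h0 => hp (funext fun j => ?_)
  have := (Finset.sum_eq_zero_iff_of_nonneg fun i _ => sq_nonneg ‖p.1 i‖).1 h0.symm j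
    (Finset.mem_univ j)
  simpa using this

/-- Cauchy–Schwarz pointwise against ∇ρ⁴ and then on spheres. It only serves to show that the radial
slope has finite weighted norm, so an inequality is enough. -/
theorem lintegral_radialSlope_le (hd : 1 ≤ d) {g : Heis d → EuclideanSpace ℂ (Fin d ⊕ Fin d)}
    (hg : AEStronglyMeasurable g) :
    ∫⁻ r in Ioi 0, ENNReal.ofReal (r ^ (2 * d + 1) * ‖radialSlope g r‖ ^ 2)
      ≤ ENNReal.ofReal (sphereMoment d)⁻¹ * ∫⁻ p, ‖g p‖ₑ ^ 2 := by
  have hκ := (sphere_constants hd).2.1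
  have hB : AEMeasurable fun p => ‖g p‖ₑ ^ 2 := hg.enorm.pow_const 2
  rw [lintegral_polar_ae hB, ← lintegral_const_mul' _ _ ENNReal.ofReal_ne_top]
  refine lintegral_mono_ae ((ae_restrict_iff' measurableSet_Ioi).2 ?_)
  have hA : AEMeasurable fun p : Heis d => ENNReal.ofReal (16 * koranyi p ^ 4)
      * ENNReal.ofReal (zSq p) :=
    ((continuous_koranyi.measurable.pow_const 4).const_mul 16).ennreal_ofReal.aemeasurable.mul
      contDiff_zSq.continuous.measurable.ennreal_ofReal.aemeasurable
  have hcs : ∀ p, ‖radialPart g p‖ₑ ^ 2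
      ≤ (ENNReal.ofReal (16 * koranyi p ^ 4) * ENNReal.ofReal (zSq p)) * ‖g p‖ₑ ^ 2 := by
    intro p
    rw [enorm_sq_eq_ofReal, enorm_sq_eq_ofReal, ← ENNReal.ofReal_mul (by positivity),
      ← ENNReal.ofReal_mul (mul_nonneg (by positivity) (zSq_nonneg p))]
    refine ENNReal.ofReal_le_ofReal ?_
    have h1 : ‖radialPart g p‖ ≤ ∑ k, |gaugeDeriv k p| * ‖g p k‖ := by
      refine (norm_sum_le _ _).trans (le_of_eq (Finset.sum_congr rfl fun k _ => ?_))
      rw [norm_smul, Real.norm_eq_abs]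
    calc _ ≤ (∑ k, |gaugeDeriv k p| * ‖g p k‖) ^ 2 :=
          pow_le_pow_left₀ (norm_nonneg _) h1 2
      _ ≤ (∑ k, |gaugeDeriv k p| ^ 2) * ∑ k, ‖g p k‖ ^ 2 :=
          Finset.sum_mul_sq_le_sq_mul_sq _ _ _
      _ = _ := by
          simp_rw [sq_abs]
          rw [sum_sq_gaugeDeriv, ← EuclideanSpace.norm_sq_eq, ← koranyi_pow_four_eq_gauge]
          ring
  filter_upwards [enorm_sphereInt_sq_le hA hB (Filter.Eventually.of_forall hcs)] with r hr h0
  have h0 : 0 < r := h0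
  have hr := hr h0
  have eA : ∫⁻ ξ, ENNReal.ofReal (16 * koranyi (dil r ξ) ^ 4) * ENNReal.ofReal (zSq (dil r ξ))
      ∂(sphereMeasure d) = ENNReal.ofReal (16 * r ^ 6 * sphereMoment d) := by
    trans ∫⁻ ξ, ENNReal.ofReal (16 * r ^ 4) * ENNReal.ofReal (zSq (dil r ξ)) ∂(sphereMeasure d)
    · refine lintegral_congr_ae ?_
      filter_upwards [ae_sphereMeasure] with ξ hξ
      rw [koranyi_dil, hξ, mul_one, abs_of_pos h0]
    · rw [lintegral_const_mul' _ _ ENNReal.ofReal_ne_top, lintegral_zSq_dil,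
        ← ENNReal.ofReal_mul (by positivity)]
      congr 1; ring
  rw [eA] at hr
  rw [ENNReal.ofReal_mul (by positivity), mul_left_comm]
  refine mul_le_mul_right (?_ : _ ≤ _) _
  rw [← enorm_sq_eq_ofReal, radialSlope, enorm_smul, mul_pow]
  refine (mul_le_mul_right hr _).trans (le_of_eq ?_)
  rw [← mul_assoc, enorm_sq_eq_ofReal, ← ENNReal.ofReal_mul (by positivity)]
  congr 2
  rw [Real.norm_of_nonneg (by positivity)]
  field_simp
  ring

/-- Cauchy–Schwarz on spheres for the splitting |f|² = (|z|²/ρ⁴)(ρ⁴|f|²/|z|²). The first factor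
integrates to κ/r² over the sphere of radius r, and the second is the integrand of the source norm;
the splitting needs z ≠ 0, which holds almost everywhere. -/
theorem lintegral_source_le (hd : 1 ≤ d) {f : Heis d → ℂ} (hf : AEStronglyMeasurable f) :
    ∫⁻ r in Ioi 0, ENNReal.ofReal (r ^ (2 * d + 1) * (r * ‖sphereInt f r‖) ^ 2)
      ≤ ENNReal.ofReal (sphereMoment d) * sourceNorm f ^ 2 := by
  have hm : AEStronglyMeasurable fun p : Heis d => (koranyi p ^ 2 / zNorm p) • f p :=
    ((continuous_koranyi.measurable.pow_const 2).div
      continuous_zNorm.measurable).aestronglyMeasurable.smul hf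
  have hB := hm.enorm.pow_const 2
  rw [sourceNorm, eLpNorm_two_sq, lintegral_polar_ae hB,
    ← lintegral_const_mul' _ _ ENNReal.ofReal_ne_top]
  refine lintegral_mono_ae ((ae_restrict_iff' measurableSet_Ioi).2 ?_)
  have hA : AEMeasurable fun p : Heis d => ENNReal.ofReal ((koranyi p ^ 4)⁻¹)
      * ENNReal.ofReal (zSq p) :=
    (continuous_koranyi.measurable.pow_const 4).inv.ennreal_ofReal.aemeasurable.mul
      contDiff_zSq.continuous.measurable.ennreal_ofReal.aemeasurable
  have hcs : ∀ᵐ p, ‖f p‖ₑ ^ 2 ≤ (ENNReal.ofReal ((koranyi p ^ 4)⁻¹) * ENNReal.ofReal (zSq p))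
      * ‖(koranyi p ^ 2 / zNorm p) • f p‖ₑ ^ 2 := by
    filter_upwards [ae_zSq_pos hd, ae_koranyi_pos] with p hz hk
    rw [enorm_sq_eq_ofReal, enorm_sq_eq_ofReal, ← ENNReal.ofReal_mul (by positivity),
      ← ENNReal.ofReal_mul (by positivity)]
    refine ENNReal.ofReal_le_ofReal (le_of_eq ?_)
    rw [← zNorm_sq_eq_zSq] at hz
    have hz' : 0 < zNorm p := (zNorm_nonneg p).lt_of_ne fun h => by simp [← h] at hz
    rw [norm_smul, ← zNorm_sq_eq_zSq, Real.norm_of_nonneg (by positivity)]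
    field_simp
  filter_upwards [enorm_sphereInt_sq_le hA hB hcs] with r hr h0
  have h0 : 0 < r := h0
  have hr := hr h0
  have eA : ∫⁻ ξ, ENNReal.ofReal ((koranyi (dil r ξ) ^ 4)⁻¹) * ENNReal.ofReal (zSq (dil r ξ))
      ∂(sphereMeasure d) = ENNReal.ofReal ((r ^ 2)⁻¹ * sphereMoment d) := by
    trans ∫⁻ ξ, ENNReal.ofReal ((r ^ 4)⁻¹) * ENNReal.ofReal (zSq (dil r ξ)) ∂(sphereMeasure d)
    · refine lintegral_congr_ae ?_
      filter_upwards [ae_sphereMeasure] with ξ hξ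
      rw [koranyi_dil, hξ, mul_one, abs_of_pos h0]
    · rw [lintegral_const_mul' _ _ ENNReal.ofReal_ne_top, lintegral_zSq_dil,
        ← ENNReal.ofReal_mul (by positivity)]
      congr 1; field_simp
  rw [eA] at hr
  rw [ENNReal.ofReal_mul (by positivity), mul_left_comm]
  refine mul_le_mul_right (?_ : _ ≤ _) _
  rw [mul_pow, ENNReal.ofReal_mul (by positivity), ← enorm_sq_eq_ofReal]
  refine (mul_le_mul_right hr _).trans (le_of_eq ?_)
  rw [← mul_assoc, ← ENNReal.ofReal_mul (by positivity), mul_inv_cancel_left₀ (by positivity)]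

end Heisenberg

/-! ### Radial functions as elements of H¹. -/

namespace Heisenberg

open HalfLine

variable {d : ℕ}

theorem abs_gaugeDeriv_le (k : Fin d ⊕ Fin d) (p : Heis d) :
    |gaugeDeriv k p| ≤ 4 * koranyi p ^ 3 := by
  refine abs_le_of_sq_le_sq ?_ (by have := koranyi_nonneg p; positivity)
  have h1 : gaugeDeriv k p ^ 2 ≤ ∑ k, gaugeDeriv k p ^ 2 :=
    Finset.single_le_sum (f := fun k => gaugeDeriv k p ^ 2) (fun _ _ => sq_nonneg _)
      (Finset.mem_univ k)
  rw [sum_sq_gaugeDeriv, ← koranyi_pow_four_eq_gauge, ← zNorm_sq_eq_zSq] at h1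
  have h2 : zNorm p ^ 2 ≤ koranyi p ^ 2 := pow_le_pow_left₀ (zNorm_nonneg p) (zNorm_le_koranyi p) 2
  have h3 : 0 ≤ koranyi p ^ 4 := by positivity
  nlinarith

/-- The flux of a test function through Koranyi spheres along a horizontal field. -/
noncomputable def flux (k : Fin d ⊕ Fin d) (φ : Heis d → ℝ) (r : ℝ) : ℝ :=
  r ^ (2 * d + 1) * ((4 * r ^ 3)⁻¹ * sphereInt (fun p => φ p * gaugeDeriv k p) r)

/-- The divergence theorem on Koranyi balls, in weak form: the horizontal derivative of φθ(ρ) has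
integral zero, and polar coordinates turn this into the statement. -/
theorem isWeakPrim_flux {φ : Heis d → ℝ} (h1 : ContDiff ℝ ∞ φ) (h2 : HasCompactSupport φ)
    (k : Fin d ⊕ Fin d) : IsWeakPrim (fun r => (flux k φ r : ℂ))
      (fun r => ((r ^ (2 * d + 1) * sphereInt (hDeriv k φ) r : ℝ) : ℂ)) := by
  have lA : LocallyIntegrable (hDeriv k φ) := (continuous_hDeriv h1 k).locallyIntegrable
  have lB : LocallyIntegrable fun p => φ p * gaugeDeriv k p :=
    (h1.continuous.mul (contDiff_gaugeDeriv k).continuous).locallyIntegrable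
  have la : LocallyIntegrableOn (fun r => r ^ (2 * d + 1) * sphereInt (hDeriv k φ) r) (Ioi 0) :=
    locallyIntegrableOn_smul (locallyIntegrable_polar lA) (continuousOn_pow _)
  have lb : LocallyIntegrableOn (flux k φ) (Ioi 0) := by
    refine locallyIntegrableOn_smul (locallyIntegrableOn_smul (locallyIntegrable_polar lB)
      (c := fun r => (4 * r ^ 3)⁻¹) ?_) (continuousOn_pow _)
    refine (by fun_prop : ContinuousOn (fun r : ℝ => 4 * r ^ 3) (Ioi 0)).inv₀ fun r hr => ?_
    have hr : 0 < r := hr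
    positivity
  have lc : ∀ {f : ℝ → ℝ}, LocallyIntegrableOn f (Ioi 0) →
      LocallyIntegrableOn (fun r => (f r : ℂ)) (Ioi 0) := fun hf => by
    refine locallyIntegrableOn_of_Icc fun a b ha hab => ?_
    exact (hf.integrableOn_compact_subset (fun x hx => ha.trans_le hx.1) isCompact_Icc).ofReal
  refine ⟨lc lb, lc la, fun θ t1 t2 t3 => ?_⟩
  have hθ : IsTest θ := ⟨t1, t2, t3⟩
  have hc := hθ.deriv.mul_inv_pow 3
  have key := integral_hDeriv_eq_zero (h1.mul hθ.contDiff_comp) h2.mul_right k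
  have e : ∀ p : Heis d, hDeriv k (fun p => φ p * θ (koranyi p)) p
      = θ (koranyi p) • hDeriv k φ p
        + (deriv θ (koranyi p) * (koranyi p ^ 3)⁻¹) • ((1 / 4 : ℝ) * (φ p * gaugeDeriv k p)) := by
    intro p
    rw [hDeriv_mul h1 hθ.contDiff_comp, hθ.hDeriv_comp, smul_eq_mul, smul_eq_mul, mul_inv]
    ring
  have lB' : LocallyIntegrable fun p => (1 / 4 : ℝ) * (φ p * gaugeDeriv k p) :=
    (continuous_const.mul (h1.continuous.mul
      (contDiff_gaugeDeriv k).continuous)).locallyIntegrable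
  simp_rw [e] at key
  rw [integral_add (integrable_koranyi_smul hθ.continuous hθ.compact lA)
    (integrable_koranyi_smul (θ := fun r => deriv θ r * (r ^ 3)⁻¹) hc.continuous hc.compact lB'),
    hθ.integral lA, hc.integral lB'] at key
  simp_rw [Complex.real_smul, ← Complex.ofReal_mul]
  rw [integral_complex_ofReal, integral_complex_ofReal, ← Complex.ofReal_neg]
  congr 1
  rw [eq_neg_iff_add_eq_zero, add_comm, ← key]
  congr 1
  refine integral_congr_ae (Filter.Eventually.of_forall fun r => ?_)
  simp only [smul_eq_mul]
  rcases le_or_gt r 0 with h0 | h0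
  · rw [hθ.deriv.zero h0]; simp
  · have : sphereInt (fun p => (1 / 4 : ℝ) * (φ p * gaugeDeriv k p)) r
        = 1 / 4 * sphereInt (fun p => φ p * gaugeDeriv k p) r := by
      unfold sphereInt; rw [integral_const_mul]
    rw [this, flux, mul_inv]; ring

/-- The bound is continuous in r so that it passes from the flux to its absolutely continuous
representative. The factor max 0 (R+1-r) is a continuous cutoff that is at least one where the flux
may be nonzero. -/
theorem abs_flux_le {φ : Heis d → ℝ} (h1 : Continuous φ) (h2 : HasCompactSupport φ)
    (k : Fin d ⊕ Fin d) : ∃ C R : ℝ, 0 ≤ C ∧ 0 < R ∧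
      (∀ p, R ≤ koranyi p → φ p = 0) ∧
      ∀ r, 0 < r → |flux k φ r| ≤ C * r ^ (2 * d + 1) * max 0 (R + 1 - r) := by
  obtain ⟨R₀, hR₀⟩ := (h2.isCompact.image continuous_koranyi).bddAbove
  obtain ⟨M, hM⟩ := h1.bounded_above_of_compact_support h2
  have hM0 : 0 ≤ M := (norm_nonneg _).trans (hM 0)
  set R := max R₀ 0 + 1 with hR
  have hz : ∀ p, R ≤ koranyi p → φ p = 0 := fun p hp => by
    by_contra hne
    have := hR₀ (mem_image_of_mem _ (subset_tsupport _ hne))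
    have := le_max_left R₀ 0
    linarith
  refine ⟨M * sphereMass d, R, mul_nonneg hM0 measureReal_nonneg, by positivity, hz,
    fun r hr => ?_⟩
  rcases le_or_gt R r with hle | hlt
  · have : flux k φ r = 0 := by
      rw [flux, sphereInt, integral_eq_zero_of_ae, mul_zero, mul_zero]
      filter_upwards [ae_sphereMeasure] with ξ hξ
      rw [hz _ (by rwa [koranyi_dil, hξ, mul_one, abs_of_pos hr]), zero_mul]; rfl
    rw [this, abs_zero]
    have : 0 ≤ sphereMass d := measureReal_nonneg
    positivity
  · have hs : |sphereInt (fun p => φ p * gaugeDeriv k p) r| ≤ M * (4 * r ^ 3) * sphereMass d := by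
      rw [← Real.norm_eq_abs]
      refine norm_integral_le_of_norm_le_const ?_
      filter_upwards [ae_sphereMeasure] with ξ hξ
      rw [norm_mul]
      refine mul_le_mul (hM _) ?_ (norm_nonneg _) hM0
      have := abs_gaugeDeriv_le k (dil r ξ)
      rwa [koranyi_dil, hξ, mul_one, abs_of_pos hr] at this
    have h1 : 1 ≤ max 0 (R + 1 - r) := le_max_of_le_right (by linarith)
    rw [flux, abs_mul, abs_mul, abs_of_pos (by positivity : 0 < r ^ (2 * d + 1)),
      abs_of_pos (by positivity : 0 < (4 * r ^ 3)⁻¹)]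
    have hS : 0 ≤ sphereMass d := measureReal_nonneg
    calc _ ≤ r ^ (2 * d + 1) * ((4 * r ^ 3)⁻¹ * (M * (4 * r ^ 3) * sphereMass d)) := by gcongr
      _ = M * sphereMass d * r ^ (2 * d + 1) * 1 := by field_simp
      _ ≤ _ := by gcongr

theorem sphereInt_ofReal (F : Heis d → ℝ) (r : ℝ) :
    sphereInt (fun p => (F p : ℂ)) r = ((sphereInt F r : ℝ) : ℂ) := integral_complex_ofReal

theorem sphereInt_mul_koranyi (F : Heis d → ℝ) (v : ℝ → ℂ) {r : ℝ} (hr : 0 < r) :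
    sphereInt (fun p => F p • v (koranyi p)) r = (sphereInt F r : ℝ) * v r := by
  simp_rw [Complex.real_smul, mul_comm _ (v _)]
  rw [sphereInt_koranyi_mul _ _ hr, sphereInt_ofReal, mul_comm]

/-- In polar coordinates the claim is that the derivative of flux times v integrates to zero over
(0,∞). The flux vanishes for large r. Near zero it is O(r^(2d+1)), and the finite norm of v makes
r^(2d+1)|v| small along a sequence, so the origin contributes nothing. -/
theorem hasWeakHGrad_radial (hd : 1 ≤ d) {v h : ℝ → ℂ} (H : RadialH1 d v h) :
    HasWeakHGrad (fun p : Heis d => v (koranyi p)) (radialGrad h) := by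
  obtain ⟨m1, m2⟩ := radialH1_memLp H
  have l1 := m1.locallyIntegrable (by norm_num)
  have l2 := m2.locallyIntegrable (by norm_num)
  refine ⟨l1, l2, fun φ h1 h2 k => ?_⟩
  have i1 : Integrable fun p => hDeriv k φ p • v (koranyi p) :=
    l1.integrable_smul_left_of_hasCompactSupport (continuous_hDeriv h1 k)
      (hasCompactSupport_hDeriv h2 k)
  have i2 : Integrable fun p => φ p • radialGrad h p k :=
    (locallyIntegrable_component l2 k).integrable_smul_left_of_hasCompactSupport h1.continuous h2
  rw [eq_neg_iff_add_eq_zero, integral_polar i1, integral_polar i2]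
  have j1 := (integrable_polar i1).2
  have j2 := (integrable_polar i2).2
  rw [← integral_add j1 j2]
  have jE := j1.add j2
  set A : ℝ → ℂ := fun r => ((r ^ (2 * d + 1) * sphereInt (hDeriv k φ) r : ℝ) : ℂ) with hA
  set E : ℝ → ℂ := fun r => A r * v r + flux k φ r * h r with hE
  have eE : ∀ r, 0 < r → r ^ (2 * d + 1) • sphereInt (fun p => hDeriv k φ p • v (koranyi p)) r
      + r ^ (2 * d + 1) • sphereInt (fun p => φ p • radialGrad h p k) r = E r := by
    intro r hr
    have e : (fun p => φ p • radialGrad h p k)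
        = fun p => (φ p * gaugeDeriv k p) • ((4 * koranyi p ^ 3)⁻¹ • h (koranyi p)) := by
      funext p; simp only [radialGrad, smul_smul, mul_assoc]
    rw [sphereInt_mul_koranyi _ _ hr, e,
      sphereInt_mul_koranyi _ (fun r => (4 * r ^ 3)⁻¹ • h r) hr]
    simp only [hE, hA, flux, Complex.real_smul]
    push_cast
    ring
  rw [setIntegral_congr_fun measurableSet_Ioi fun r hr => eE r hr]
  have jE : IntegrableOn E (Ioi 0) := jE.congr_fun (fun r hr => eE r hr) measurableSet_Ioi
  obtain ⟨B, hB, hBe⟩ := (isWeakPrim_flux h1 h2 k).exists_isPrim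
  obtain ⟨C, R, hC, hR, hφ, hflux⟩ := abs_flux_le h1.continuous h2 k
  have hBb : ∀ r, 0 < r → ‖B r‖ ≤ C * r ^ (2 * d + 1) * max 0 (R + 1 - r) := by
    refine le_of_ae_le_of_continuousOn hB.continuousOn.norm (by fun_prop) ?_
    filter_upwards [hBe] with r hr h0
    rw [← hr h0, Complex.norm_real]
    exact hflux r h0
  have hP : IsPrim (fun r => B r * v r) E := (hB.mul H.hv).congr_deriv (by
    filter_upwards [hBe] with r hr h0
    rw [← hr h0])
  have hzero : ∀ r, R + 1 < r → E r = 0 := by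
    intro r hr
    have h0 : 0 < r := by linarith
    have hf : flux k φ r = 0 := by
      have := hflux r h0
      rw [max_eq_left (by linarith), mul_zero] at this
      exact abs_nonpos_iff.1 this
    have hs : sphereInt (hDeriv k φ) r = 0 := by
      refine integral_eq_zero_of_ae ?_
      filter_upwards [ae_sphereMeasure] with ξ hξ
      have ho : IsOpen {p : Heis d | R < koranyi p} := isOpen_lt continuous_const continuous_koranyi
      have hm : dil r ξ ∈ {p : Heis d | R < koranyi p} := by
        simp only [Set.mem_ofPred_eq, koranyi_dil, hξ, mul_one, abs_of_pos h0]; linarith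
      have : φ =ᶠ[nhds (dil r ξ)] fun _ => 0 := by
        filter_upwards [ho.mem_nhds hm] with p hp using hφ p (le_of_lt hp)
      rw [hDeriv, this.fderiv_eq]
      simp
    simp only [hE, hA, hf, hs]
    simp
  have hint : ∀ s, 0 < s → s < 1 → ∫ r in Ioi s, E r = - (B s * v s) := by
    intro s hs hs1
    have hlt : s ≤ R + 2 := by linarith
    have jt : IntegrableOn E (Ioi (R + 2)) := jE.mono_set (Ioi_subset_Ioi (by linarith))
    rw [← Ioc_union_Ioi_eq_Ioi hlt, setIntegral_union Ioc_disjoint_Ioi_same measurableSet_Ioi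
      (jE.mono_set fun x hx => hs.trans hx.1) jt,
      setIntegral_eq_zero_of_forall_eq_zero (t := Ioi (R + 2))
        fun x hx => hzero x (by have : R + 2 < x := hx; linarith),
      ← intervalIntegral.integral_of_le hlt, hP.eq hs (by linarith), add_zero]
    have : B (R + 2) = 0 := by
      have := hBb (R + 2) (by linarith)
      rw [max_eq_left (by linarith), mul_zero] at this
      exact norm_le_zero_iff.1 this
    rw [this]; ring
  have hlim : Filter.Tendsto (fun s => ∫ r in Ioi s, E r) (nhdsWithin 0 (Ioi 0))
      (nhds (∫ r in Ioi 0, E r)) := by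
    have := (aecover_Ioi_of_Ioi (μ := volume) (A := (0 : ℝ))
      (l := nhdsWithin 0 (Ioi 0)) (a := id) (Filter.tendsto_id.mono_right nhdsWithin_le_nhds)
      ).integral_tendsto_of_countably_generated jE
    refine this.congr' ?_
    filter_upwards [self_mem_nhdsWithin] with s hs
    rw [Measure.restrict_restrict measurableSet_Ioi, id, Ioi_inter_Ioi, max_eq_left (le_of_lt hs)]
  rw [← norm_le_zero_iff]
  refine le_of_forall_pos_le_add fun ε hε => ?_
  have hev : ∀ᶠ s in nhdsWithin 0 (Ioi (0 : ℝ)), ‖∫ r in Ioi 0, E r‖ < ‖∫ r in Ioi s, E r‖ + ε / 2 := by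
    have h1 := hlim.norm.add_const (ε / 2)
    exact h1.eventually_const_lt (by linarith)
  obtain ⟨c, hc, hc'⟩ := (nhdsGT_basis (0 : ℝ)).eventually_iff.1 hev
  set η : ℝ := ε / (2 * (C * (R + 1) + 1)) with hη
  have hη0 : 0 < η := by positivity
  -- The square of s^(2d+1)|v(s)| is s^(2d) times the quantity made small here, and s < 1.
  obtain ⟨s, hs0, hs1, hs2⟩ := exists_small_near_zero H.iv (pow_pos hη0 2)
    (lt_min hc one_pos)
  have hsc := hc' ⟨hs0, hs1.trans_le (min_le_left _ _)⟩
  have hs1 := hs1.trans_le (min_le_right _ _)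
  rw [hint s hs0 hs1, norm_neg, norm_mul] at hsc
  have hv : s ^ (2 * d + 1) * ‖v s‖ ≤ η := by
    refine abs_le_of_sq_le_sq' ?_ hη0.le |>.2
    refine le_trans ?_ hs2
    have : s ^ (2 * d) ≤ s := by
      calc s ^ (2 * d) ≤ s ^ 1 := pow_le_pow_of_le_one hs0.le hs1.le (by omega)
        _ = s := pow_one s
    calc _ = s ^ (2 * d) * (s * (s ^ (2 * d + 1) * ‖v s‖ ^ 2)) := by ring
      _ ≤ 1 * (s * (s ^ (2 * d + 1) * ‖v s‖ ^ 2)) := by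
          gcongr; exact pow_le_one₀ hs0.le hs1.le
      _ = _ := one_mul _
  have hb : ‖B s‖ * ‖v s‖ ≤ C * (R + 1) * η := by
    calc _ ≤ C * s ^ (2 * d + 1) * max 0 (R + 1 - s) * ‖v s‖ := by
          gcongr; exact hBb s hs0
      _ ≤ C * s ^ (2 * d + 1) * (R + 1) * ‖v s‖ := by
          gcongr; exact max_le (by linarith) (by linarith)
      _ = C * (R + 1) * (s ^ (2 * d + 1) * ‖v s‖) := by ring
      _ ≤ _ := by gcongr
  have : C * (R + 1) * η ≤ ε / 2 := by
    rw [hη, mul_div_assoc', div_le_div_iff₀ (by positivity) two_pos]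
    nlinarith
  linarith

theorem memH1_radial (hd : 1 ≤ d) {v h : ℝ → ℂ} (H : RadialH1 d v h) :
    MemH1 (fun p : Heis d => v (koranyi p)) :=
  ⟨(radialH1_memLp H).1, _, hasWeakHGrad_radial hd H, (radialH1_memLp H).2⟩

/-- The gradient norm is an infimum over weak gradients, so exhibiting one suffices for every use
made of it. -/
theorem hGradNorm_sq_radial_le (hd : 1 ≤ d) {v h : ℝ → ℂ} (H : RadialH1 d v h) :
    hGradNorm (fun p : Heis d => v (koranyi p)) ^ 2
      ≤ ENNReal.ofReal (sphereMoment d * ∫ r in Ioi 0, r ^ (2 * d + 1) * ‖h r‖ ^ 2) := by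
  have h1 : hGradNorm (fun p : Heis d => v (koranyi p)) ≤ eLpNorm (radialGrad h : Heis d → _) 2 :=
    iInf₂_le _ (hasWeakHGrad_radial hd H)
  refine (pow_le_pow_left' h1 2).trans (le_of_eq ?_)
  rw [eLpNorm_two_sq, lintegral_sq_radialGrad H.mp, ENNReal.ofReal_mul (sphereMoment_nonneg d),
    ofReal_integral_eq_lintegral_ofReal H.ip]
  refine (ae_restrict_iff' measurableSet_Ioi).2 (Filter.Eventually.of_forall fun r hr => ?_)
  have hr : 0 < r := hr
  simp only [Pi.zero_apply]
  positivity

end Heisenberg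

/-! ### The constants: attainment of the minima and the quadratic inequality. -/

namespace Heisenberg

variable {d : ℕ}

theorem isLeast_sInf_image_Ioi {f : ℝ → ℝ} (hf : ContinuousOn f (Ioi 0))
    (h0 : Filter.Tendsto f (nhdsWithin 0 (Ioi 0)) Filter.atTop)
    (h1 : Filter.Tendsto f Filter.atTop Filter.atTop) :
    IsLeast (f '' Ioi 0) (sInf (f '' Ioi 0)) := by
  obtain ⟨a, ha, ha'⟩ := (nhdsGT_basis (0 : ℝ)).eventually_iff.1 (h0.eventually_ge_atTop (f 1))
  obtain ⟨b, hb⟩ := Filter.eventually_atTop.1 (h1.eventually_ge_atTop (f 1))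
  obtain ⟨x, hx, hmin⟩ := (isCompact_Icc (a := min a 1) (b := max b 1)).exists_isMinOn
    ⟨1, min_le_right _ _, le_max_right _ _⟩
    (hf.mono fun x hx => lt_of_lt_of_le (lt_min ha one_pos) hx.1)
  have hx1 : f x ≤ f 1 := hmin ⟨min_le_right _ _, le_max_right _ _⟩
  have hx0 : 0 < x := lt_of_lt_of_le (lt_min ha one_pos) hx.1
  have h : IsLeast (f '' Ioi 0) (f x) := by
    refine ⟨mem_image_of_mem _ hx0, ?_⟩
    rintro _ ⟨y, hy, rfl⟩
    rcases lt_or_ge y a with hya | hya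
    · exact hx1.trans (ha' ⟨hy, hya⟩)
    rcases le_or_gt b y with hyb | hyb
    · exact hx1.trans (hb y hyb)
    · exact hmin ⟨(min_le_left _ _).trans hya, hyb.le.trans (le_max_left _ _)⟩
  rwa [h.csInf_eq]

theorem one_sub_sq_pos {b : ℝ} (hb0 : 0 ≤ b) (hb1 : b < 1) : 0 < 1 - b ^ 2 := by nlinarith

variable {b : ℝ}

theorem div_le_kFun (hd : 1 ≤ d) (hb0 : 0 ≤ b) (hb1 : b < 1) {δ γ : ℝ} :
    γ * (√δ / (4 * d * (1 - b ^ 2))) ≤ kFun d b δ γ := by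
  have hc := one_sub_sq_pos hb0 hb1
  have hd' : (0 : ℝ) < d := by exact_mod_cast hd
  have h1 : γ * (√δ / (4 * d * (1 - b ^ 2)))
      ≤ (8 * d + 2 + γ * √δ) / (4 * d * (1 - b ^ 2)) := by
    rw [← mul_div_assoc]
    gcongr
    linarith
  exact h1.trans (le_add_of_nonneg_right (Real.sqrt_nonneg _))

theorem sqrt_le_kFun (hd : 1 ≤ d) (hb0 : 0 ≤ b) (hb1 : b < 1) {δ γ : ℝ} (hγ : 0 < γ) :
    √(√δ / (2 * γ * (1 - b ^ 2))) ≤ kFun d b δ γ := by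
  have hc := one_sub_sq_pos hb0 hb1
  have hd' : (0 : ℝ) < d := by exact_mod_cast hd
  refine le_trans (Real.sqrt_le_sqrt ?_) (le_add_of_nonneg_left (by positivity))
  exact le_add_of_nonneg_left (sq_nonneg _)

theorem continuousOn_kFun (hb0 : 0 ≤ b) (hb1 : b < 1) (δ : ℝ) :
    ContinuousOn (kFun d b δ) (Ioi 0) := by
  have hc := one_sub_sq_pos hb0 hb1
  unfold kFun
  refine ContinuousOn.add (by fun_prop) (Real.continuous_sqrt.comp_continuousOn ?_)
  refine ContinuousOn.add (by fun_prop) (continuousOn_const.div (by fun_prop) fun γ hγ => ?_)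
  have hγ : 0 < γ := hγ
  positivity

theorem isLeast_K (hd : 1 ≤ d) (hb0 : 0 ≤ b) (hb1 : b < 1) {δ : ℝ} (hδ : 0 < δ) :
    IsLeast (kFun d b δ '' Ioi 0) (K d b δ) := by
  have hc := one_sub_sq_pos hb0 hb1
  have hd' : (0 : ℝ) < d := by exact_mod_cast hd
  refine isLeast_sInf_image_Ioi (continuousOn_kFun hb0 hb1 δ) ?_ ?_
  · have h : Filter.Tendsto (fun γ : ℝ => √(γ⁻¹ * (√δ / (2 * (1 - b ^ 2)))))
        (nhdsWithin 0 (Ioi 0)) Filter.atTop :=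
      Real.tendsto_sqrt_atTop.comp
        (tendsto_inv_nhdsGT_zero.atTop_mul_const (by positivity))
    refine Filter.tendsto_atTop_mono' _ ?_ h
    filter_upwards [self_mem_nhdsWithin] with γ hγ
    have hγ : 0 < γ := hγ
    refine le_trans (le_of_eq ?_) (sqrt_le_kFun hd hb0 hb1 hγ)
    congr 1
    field_simp
  · have h : Filter.Tendsto (fun γ : ℝ => γ * (√δ / (4 * d * (1 - b ^ 2))))
        Filter.atTop Filter.atTop := Filter.tendsto_id.atTop_mul_const (by positivity)
    refine Filter.tendsto_atTop_mono' _ ?_ h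
    filter_upwards [Filter.eventually_gt_atTop 0] with γ hγ using div_le_kFun hd hb0 hb1

theorem kFun_pos (hd : 1 ≤ d) (hb0 : 0 ≤ b) (hb1 : b < 1) {δ γ : ℝ} (hδ : 0 < δ) (hγ : 0 < γ) :
    0 < kFun d b δ γ := by
  have hc := one_sub_sq_pos hb0 hb1
  have hd' : (0 : ℝ) < d := by exact_mod_cast hd
  exact lt_of_lt_of_le (by positivity) (div_le_kFun hd hb0 hb1)

theorem K_pos (hd : 1 ≤ d) (hb0 : 0 ≤ b) (hb1 : b < 1) {δ : ℝ} (hδ : 0 < δ) : 0 < K d b δ := by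
  obtain ⟨γ, hγ, h⟩ := (isLeast_K hd hb0 hb1 hδ).1
  rw [← h]
  exact kFun_pos hd hb0 hb1 hδ hγ

/-- The quantity minimised by `K`, parametrised by `τ = γ √δ`. -/
noncomputable def kAux (d : ℕ) (b τ δ : ℝ) : ℝ :=
  (8 * d + 2 + τ) / (4 * d * (1 - b ^ 2))
    + √(((8 * d + 2 + τ) / (4 * d * (1 - b ^ 2))) ^ 2 + δ * (2 * τ * (1 - b ^ 2))⁻¹)

theorem kFun_eq_kAux (δ γ : ℝ) (hδ : 0 < δ) : kFun d b δ γ = kAux d b (γ * √δ) δ := by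
  have h := Real.mul_self_sqrt hδ.le
  have hs := Real.sqrt_pos.2 hδ
  rw [kFun, kAux]
  congr 3
  rw [← div_eq_mul_inv, show 2 * (γ * √δ) * (1 - b ^ 2) = (2 * γ * (1 - b ^ 2)) * √δ by ring,
    ← mul_div_mul_right _ _ hs.ne', h]

/-- After the substitution τ = γ√δ, the function minimised is, for fixed τ, concave in δ (a constant
plus the root of an affine function), and an infimum of concave functions is concave. Concavity on
the open half-line gives the continuity of K needed for the minimum over δ. -/
theorem concaveOn_K (hd : 1 ≤ d) (hb0 : 0 ≤ b) (hb1 : b < 1) :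
    ConcaveOn ℝ (Ioi 0) (K d b) := by
  have hc := one_sub_sq_pos hb0 hb1
  refine ⟨convex_Ioi 0, fun x hx y hy s t hs ht hst => ?_⟩
  have hz : 0 < s • x + t • y := convex_Ioi (0 : ℝ) hx hy hs ht hst
  obtain ⟨γ, hγ, h⟩ := (isLeast_K hd hb0 hb1 hz).1
  have hγ : 0 < γ := hγ
  have hx : 0 < x := hx
  have hy : 0 < y := hy
  rw [← h, kFun_eq_kAux _ _ hz]
  set τ := γ * √(s • x + t • y) with hτ
  have hτ0 : 0 < τ := mul_pos hγ (Real.sqrt_pos.2 hz)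
  have le : ∀ w, 0 < w → K d b w ≤ kAux d b τ w := fun w hw => by
    have := (isLeast_K hd hb0 hb1 hw).2 (mem_image_of_mem _ (div_pos hτ0 (Real.sqrt_pos.2 hw)))
    rwa [kFun_eq_kAux _ _ hw, div_mul_cancel₀ _ (Real.sqrt_pos.2 hw).ne'] at this
  refine (add_le_add (smul_le_smul_of_nonneg_left (le x hx) hs)
    (smul_le_smul_of_nonneg_left (le y hy) ht)).trans ?_
  simp only [kAux, smul_eq_mul]
  set A := (8 * d + 2 + τ) / (4 * d * (1 - b ^ 2)) with hA
  set B := (2 * τ * (1 - b ^ 2))⁻¹ with hB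
  have hB0 : 0 < B := by positivity
  have := Real.strictConcaveOn_sqrt.concaveOn.2 (x := A ^ 2 + x * B) (y := A ^ 2 + y * B)
    (by simp only [mem_Ici]; positivity) (by simp only [mem_Ici]; positivity) hs ht hst
  simp only [smul_eq_mul] at this
  have e : s * (A ^ 2 + x * B) + t * (A ^ 2 + y * B) = A ^ 2 + (s * x + t * y) * B := by
    linear_combination A ^ 2 * hst
  rw [e] at this
  have e2 : s * A + t * A = A := by rw [← add_mul, hst, one_mul]
  linarith

/-- At the minimiser, the linear term bounds from below if γ ≥ 1 and the root term if γ ≤ 1. Both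
lower bounds tend to infinity with δ. -/
theorem min_le_K (hd : 1 ≤ d) (hb0 : 0 ≤ b) (hb1 : b < 1) {δ : ℝ} (hδ : 0 < δ) :
    min (√δ / (4 * d * (1 - b ^ 2))) (√(√δ / (2 * (1 - b ^ 2)))) ≤ K d b δ := by
  have hc := one_sub_sq_pos hb0 hb1
  have hd' : (0 : ℝ) < d := by exact_mod_cast hd
  obtain ⟨γ, hγ, h⟩ := (isLeast_K hd hb0 hb1 hδ).1
  have hγ : 0 < γ := hγ
  rw [← h]
  rcases le_total 1 γ with h1 | h1
  · refine (min_le_left _ _).trans (le_trans ?_ (div_le_kFun hd hb0 hb1))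
    exact le_mul_of_one_le_left (by positivity) h1
  · refine (min_le_right _ _).trans (le_trans (Real.sqrt_le_sqrt ?_) (sqrt_le_kFun hd hb0 hb1 hγ))
    gcongr
    linarith

theorem isLeast_kappa (hd : 1 ≤ d) (hb0 : 0 ≤ b) (hb1 : b < 1) :
    IsLeast (kappaFun d b '' Ioi 0) (kappa d b) := by
  have hc := one_sub_sq_pos hb0 hb1
  have hd' : (0 : ℝ) < d := by exact_mod_cast hd
  refine isLeast_sInf_image_Ioi ?_ ?_ ?_
  · unfold kappaFun
    refine continuous_max.comp_continuousOn (ContinuousOn.prodMk ?_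
      (((concaveOn_K hd hb0 hb1).continuousOn isOpen_Ioi).div_const _))
    refine (continuousOn_const.add (continuousOn_const.div continuousOn_id fun x hx => ?_)).div_const _
    exact ne_of_gt hx
  · have h : Filter.Tendsto (fun δ : ℝ => (1 + δ⁻¹) / (d : ℝ) ^ 2) (nhdsWithin 0 (Ioi 0))
        Filter.atTop :=
      (Filter.tendsto_atTop_add_const_left _ 1 tendsto_inv_nhdsGT_zero).atTop_div_const
        (by positivity)
    refine Filter.tendsto_atTop_mono (fun δ => ?_) h
    rw [kappaFun, one_div]
    exact le_max_left _ _
  · have h : Filter.Tendsto (fun δ : ℝ => min (√δ / (4 * d * (1 - b ^ 2)))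
        (√(√δ / (2 * (1 - b ^ 2)))) / d) Filter.atTop Filter.atTop :=
      Filter.Tendsto.atTop_div_const hd' <| Filter.tendsto_atTop.2 fun C =>
        ((Real.tendsto_sqrt_atTop.atTop_div_const
          (by positivity : 0 < 4 * d * (1 - b ^ 2))).eventually_ge_atTop C).and
        ((Real.tendsto_sqrt_atTop.comp (Real.tendsto_sqrt_atTop.atTop_div_const
          (by positivity : 0 < 2 * (1 - b ^ 2)))).eventually_ge_atTop C) |>.mono
        fun _ h => le_min h.1 h.2
    refine Filter.tendsto_atTop_mono' _ ?_ h
    filter_upwards [Filter.eventually_gt_atTop 0] with δ hδ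
    refine le_trans ?_ (le_max_right _ _)
    gcongr
    exact min_le_K hd hb0 hb1 hδ

/-- Young's inequality with weight γ splits T into multiples of X and M, which leaves X² ≤ 2AXM +
qM². The larger root of this quadratic is the function of γ defining K, and γ is taken to be its
minimiser. -/
theorem le_K_mul (hd : 1 ≤ d) (hb0 : 0 ≤ b) (hb1 : b < 1) {δ X M T : ℝ} (hδ : 0 < δ)
    (hX : 0 ≤ X) (hM : 0 ≤ M) (hT2 : T ^ 2 ≤ δ * (X / d * M))
    (h : (1 - b ^ 2) * X ^ 2 ≤ M * ((4 * d + 1) / d * X + T)) : X ≤ K d b δ * M := by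
  have hc := one_sub_sq_pos hb0 hb1
  have hd' : (0 : ℝ) < d := by exact_mod_cast hd
  obtain ⟨γ, hγ, hK⟩ := (isLeast_K hd hb0 hb1 hδ).1
  have hγ : 0 < γ := hγ
  rw [← hK, kFun]
  set A := (8 * d + 2 + γ * √δ) / (4 * d * (1 - b ^ 2)) with hA
  set q := √δ / (2 * γ * (1 - b ^ 2)) with hq
  have hs := Real.sqrt_pos.2 hδ
  have hss := Real.sq_sqrt hδ.le
  have hT : T ≤ √δ * (γ * X / (2 * d) + M / (2 * γ)) := by
    refine abs_le_of_sq_le_sq' (hT2.trans ?_) (by positivity) |>.2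
    rw [mul_pow, hss]
    gcongr
    have := sq_nonneg (γ * X / (2 * d) - M / (2 * γ))
    have e : 4 * (γ * X / (2 * d)) * (M / (2 * γ)) = X / d * M := by field_simp; ring
    nlinarith
  have hquad : X ^ 2 ≤ 2 * A * X * M + q * M ^ 2 := by
    have h2 : (1 - b ^ 2) * X ^ 2 ≤ (1 - b ^ 2) * (2 * A * X * M + q * M ^ 2) := by
      refine h.trans ((mul_le_mul_of_nonneg_left (add_le_add_right hT _) hM).trans (le_of_eq ?_))
      rw [hA, hq]
      field_simp
      ring
    exact le_of_mul_le_mul_left h2 hc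
  have hA0 : 0 ≤ A := by positivity
  have hq0 : 0 ≤ q := by positivity
  have hr : (X - A * M) ^ 2 ≤ (√(A ^ 2 + q) * M) ^ 2 := by
    rw [mul_pow, Real.sq_sqrt (by positivity)]
    nlinarith
  have := (abs_le_of_sq_le_sq' hr (by positivity)).2
  linarith

end Heisenberg

/-! ### Modulation by the phase. -/

namespace HalfLine

open Complex

/-- Multiplication by the phase `e^{-ikr}` removes the real spectral parameter `α = k²`. -/
theorem RadialEq.modulate {d : ℕ} {v p G : ℝ → ℂ} {W W' : ℝ → ℝ} {k α ε : ℝ}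
    (h : RadialEq d v p G W W' 0 α ε) (hk : α = k ^ 2) :
    RadialEq d (fun r => cexp (-(I * (k * r : ℝ))) * v r)
      (fun r => cexp (-(I * (k * r : ℝ))) * (p r - I * k * v r))
      (fun r => cexp (-(I * (k * r : ℝ))) * G r) W W' k 0 ε := by
  have hn : ∀ r : ℝ, ‖cexp (-(I * (k * r : ℝ)))‖ = 1 := fun r => by
    rw [Complex.norm_exp]; simp
  have hcont : Continuous fun r : ℝ => cexp (-(I * (k * r : ℝ))) := by fun_prop
  have he : IsPrim (fun r : ℝ => cexp (-(I * (k * r : ℝ))))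
      (fun r => -(I * k) * cexp (-(I * (k * r : ℝ)))) := by
    refine IsPrim.of_hasDerivAt (fun r _ => ?_) (by fun_prop)
    have h1 : HasDerivAt (fun r : ℝ => -(I * ((k * r : ℝ) : ℂ))) (-(I * k)) r := by
      exact (((hasDerivAt_id r).const_mul k).ofReal_comp.const_mul I).neg.congr_deriv
        (by simp)
    exact h1.cexp.congr_deriv (mul_comm _ _)
  have hIk : IsPrim (fun r => I * k * v r) (fun r => I * k * p r) :=
    h.hv.comp_clm ((ContinuousLinearMap.mul ℝ ℂ) (I * k))
  have hm : AEStronglyMeasurable (fun r => p r - I * k * v r) (volume.restrict (Ioi 0)) :=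
    h.mp.sub (h.mv.const_mul _)
  refine ⟨⟨?_, hcont.aestronglyMeasurable.mul hm, ?_, ?_⟩, ?_, h.hW, h.W0,
    hcont.aestronglyMeasurable.mul h.mG, ?_⟩
  · exact (he.mul h.hv).congr_deriv' fun r _ => by ring
  · simpa only [norm_mul, hn, one_mul] using h.iv
  · simp only [norm_mul, hn, one_mul]
    refine Integrable.mono' ((h.ip.const_mul 2).add (h.iv.const_mul (2 * k ^ 2)))
      ((continuous_pow _).aestronglyMeasurable.mul (hm.norm.pow 2))
      ((ae_restrict_iff' measurableSet_Ioi).2 (Filter.Eventually.of_forall fun r hr => ?_))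
    have hr : 0 < r := hr
    have h1 : ‖p r - I * k * v r‖ ≤ ‖p r‖ + |k| * ‖v r‖ := by
      refine (norm_sub_le _ _).trans (le_of_eq ?_)
      simp
    have h2 : ‖p r - I * k * v r‖ ^ 2 ≤ 2 * ‖p r‖ ^ 2 + 2 * k ^ 2 * ‖v r‖ ^ 2 := by
      refine (pow_le_pow_left₀ (norm_nonneg _) h1 2).trans ?_
      rw [← sq_abs k]
      nlinarith [sq_nonneg (‖p r‖ - |k| * ‖v r‖)]
    rw [Real.norm_of_nonneg (by positivity)]
    calc _ ≤ r ^ (2 * d + 1) * (2 * ‖p r‖ ^ 2 + 2 * k ^ 2 * ‖v r‖ ^ 2) := by gcongr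
      _ = _ := by simp only [Pi.add_apply]; ring
  · refine (he.mul (h.hp.sub hIk)).congr_deriv' fun r _ => ?_
    rw [hk]
    push_cast
    linear_combination (-(cexp (-(I * (k * r))) * k ^ 2 * v r)) * I_sq
  · simpa only [norm_mul, hn, one_mul] using h.iG

end HalfLine

/-! ### Transfer between the group and the half-line. -/

namespace Heisenberg

open HalfLine

variable {d : ℕ}

theorem hGradNorm_congr_le {u w : Heis d → ℂ} (h : ∀ᵐ p, u p = w p) :
    hGradNorm u ≤ hGradNorm w := by
  refine le_iInf₂ fun g hg => iInf₂_le g ⟨hg.1.congr ?_, hg.2.1, fun φ h1 h2 k => ?_⟩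
  · filter_upwards [h] with p hp using hp.symm
  · rw [← hg.2.2 φ h1 h2 k]
    refine integral_congr_ae ?_
    filter_upwards [h] with p hp
    rw [hp]

theorem hardyNorm_sq_radial (hd : 1 ≤ d) {v h : ℝ → ℂ} (H : RadialH1 d v h) {w : Heis d → ℂ}
    (hw : ∀ᵐ p, w p = v (koranyi p)) :
    hardyNorm w ^ 2 = ENNReal.ofReal
      (sphereMoment d * ∫ r in Ioi 0, r ^ (2 * d + 1) * (‖v r‖ / r) ^ 2) := by
  have hm : AEStronglyMeasurable (fun r : ℝ => ((r ^ 2)⁻¹ : ℝ) • v r) (volume.restrict (Ioi 0)) :=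
    (measurable_id.pow_const 2).inv.aestronglyMeasurable.smul H.mv
  rw [hardyNorm, eLpNorm_two_sq, ENNReal.ofReal_mul (sphereMoment_nonneg d),
    ofReal_integral_eq_lintegral_ofReal (H.hardy hd).1]
  · trans ∫⁻ p : Heis d, ‖((koranyi p ^ 2)⁻¹ : ℝ) • v (koranyi p)‖ₑ ^ 2 * ENNReal.ofReal (zSq p)
    · refine lintegral_congr_ae ?_
      filter_upwards [hw] with p hp
      rw [enorm_sq_eq_ofReal, enorm_sq_eq_ofReal, ← ENNReal.ofReal_mul (by positivity), hp,
        norm_smul, norm_smul, ← zNorm_sq_eq_zSq, Real.norm_eq_abs, Real.norm_eq_abs, mul_pow,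
        mul_pow, sq_abs, sq_abs, div_eq_mul_inv]
      congr 1; ring
    · rw [lintegral_sq_radial_mul_zSq hm]
      congr 1
      refine setLIntegral_congr_fun measurableSet_Ioi fun r hr => ?_
      have hr : 0 < r := hr
      rw [norm_smul, Real.norm_of_nonneg (by positivity)]
      congr 3
      field_simp
  · refine (ae_restrict_iff' measurableSet_Ioi).2 (Filter.Eventually.of_forall fun r hr => ?_)
    have hr : 0 < r := hr
    simp only [Pi.zero_apply]
    positivity

theorem le_ofReal_mul_of_sq_le {A N : ℝ≥0∞} {C Y : ℝ} (hC : 0 ≤ C)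
    (hA : A ^ 2 ≤ ENNReal.ofReal (C ^ 2 * Y)) (hN : ENNReal.ofReal Y ≤ N ^ 2) :
    A ≤ ENNReal.ofReal C * N := by
  refine (ENNReal.pow_le_pow_left_iff two_ne_zero).1 ?_
  rw [mul_pow, ← ENNReal.ofReal_pow hC]
  refine hA.trans ?_
  rw [ENNReal.ofReal_mul (sq_nonneg C)]
  exact mul_le_mul_right hN _

/-- Transfer of an estimate on the half line to radial functions on the Heisenberg group. -/
theorem norms_le_of_radial (hd : 1 ≤ d) {v h : ℝ → ℂ} (H : RadialH1 d v h) {w : Heis d → ℂ}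
    (hw : ∀ᵐ p, w p = v (koranyi p)) {C M : ℝ} {N : ℝ≥0∞} (hC : 0 ≤ C)
    (hN : ENNReal.ofReal (sphereMoment d * M ^ 2) ≤ N ^ 2)
    (hX : √(∫ r in Ioi 0, r ^ (2 * d + 1) * ‖h r‖ ^ 2) ≤ C * M) :
    hGradNorm w ≤ ENNReal.ofReal C * N ∧ hardyNorm w ≤ ENNReal.ofReal (C / d) * N := by
  have hκ := sphereMoment_nonneg d
  have hi : ∫ r in Ioi 0, r ^ (2 * d + 1) * ‖h r‖ ^ 2 ≤ C ^ 2 * M ^ 2 := by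
    rw [← mul_pow]
    exact (Real.sqrt_le_left ((Real.sqrt_nonneg _).trans hX)).1 hX
  constructor
  · refine (hGradNorm_congr_le hw).trans (le_ofReal_mul_of_sq_le hC
      ((hGradNorm_sq_radial_le hd H).trans (ENNReal.ofReal_le_ofReal ?_)) hN)
    calc _ ≤ sphereMoment d * (C ^ 2 * M ^ 2) := by gcongr
      _ = _ := by ring
  · refine le_ofReal_mul_of_sq_le (by positivity)
      ((hardyNorm_sq_radial hd H hw).le.trans (ENNReal.ofReal_le_ofReal ?_)) hN
    calc _ ≤ sphereMoment d * ((C ^ 2 * M ^ 2) / (d : ℝ) ^ 2) := by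
          gcongr
          exact (H.hardy hd).2.trans (by gcongr)
      _ = _ := by ring

theorem integrableOn_of_lintegral_lt_top {w : ℝ → ℝ}
    (hm : AEStronglyMeasurable w (volume.restrict (Ioi 0))) (h0 : ∀ r, 0 < r → 0 ≤ w r)
    (h : ∫⁻ r in Ioi 0, ENNReal.ofReal (w r) < ⊤) : IntegrableOn w (Ioi 0) := by
  refine ⟨hm, ?_⟩
  rw [hasFiniteIntegral_iff_ofReal]
  · exact h
  · exact (ae_restrict_iff' measurableSet_Ioi).2 (Filter.Eventually.of_forall h0)

theorem sphereMoment_mul_integral_source_le (hd : 1 ≤ d) {f : Heis d → ℂ}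
    (hf : LocallyIntegrable f) (hs : sourceNorm f < ⊤) :
    IntegrableOn (fun r => r ^ (2 * d + 1) * (r * ‖(sphereMoment d)⁻¹ • sphereInt f r‖) ^ 2)
      (Ioi 0) ∧
    ENNReal.ofReal (sphereMoment d *
      ∫ r in Ioi 0, r ^ (2 * d + 1) * (r * ‖(sphereMoment d)⁻¹ • sphereInt f r‖) ^ 2)
      ≤ sourceNorm f ^ 2 := by
  have hκ := (sphere_constants hd).2.1
  have hle := lintegral_source_le hd hf.aestronglyMeasurable
  have hm : AEStronglyMeasurable (sphereInt f) (volume.restrict (Ioi 0)) :=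
    (locallyIntegrable_polar hf).aestronglyMeasurable
  have e : ∀ r : ℝ, r ^ (2 * d + 1) * (r * ‖(sphereMoment d)⁻¹ • sphereInt f r‖) ^ 2
      = ((sphereMoment d)⁻¹ ^ 2) * (r ^ (2 * d + 1) * (r * ‖sphereInt f r‖) ^ 2) := fun r => by
    rw [norm_smul, Real.norm_of_nonneg (by positivity)]; ring
  have h0 : ∀ r : ℝ, 0 < r → 0 ≤ r ^ (2 * d + 1) * (r * ‖sphereInt f r‖) ^ 2 := fun r hr => by
    positivity
  have hi : IntegrableOn (fun r => r ^ (2 * d + 1) * (r * ‖sphereInt f r‖) ^ 2) (Ioi 0) := by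
    refine integrableOn_of_lintegral_lt_top ((continuous_pow _).aestronglyMeasurable.mul
      ((continuous_id.aestronglyMeasurable.mul hm.norm).pow 2)) h0 (hle.trans_lt ?_)
    exact ENNReal.mul_lt_top ENNReal.ofReal_lt_top (ENNReal.pow_lt_top hs)
  simp_rw [e]
  refine ⟨hi.const_mul _, ?_⟩
  rw [integral_const_mul, show ∀ y : ℝ, sphereMoment d * ((sphereMoment d)⁻¹ ^ 2 * y)
    = (sphereMoment d)⁻¹ * y from fun y => by field_simp, ENNReal.ofReal_mul (by positivity),
    ofReal_integral_eq_lintegral_ofReal hi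
      ((ae_restrict_iff' measurableSet_Ioi).2 (Filter.Eventually.of_forall h0))]
  refine (mul_le_mul_right hle _).trans (le_of_eq ?_)
  rw [← mul_assoc, ← ENNReal.ofReal_mul (by positivity), inv_mul_cancel₀ hκ.ne',
    ENNReal.ofReal_one, one_mul]

/-- Reduction of the radial equation to an ordinary differential equation. -/
theorem exists_radialEq (hd : 1 ≤ d) {V : Heis d → ℝ} {DV : Heis d → Heis d →L[ℝ] ℝ}
    (hV0 : ∀ᵐ p, 0 ≤ V p) (hV : HasWeakFDeriv V DV) {lam : ℂ} {f u : Heis d → ℂ}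
    (hu : IsWeakSolution V lam f u) (hrad : IsRadial u) (hs : sourceNorm f < ⊤) :
    ∃ (v p : ℝ → ℂ) (W : ℝ → ℝ), (∀ᵐ q, u q = v (koranyi q)) ∧
      (∀ᵐ r, 0 < r → sphereInt V r = sphereMoment d * W r) ∧
      RadialEq d v p (fun r => (sphereMoment d)⁻¹ • sphereInt f r) W
        (fun r => (sphereMoment d)⁻¹ * (r⁻¹ * sphereInt (eulerDeriv DV) r)) 0
        (lam.re * (sphereMass d / sphereMoment d)) (lam.im * (sphereMass d / sphereMoment d)) := by
  obtain ⟨hu2, hVu, hf, g, hg, hg2, hsol⟩ := hu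
  obtain ⟨u₀, hu₀⟩ := hrad
  obtain ⟨hS, hκ, -⟩ := sphere_constants hd
  obtain ⟨v, hv, hvu⟩ := (isWeakPrim_of_hasWeakHGrad hd hg hu₀).exists_isPrim
  have huv : ∀ᵐ q, u q = v (koranyi q) := by
    filter_upwards [hu₀, ae_koranyi hvu] with q h1 h2
    rw [h1, h2]
  obtain ⟨Q, hQ, hQe⟩ := (isWeakPrim_of_isWeakSolution hd hVu hf hg hsol huv).exists_isPrim
  obtain ⟨Z, hZ, hZe⟩ := (isWeakPrim_of_hasWeakFDeriv hV).exists_isPrim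
  -- Q is the continuous representative of r^(2d+1) times the radial slope; dividing by the weight
  -- gives a representative p of the derivative of v that is itself differentiable.
  set p : ℝ → ℂ := fun r => ((r ^ (2 * d + 1))⁻¹ : ℝ) * Q r with hp
  set W : ℝ → ℝ := fun r => (sphereMoment d)⁻¹ * (Z r).re with hW
  have hWV : ∀ᵐ r, 0 < r → sphereInt V r = sphereMoment d * W r := by
    filter_upwards [hZe] with r hr h0
    simp only [hW]
    rw [← hr h0, Complex.ofReal_re, mul_inv_cancel_left₀ hκ.ne']
  have hpg : ∀ᵐ r, 0 < r → radialSlope g r = p r := by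
    filter_upwards [hQe] with r hr h0
    rw [hp]
    simp only
    rw [← hr h0, Complex.real_smul, ← mul_assoc, ← Complex.ofReal_mul,
      inv_mul_cancel₀ (by positivity)]
    simp
  have hWp : IsPrim W (fun r => (sphereMoment d)⁻¹ * (r⁻¹ * sphereInt (eulerDeriv DV) r)) :=
    hZ.re.const_mul _
  have mv : AEStronglyMeasurable v (volume.restrict (Ioi 0)) :=
    hv.continuousOn.aestronglyMeasurable measurableSet_Ioi
  have mp : AEStronglyMeasurable p (volume.restrict (Ioi 0)) :=
    (Complex.measurable_ofReal.comp (measurable_id.pow_const _).inv).aestronglyMeasurable.mul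
      (hQ.continuousOn.aestronglyMeasurable measurableSet_Ioi)
  have hinv : IsPrim (fun r : ℝ => (r ^ (2 * d + 1))⁻¹)
      (fun r => -(2 * d + 1 : ℝ) / r * (r ^ (2 * d + 1))⁻¹) := by
    refine IsPrim.of_hasDerivAt (fun r hr => ?_) ?_
    · refine ((hasDerivAt_pow (2 * d + 1) r).inv (pow_ne_zero _ hr.ne')).congr_deriv ?_
      push_cast
      field_simp
      ring
    · refine (continuousOn_const.div continuousOn_id fun r hr => ne_of_gt hr).mul
        ((continuousOn_pow _).inv₀ fun r hr => pow_ne_zero _ (ne_of_gt hr))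
  refine ⟨v, p, W, huv, hWV,
    { hv := hv.congr_deriv hpg, mp := mp, iv := ?_, ip := ?_, hp := ?_, hW := hWp, W0 := ?_,
      mG := (locallyIntegrable_polar hf).aestronglyMeasurable.const_smul (sphereMoment d)⁻¹,
      iG := (sphereMoment_mul_integral_source_le hd hf hs).1 }⟩
  · refine integrableOn_of_lintegral_lt_top ((continuous_pow _).aestronglyMeasurable.mul
      (mv.norm.pow 2)) (fun r hr => by positivity) ?_
    have h := lintegral_lt_top_of_memLp_two hu2
    rw [lintegral_congr_ae (g := fun q => ‖v (koranyi q)‖ₑ ^ 2)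
      (by filter_upwards [huv] with q hq; rw [hq]), lintegral_sq_radial mv] at h
    exact ENNReal.lt_top_of_mul_ne_top_right h.ne (ENNReal.ofReal_pos.2 hS).ne'
  · refine integrableOn_of_lintegral_lt_top ((continuous_pow _).aestronglyMeasurable.mul
      (mp.norm.pow 2)) (fun r hr => by positivity) ?_
    rw [← lintegral_congr_ae (f := fun r => ENNReal.ofReal (r ^ (2 * d + 1) * ‖radialSlope g r‖ ^ 2))
      ((ae_restrict_iff' measurableSet_Ioi).2 (by filter_upwards [hpg] with r hr h0; rw [hr h0]))]
    exact (lintegral_radialSlope_le hd hg2.1).trans_lt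
      (ENNReal.mul_lt_top ENNReal.ofReal_lt_top (lintegral_lt_top_of_memLp_two hg2))
  · refine (hinv.ofReal.mul hQ).congr_deriv ?_
    filter_upwards [hWV] with r hr h0
    have h0 : 0 < r := h0
    have hrC : (r : ℂ) ≠ 0 := by exact_mod_cast h0.ne'
    have hκC : (sphereMoment d : ℂ) ≠ 0 := by exact_mod_cast hκ.ne'
    rw [sphereInt_ofReal, hr h0]
    simp only [hp, Complex.real_smul]
    push_cast
    field_simp
    linear_combination ((r : ℂ) ^ 2 * r ^ (2 * d) * v r * sphereMass d) * Complex.re_add_im lam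
  -- Nonnegativity of the spherical means is known for almost every r and extends to all r by
  -- continuity of W.
  · refine le_of_ae_le_of_continuousOn continuousOn_const hWp.continuousOn ?_
    filter_upwards [hWV, ae_polar hV0] with r h1 h2 h0
    have : 0 ≤ sphereInt V r := integral_nonneg_of_ae (h2 h0)
    rw [h1 h0] at this
    exact nonneg_of_mul_nonneg_right this hκ

/-- The subordination condition on `V`, tested on a radial function. -/
theorem integral_potential_le (hd : 1 ≤ d) {V : Heis d → ℝ} {DV : Heis d → Heis d →L[ℝ] ℝ}
    (hV : HasWeakFDeriv V DV) {b : ℝ}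
    (hVb : ∀ ψ : Heis d → ℂ, MemH1 ψ →
      ∫⁻ p, ENNReal.ofReal (max 0 (radialDerivMul V DV p)) * ‖ψ p‖ₑ ^ 2
        ≤ ENNReal.ofReal (b ^ 2) * hGradNorm ψ ^ 2)
    {W : ℝ → ℝ} (hW : ∀ᵐ r, 0 < r → sphereInt V r = sphereMoment d * W r)
    {v h : ℝ → ℂ} (H : RadialH1 d v h) {s t : ℝ} (hs : 0 < s) (hst : s < t) :
    ∫ r in s..t, r ^ (2 * d + 1) *
      ((W r + r * ((sphereMoment d)⁻¹ * (r⁻¹ * sphereInt (eulerDeriv DV) r))) * ‖v r‖ ^ 2)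
      ≤ b ^ 2 * ∫ r in Ioi 0, r ^ (2 * d + 1) * ‖h r‖ ^ 2 := by
  obtain ⟨hS, hκ, -⟩ := sphere_constants hd
  have lE := locallyIntegrable_eulerDeriv hV.2.1
  have hX : 0 ≤ ∫ r in Ioi 0, r ^ (2 * d + 1) * ‖h r‖ ^ 2 :=
    setIntegral_nonneg measurableSet_Ioi fun r hr => by
      have hr : 0 < r := hr
      positivity
  set T : ℝ → ℝ := fun r => r ^ (2 * d + 1) *
    ((W r + r * ((sphereMoment d)⁻¹ * (r⁻¹ * sphereInt (eulerDeriv DV) r))) * ‖v r‖ ^ 2) with hT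
  have ek : ∀ p : Heis d, 0 < koranyi p → radialDerivMul V DV p = V p + eulerDeriv DV p :=
    fun p hp => by
      rw [radialDerivMul, radialDeriv, mul_inv_cancel_left₀ hp.ne', eulerDeriv]
  have hwm : AEMeasurable fun p => ENNReal.ofReal (max 0 (radialDerivMul V DV p)) := by
    have : AEMeasurable fun p => V p + eulerDeriv DV p :=
      hV.1.aestronglyMeasurable.aemeasurable.add lE.aestronglyMeasurable.aemeasurable
    refine (aemeasurable_const.max (this.congr ?_)).ennreal_ofReal
    filter_upwards [ae_koranyi_pos] with p hp using (ek p hp).symm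
  -- The hypothesis is applied to ψ = v(ρ), and its right side is bounded by the half-line integral
  -- of |h|².
  have main := (hVb _ (memH1_radial hd H)).trans
    (mul_le_mul_right (hGradNorm_sq_radial_le hd H) _)
  simp_rw [mul_comm (ENNReal.ofReal (max 0 _))] at main
  rw [lintegral_radial_mul (e := fun r => ‖v r‖ₑ ^ 2) (H.mv.enorm.pow_const 2) hwm,
    ← ENNReal.ofReal_mul (sq_nonneg b)] at main
  have low : ∫⁻ r in Ioi 0, ENNReal.ofReal (sphereMoment d * T r)
      ≤ ENNReal.ofReal (b ^ 2 * (sphereMoment d * ∫ r in Ioi 0, r ^ (2 * d + 1) * ‖h r‖ ^ 2)) := by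
    refine le_trans (lintegral_mono_ae ((ae_restrict_iff' measurableSet_Ioi).2 ?_)) main
    filter_upwards [hW, ae_integrable_sphere hV.1, ae_integrable_sphere lE] with r h1 h2 h3 h0
    have h0 : 0 < r := h0
    have e1 : sphereMoment d * T r
        = r ^ (2 * d + 1) * (‖v r‖ ^ 2 * sphereInt (fun p => V p + eulerDeriv DV p) r) := by
      have : sphereInt (fun p => V p + eulerDeriv DV p) r
          = sphereMoment d * W r + sphereInt (eulerDeriv DV) r := by
        rw [← h1 h0]; exact integral_add (h2 h0) (h3 h0)
      rw [this]
      simp only [hT]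
      field_simp
    rw [e1, ENNReal.ofReal_mul (by positivity), ENNReal.ofReal_mul (by positivity),
      ← enorm_sq_eq_ofReal]
    refine mul_le_mul_right (mul_le_mul_right ?_ _) _
    -- The positive part of a spherical integral is at most the spherical integral of the positive
    -- part.
    refine (ENNReal.ofReal_le_ofReal (integral_mono_ae ((h2 h0).add (h3 h0))
      (((h2 h0).add (h3 h0)).sup (integrable_zero _ _ _)) (Filter.Eventually.of_forall fun ξ =>
        le_sup_left))).trans ?_
    rw [ofReal_integral_eq_lintegral_ofReal (((h2 h0).add (h3 h0)).sup (integrable_zero _ _ _))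
      (Filter.Eventually.of_forall fun ξ => le_sup_right)]
    refine lintegral_mono_ae ?_
    filter_upwards [ae_sphereMeasure] with ξ hξ
    rw [ek _ (by rwa [koranyi_dil, hξ, mul_one, abs_of_pos h0]), max_comm]
    rfl
  rw [intervalIntegral.integral_of_le hst.le]
  -- If T is not integrable, its integral is 0 by convention and the bound is trivial.
  by_cases hi : IntegrableOn T (Ioc s t)
  swap
  · rw [integral_undef hi]; positivity
  have hle : ∫ r in Ioc s t, sphereMoment d * T r
      ≤ b ^ 2 * (sphereMoment d * ∫ r in Ioi 0, r ^ (2 * d + 1) * ‖h r‖ ^ 2) := by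
    rw [integral_eq_lintegral_pos_part_sub_lintegral_neg_part (hi.const_mul _)]
    refine (sub_le_self _ ENNReal.toReal_nonneg).trans ?_
    refine ENNReal.toReal_le_of_le_ofReal (by positivity) (le_trans ?_ low)
    exact lintegral_mono_set fun x hx => hs.trans hx.1
  rw [integral_const_mul] at hle
  have : sphereMoment d * ∫ r in Ioc s t, T r
      ≤ sphereMoment d * (b ^ 2 * ∫ r in Ioi 0, r ^ (2 * d + 1) * ‖h r‖ ^ 2) := by
    linarith
  exact le_of_mul_le_mul_left this hκ

end Heisenberg

/-! ### The estimates for radial solutions. -/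

namespace Heisenberg

open HalfLine

variable {d : ℕ}

/-- The phase equals kρ with k² = |λ₁|S/κ, which is the modulation that removes the real spectral
parameter of the radial equation when λ₁ ≥ 0. -/
theorem uMinus_radial (hd : 1 ≤ d) (lam : ℂ) {u : Heis d → ℂ} {v : ℝ → ℂ}
    (hu : ∀ᵐ q, u q = v (koranyi q)) :
    ∀ᵐ q, uMinus lam u q = Complex.exp (-(Complex.I *
      ((sgn lam.im * √(|lam.re| * (sphereMass d / sphereMoment d)) * koranyi q : ℝ) : ℂ)))
        * v (koranyi q) := by
  filter_upwards [hu] with q hq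
  rw [uMinus, hq, phase, sqrt_mul_gamma_ratio hd, Real.sqrt_mul (abs_nonneg _)]
  congr 5
  ring

theorem hardyNorm_uMinus (lam : ℂ) (u : Heis d → ℂ) : hardyNorm (uMinus lam u) = hardyNorm u := by
  refine eLpNorm_congr_norm_ae (Filter.Eventually.of_forall fun p => ?_)
  rw [norm_smul, norm_smul, uMinus, norm_mul, Complex.norm_exp]
  simp

theorem sgn_mul_self (w : ℝ) : sgn w * sgn w = 1 := by
  unfold sgn
  split_ifs with h
  · norm_num
  · rw [div_mul_div_comm, abs_mul_abs_self, div_self (mul_self_ne_zero.2 h)]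

theorem abs_mul_sgn (w : ℝ) : |w| * sgn w = w := by
  unfold sgn
  split_ifs with h
  · simp [h]
  · rw [mul_div_cancel₀ _ (abs_ne_zero.2 h)]

/-- The estimates for radial solutions, when the weighted norm of the source is finite. -/
theorem radial_estimates (hd : 1 ≤ d) {V : Heis d → ℝ} {DV : Heis d → Heis d →L[ℝ] ℝ}
    (hV0 : ∀ᵐ p, 0 ≤ V p) (hV : HasWeakFDeriv V DV) {b : ℝ} (hb0 : 0 ≤ b) (hb1 : b < 1)
    (hVb : ∀ ψ : Heis d → ℂ, MemH1 ψ →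
      ∫⁻ p, ENNReal.ofReal (max 0 (radialDerivMul V DV p)) * ‖ψ p‖ₑ ^ 2
        ≤ ENNReal.ofReal (b ^ 2) * hGradNorm ψ ^ 2)
    {lam : ℂ} {f u : Heis d → ℂ} (hu : IsWeakSolution V lam f u) (hrad : IsRadial u)
    (hs : sourceNorm f < ⊤) {δ : ℝ} (hδ : 0 < δ) :
    (δ * lam.re ≤ |lam.im| →
      hGradNorm u ≤ ENNReal.ofReal ((1 + 1 / δ) / d) * sourceNorm f ∧
      hardyNorm u ≤ ENNReal.ofReal ((1 + 1 / δ) / d / d) * sourceNorm f) ∧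
    (|lam.im| ≤ δ * lam.re →
      hGradNorm (uMinus lam u) ≤ ENNReal.ofReal (K d b δ) * sourceNorm f ∧
      hardyNorm u ≤ ENNReal.ofReal (K d b δ / d) * sourceNorm f) := by
  obtain ⟨v, p, W, huv, hW, H⟩ := exists_radialEq hd hV0 hV hu hrad hs
  obtain ⟨hS, hκ, -⟩ := sphere_constants hd
  have hc : 0 < sphereMass d / sphereMoment d := div_pos hS hκ
  have hN := (sphereMoment_mul_integral_source_le hd hu.2.2.1 hs).2
  set c := sphereMass d / sphereMoment d with hcdef
  set I := ∫ r in Ioi 0, r ^ (2 * d + 1) * (r * ‖(sphereMoment d)⁻¹ • sphereInt f r‖) ^ 2 with hI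
  have hI0 : 0 ≤ I := setIntegral_nonneg measurableSet_Ioi fun r hr => by
    have hr : 0 < r := hr
    positivity
  rw [← Real.sq_sqrt hI0] at hN
  constructor
  · intro h
    refine norms_le_of_radial hd H.toRadialH1 huv (by positivity) hN (H.sectorial hd hδ ?_)
    rw [abs_mul, abs_of_pos hc, ← mul_assoc]
    exact mul_le_mul_of_nonneg_right h hc.le
  · intro h
    have hre : 0 ≤ lam.re := by
      have := (abs_nonneg _).trans h
      exact nonneg_of_mul_nonneg_right this hδ
    set s := √(|lam.re| * c) with hsdef
    have hss : s ^ 2 = lam.re * c := by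
      rw [hsdef, Real.sq_sqrt (by positivity), abs_of_nonneg hre]
    have hs0 : 0 ≤ s := Real.sqrt_nonneg _
    set k := sgn lam.im * s with hk
    have hk2 : lam.re * c = k ^ 2 := by
      rw [hk, mul_pow, sq (sgn _), sgn_mul_self, one_mul, hss]
    -- The sign of k is chosen so that τ ≥ 0. If s = 0, then λ₁ = 0 and the sector condition forces
    -- λ₂ = 0, while division by zero gives τ = 0.
    set τ := |lam.im| * c / s with hτ
    have hτ0 : 0 ≤ τ := by positivity
    have hτk : lam.im * c = τ * k := by
      rcases hs0.eq_or_lt with h0 | h0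
      · have hre0 : lam.re = 0 := by
          rw [← h0] at hss
          have : lam.re * c = 0 := by rw [← hss]; ring
          exact (mul_eq_zero.1 this).resolve_right hc.ne'
        rw [hre0, mul_zero] at h
        rw [abs_nonpos_iff.1 h, hk, ← h0]; ring
      · rw [hτ, hk]
        nth_rewrite 1 [← abs_mul_sgn lam.im]
        field_simp
    have Hm := H.modulate hk2
    rw [hτk] at Hm
    -- For λ₁ > 0 one has τ² = |τk||λ₂|/λ₁, so this is the sector condition.
    have hτ2 : τ ^ 2 ≤ δ * |τ * k| := by
      rw [← hτk, abs_mul, abs_of_pos hc]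
      rcases hs0.eq_or_lt with h0 | h0
      · rw [hτ, ← h0, div_zero, zero_pow two_ne_zero]; positivity
      · rw [hτ, div_pow, div_le_iff₀ (by positivity), hss]
        have := mul_le_mul_of_nonneg_right h (by positivity : 0 ≤ |lam.im| * c ^ 2)
        linarith
    obtain ⟨T, hT0, hT1, hT2⟩ := Hm.morawetz hd hτ0 hτ2 hδ.le fun s t h1 h2 =>
      integral_potential_le hd hV hVb hW Hm.toRadialH1 h1 h2
    have hn : ∀ r : ℝ, ‖Complex.exp (-(Complex.I * (k * r : ℝ)))‖ = 1 := fun r => by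
      rw [Complex.norm_exp]; simp
    simp only [norm_mul (Complex.exp _) (_ • _), hn, one_mul] at hT1 hT2
    have hle := le_K_mul hd hb0 hb1 hδ (Real.sqrt_nonneg _) (Real.sqrt_nonneg _) hT1 hT2
    rw [← hardyNorm_uMinus lam u]
    exact norms_le_of_radial hd Hm.toRadialH1 (uMinus_radial hd lam huv)
      (K_pos hd hb0 hb1 hδ).le hN hle

end Heisenberg

theorem theorem2p3 (d : ℕ) (hd : 1 ≤ d)
    (V : Heisenberg.Heis d → ℝ) (DV : Heisenberg.Heis d → Heisenberg.Heis d →L[ℝ] ℝ)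
    (hV0 : ∀ᵐ p, 0 ≤ V p)
    (hVloc : LocallyIntegrable V)
    (hVW : Heisenberg.MemW1Loc V DV (d : ℝ≥0∞))
    (b : ℝ) (hb0 : 0 ≤ b) (hb1 : b < 1)
    (hVb : ∀ ψ : Heisenberg.Heis d → ℂ, Heisenberg.MemH1 ψ →
      ∫⁻ p, ENNReal.ofReal (max 0 (Heisenberg.radialDerivMul V DV p)) * ‖ψ p‖ₑ ^ 2
        ≤ ENNReal.ofReal (b ^ 2) * Heisenberg.hGradNorm ψ ^ 2)
    (lam : ℂ) (f u : Heisenberg.Heis d → ℂ)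
    (hu : Heisenberg.IsWeakSolution V lam f u)
    (hrad : Heisenberg.IsRadial u) :
    (∀ δ : ℝ, 0 < δ →
      (δ * lam.re < |lam.im| →
        Heisenberg.hGradNorm u
          ≤ ENNReal.ofReal ((1 + 1 / δ) / d) * Heisenberg.sourceNorm f) ∧
      (|lam.im| ≤ δ * lam.re →
        Heisenberg.hGradNorm (Heisenberg.uMinus lam u)
          ≤ ENNReal.ofReal (Heisenberg.K d b δ) * Heisenberg.sourceNorm f)) ∧
    Heisenberg.hardyNorm u
      ≤ ENNReal.ofReal (Heisenberg.kappa d b) * Heisenberg.sourceNorm f ∧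
    (∀ δ : ℝ, 0 < δ →
      IsLeast (Heisenberg.kFun d b δ '' Ioi 0) (Heisenberg.K d b δ)) ∧
    IsLeast (Heisenberg.kappaFun d b '' Ioi 0) (Heisenberg.kappa d b) := by
  have hd' : (0 : ℝ) < d := by exact_mod_cast hd
  have hK : ∀ δ : ℝ, 0 < δ → IsLeast (Heisenberg.kFun d b δ '' Ioi 0) (Heisenberg.K d b δ) :=
    fun δ hδ => Heisenberg.isLeast_K hd hb0 hb1 hδ
  have hkappa := Heisenberg.isLeast_kappa (d := d) hd hb0 hb1
  obtain ⟨δ₀, hδ₀, hmin⟩ := hkappa.1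
  have hδ₀ : 0 < δ₀ := hδ₀
  have h1 : (1 + 1 / δ₀) / d / d ≤ Heisenberg.kappa d b := by
    rw [← hmin, div_div, ← sq]
    exact le_max_left _ _
  have h2 : Heisenberg.K d b δ₀ / d ≤ Heisenberg.kappa d b := by
    rw [← hmin]
    exact le_max_right _ _
  have hk0 : 0 < Heisenberg.kappa d b := lt_of_lt_of_le (by positivity) h1
  -- When the norm of f is infinite, the right sides are infinite because the constants are strictly
  -- positive.
  rcases lt_or_ge (Heisenberg.sourceNorm f) ⊤ with hs | hs
  · have main := fun (δ : ℝ) (hδ : 0 < δ) =>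
      Heisenberg.radial_estimates hd hV0 hVW.1 hb0 hb1 hVb hu hrad hs hδ
    refine ⟨fun δ hδ => ⟨fun h => ((main δ hδ).1 h.le).1, fun h => ((main δ hδ).2 h).1⟩, ?_, hK,
      hkappa⟩
    -- At the minimising δ₀ one of the two cases applies, and its Hardy constant is at most kappa.
    rcases le_total (δ₀ * lam.re) |lam.im| with h | h
    · exact ((main δ₀ hδ₀).1 h).2.trans (mul_le_mul_left (ENNReal.ofReal_le_ofReal h1) _)
    · exact ((main δ₀ hδ₀).2 h).2.trans (mul_le_mul_left (ENNReal.ofReal_le_ofReal h2) _)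
  · have top : ∀ {c : ℝ} {A : ℝ≥0∞}, 0 < c →
        A ≤ ENNReal.ofReal c * Heisenberg.sourceNorm f := fun hc => by
      rw [top_le_iff.1 hs, ENNReal.mul_top (ENNReal.ofReal_pos.2 hc).ne']
      exact le_top
    exact ⟨fun δ hδ => ⟨fun _ => top (by positivity),
      fun _ => top (Heisenberg.K_pos hd hb0 hb1 hδ)⟩, top hk0, hK, hkappa⟩
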